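/- **Theorem 1.** Let $n\ge 1$, $\mathcal V=\{1,\dots,n\}$, let $\mathcal S\subseteq\mathcal V$ be a nonempty set of noise-driven agents, let $\epsilon\in(0,1]$ and $x(0)\in[0,1]^n$. Let $\{\xi_i(t)\}_{i\in\mathcal V,\,t\ge 1}$ be i.i.d. real random variables on a probability space with $E\,\xi_1(1)=0$ and $0<E\,\xi_1^2(1)<\infty$. For $i\in\mathcal V$ and $t\ge 0$ put $$\mathcal N(i,x(t))=\{j\in\mathcal V:\ |x_j(t)-x_i(t)|\le\epsilon\},\qquad x_i^*(t)=\frac{1}{|\mathcal N(i,x(t))|}\sum_{j\in\mathcal N(i,x(t))}x_j(t)+I_{\{i\in\mathcal S\}}\,\xi_i(t+1),$$ and let $x_i(t+1)$ be $1$ if $x_i^*(t)>1$, $x_i^*(t)$ if $x_i^*(t)\in[0,1]$, and $0$ if $x_i^*(t)<0$. Let $d_{\mathcal V}(t)=\max_{i,j\in\mathcal V}|x_i(t)-x_j(t)|$ and $T=\min\{t:\ d_{\mathcal V}(t')\le\epsilon \text{ for all } t'\ge t\}$, with $T=\infty$ if there is no such $t$. (i) If $P\{|\xi_1(1)|\le\epsilon\}=1$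 when $|\mathcal S|=1$, or $P\{|\xi_1(1)|\le\epsilon/2\}=1$ when $|\mathcal S|>1$, then almost surely the system attains a quasi-consensus in finite time, that is, $P\{T<\infty\}=1$. (ii) Suppose in addition that $n\ge 2$ and $\epsilon<1$. If $P\{\xi_1(1)>\epsilon\}>0$ and $P\{\xi_1(1)<-\epsilon\}>0$ when $|\mathcal S|=1$, or $P\{\xi_1(1)>\epsilon/2\}>0$ and $P\{\xi_1(1)<-\epsilon/2\}>0$ when $|\mathcal S|>1$, then almost surely the system cannot reach a quasi-consensus, that is, $P\{\limsup_{t\to\infty}d_{\mathcal V}(t)\le\epsilon\}=0$. -/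

import Mathlib

open MeasureTheory ProbabilityTheory Filter

noncomputable section

/-- The neighbour set `N(i, x) = {j | |x_j - x_i| ≤ ε}` of agent `i` in the opinion profile `x`. -/
def neighbors {n : ℕ} (ε : ℝ) (x : Fin n → ℝ) (i : Fin n) : Finset (Fin n) :=
  {j | |x j - x i| ≤ ε}

/-- The average opinion of the neighbours of agent `i`. -/
def localMean {n : ℕ} (ε : ℝ) (x : Fin n → ℝ) (i : Fin n) : ℝ :=
  ((neighbors ε x i).card : ℝ)⁻¹ * ∑ j ∈ neighbors ε x i, x j

/-- Truncation to `[0, 1]`: `1` if `y > 1`, `0` if `y < 0`, and `y` otherwise. -/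
def clip (y : ℝ) : ℝ := max 0 (min 1 y)

/-- One step of the noisy Hegselmann-Krause dynamics with noise values `u`, acting only on the
agents of `S`. -/
def hkStep {n : ℕ} (ε : ℝ) (S : Finset (Fin n)) (x u : Fin n → ℝ) (i : Fin n) : ℝ :=
  clip (localMean ε x i + if i ∈ S then u i else 0)

/-- The opinions `x_i(t)` started from `x0`, for a realization `ξ` of the noise:
`x(t + 1)` is obtained from `x(t)` with the noise `ξ_i(t + 1)`. The value `ξ i 0` is never used. -/
def hkState {n : ℕ} (ε : ℝ) (S : Finset (Fin n)) (x0 : Fin n → ℝ) (ξ : Fin n → ℕ → ℝ) :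
    ℕ → Fin n → ℝ
  | 0 => x0
  | t + 1 => hkStep ε S (hkState ε S x0 ξ t) (fun i => ξ i (t + 1))

/-- The opinion diameter `max_{i,j} |x_i - x_j|`. -/
def opinionDiam {n : ℕ} (x : Fin n → ℝ) : ℝ :=
  ⨆ p : Fin n × Fin n, |x p.1 - x p.2|

/-- Quasi-consensus of a trajectory: `limsup_{t → ∞} d(t) ≤ ε`. -/
def QuasiConsensus {n : ℕ} (ε : ℝ) (x : ℕ → Fin n → ℝ) : Prop :=
  limsup (fun t => opinionDiam (x t)) atTop ≤ ε

/-- `T = min {t | d(t') ≤ ε for all t' ≥ t}`, which is `⊤` if there is no such `t`. -/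
def consensusTime {n : ℕ} (ε : ℝ) (x : ℕ → Fin n → ℝ) : ℕ∞ :=
  sInf {τ : ℕ∞ | ∃ t : ℕ, τ = t ∧ ∀ t' ≥ t, opinionDiam (x t') ≤ ε}

end

/-! ### Local averages, truncation and diameter -/

/-! Both parts reduce to a game. At each step a controller decides which noisy agents receive noise
from a set `Ip` and which from a set `Im`, and an adversary picks the values inside these sets.
`Forces` says that a target is reached within L steps against every adversary, and `Leads` that L is
uniform over the starting states. If `Ip` and `Im` have positive probability, independence gives
every block of L steps a chance of success bounded below, whatever the past. Hence almost surely the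
process does not avoid the target from some time on (`measure_eventually_mem_eq_zero`).

Part (i): once the diameter is at most ε, all local means coincide and the next opinions differ by
at most the difference of the noises, so the bound persists. It suffices to force it once. Mean zero
and positive variance make noise above some a > 0 and noise below -a both possible. Part (ii):
quasi-consensus bounds the diameter eventually by ε + e for every e > 0, so it suffices to force a
diameter above ε + e for one e > 0.

The common tool is `exists_settled`: under persistent upward noise the opinions form clusters of
width η that are more than ε apart, with all noisy agents near 1. For (i) with noise at most ε/2
(`leads_opinionDiam_le_of_half`), the controller keeps everyone in the current hull. If the hull did
not shrink, the noisy agents would be trapped well below its top while being pushed up, against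
`exists_settled`. The last passage, from ε + c to ε, uses an agent in the interior of the hull. For
(i) with one noisy agent (`leads_opinionDiam_le_of_singleton`), noise-free agents that agree do so
forever, and the noisy agent can draw two clusters together until they merge. For (ii), a lone noisy
agent jumps away from the rest (`leads_lt_opinionDiam_of_singleton`). Two noisy agents are pushed in
opposite directions (`leads_lt_opinionDiam_of_large`, `leads_lt_opinionDiam_of_half`), after the
common mean has been moved to where truncation does no harm. -/

lemma mem_neighbors {n : ℕ} {ε : ℝ} {x : Fin n → ℝ} {i j : Fin n} :
    j ∈ neighbors ε x i ↔ |x j - x i| ≤ ε := by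
  simp [neighbors]

lemma self_mem_neighbors {n : ℕ} {ε : ℝ} (hε : 0 ≤ ε) (x : Fin n → ℝ) (i : Fin n) :
    i ∈ neighbors ε x i := by
  simpa [mem_neighbors] using hε

lemma card_neighbors_pos {n : ℕ} {ε : ℝ} (hε : 0 ≤ ε) (x : Fin n → ℝ) (i : Fin n) :
    (0 : ℝ) < (neighbors ε x i).card :=
  Nat.cast_pos.2 (Finset.card_pos.2 ⟨i, self_mem_neighbors hε x i⟩)

lemma card_neighbors_le {n : ℕ} (ε : ℝ) (x : Fin n → ℝ) (i : Fin n) :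
    ((neighbors ε x i).card : ℝ) ≤ n := by
  have := Finset.card_le_univ (neighbors ε x i)
  rw [Fintype.card_fin] at this
  exact_mod_cast this

lemma localMean_eq_div {n : ℕ} (ε : ℝ) (x : Fin n → ℝ) (i : Fin n) :
    localMean ε x i = (∑ j ∈ neighbors ε x i, x j) / (neighbors ε x i).card := by
  rw [localMean, div_eq_inv_mul]

/-- A neighbour has weight at least 1/n in the mean, so a single neighbour at depth θ below the
bound pulls the mean down by θ/n. All quantitative progress in the steering comes from this estimate
and its mirror image `le_localMean_add`. -/
lemma localMean_le_sub {n : ℕ} {ε : ℝ} (hε : 0 ≤ ε) {x : Fin n → ℝ} {i k : Fin n} {B θ : ℝ}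
    (h : ∀ j, |x j - x i| ≤ ε → x j ≤ B) (hk : |x k - x i| ≤ ε) (hθ : 0 ≤ θ)
    (hxk : x k ≤ B - θ) : localMean ε x i ≤ B - θ / n := by
  have hc := card_neighbors_pos hε x i
  rw [localMean_eq_div, div_le_iff₀ hc]
  have h1 : ∑ j ∈ neighbors ε x i, x j ≤
      ∑ j ∈ neighbors ε x i, (B - if j = k then θ else 0) := by
    refine Finset.sum_le_sum fun j hj => ?_
    split_ifs with hjk
    · rw [hjk]; exact hxk
    · simpa using h j (mem_neighbors.1 hj)
  rw [Finset.sum_sub_distrib, Finset.sum_ite_eq' _ k, if_pos (mem_neighbors.2 hk)] at h1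
  simp only [Finset.sum_const, nsmul_eq_mul] at h1
  have hn : (0 : ℝ) < n := hc.trans_le (card_neighbors_le ε x i)
  have h2 : θ / n * (neighbors ε x i).card ≤ θ := by
    rw [div_mul_eq_mul_div, div_le_iff₀ hn]
    exact mul_le_mul_of_nonneg_left (card_neighbors_le ε x i) hθ
  nlinarith

lemma localMean_le {n : ℕ} {ε : ℝ} (hε : 0 ≤ ε) {x : Fin n → ℝ} {i : Fin n} {B : ℝ}
    (h : ∀ j, |x j - x i| ≤ ε → x j ≤ B) : localMean ε x i ≤ B := by
  have hi : |x i - x i| ≤ ε := by simpa using hε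
  simpa using localMean_le_sub hε h hi le_rfl (by simpa using h i hi)

lemma neighbors_one_sub {n : ℕ} (ε : ℝ) (x : Fin n → ℝ) (i : Fin n) :
    neighbors ε (fun j => 1 - x j) i = neighbors ε x i := by
  ext j
  rw [mem_neighbors, mem_neighbors, ← abs_neg]
  congr! 2
  ring

lemma localMean_one_sub {n : ℕ} {ε : ℝ} (hε : 0 ≤ ε) (x : Fin n → ℝ) (i : Fin n) :
    localMean ε (fun j => 1 - x j) i = 1 - localMean ε x i := by
  have hc := card_neighbors_pos hε x i
  rw [localMean_eq_div, localMean_eq_div, neighbors_one_sub, Finset.sum_sub_distrib]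
  simp only [Finset.sum_const, nsmul_eq_mul, mul_one]
  field_simp

lemma le_localMean_add {n : ℕ} {ε : ℝ} (hε : 0 ≤ ε) {x : Fin n → ℝ} {i k : Fin n} {B θ : ℝ}
    (h : ∀ j, |x j - x i| ≤ ε → B ≤ x j) (hk : |x k - x i| ≤ ε) (hθ : 0 ≤ θ)
    (hxk : B + θ ≤ x k) : B + θ / n ≤ localMean ε x i := by
  have key := localMean_le_sub (x := fun j => 1 - x j) (i := i) (k := k) (B := 1 - B) (θ := θ) hε
    (fun j hj => by
      have := h j (by rw [← abs_neg]; convert hj using 2; ring)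
      linarith)
    (by rw [← abs_neg]; convert hk using 2; ring) hθ (by linarith)
  rw [localMean_one_sub hε] at key
  linarith

lemma le_localMean {n : ℕ} {ε : ℝ} (hε : 0 ≤ ε) {x : Fin n → ℝ} {i : Fin n} {B : ℝ}
    (h : ∀ j, |x j - x i| ≤ ε → B ≤ x j) : B ≤ localMean ε x i := by
  have hi : |x i - x i| ≤ ε := by simpa using hε
  simpa using le_localMean_add hε h hi le_rfl (by simpa using h i hi)

lemma localMean_congr {n : ℕ} {ε : ℝ} {x : Fin n → ℝ} {i j : Fin n}
    (h : ∀ k, |x k - x i| ≤ ε ↔ |x k - x j| ≤ ε) : localMean ε x i = localMean ε x j := by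
  have : neighbors ε x i = neighbors ε x j := by
    ext k; rw [mem_neighbors, mem_neighbors, h]
  rw [localMean, localMean, this]

lemma localMean_eq_of_eq {n : ℕ} {ε : ℝ} {x : Fin n → ℝ} {i j : Fin n}
    (h : x i = x j) : localMean ε x i = localMean ε x j :=
  localMean_congr fun k => by rw [h]

/-- All opinions lie in `[0, 1]`. -/
def InCube {n : ℕ} (x : Fin n → ℝ) : Prop := ∀ i, 0 ≤ x i ∧ x i ≤ 1

lemma InCube.localMean_nonneg {n : ℕ} {ε : ℝ} (hε : 0 ≤ ε) {x : Fin n → ℝ} (hx : InCube x)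
    (i : Fin n) : 0 ≤ localMean ε x i :=
  le_localMean hε fun j _ => (hx j).1

lemma InCube.localMean_le_one {n : ℕ} {ε : ℝ} (hε : 0 ≤ ε) {x : Fin n → ℝ} (hx : InCube x)
    (i : Fin n) : localMean ε x i ≤ 1 :=
  localMean_le hε fun j _ => (hx j).2

lemma clip_nonneg (y : ℝ) : 0 ≤ clip y := le_max_left _ _

lemma clip_le_one (y : ℝ) : clip y ≤ 1 := max_le zero_le_one (min_le_left _ _)

lemma clip_of_mem {y : ℝ} (h0 : 0 ≤ y) (h1 : y ≤ 1) : clip y = y := by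
  rw [clip, min_eq_right h1, max_eq_right h0]

lemma min_le_clip (y : ℝ) : min 1 y ≤ clip y := le_max_right _ _

lemma clip_le_max (y : ℝ) : clip y ≤ max 0 y := max_le_max le_rfl (min_le_right _ _)

lemma clip_of_one_le {y : ℝ} (h : 1 ≤ y) : clip y = 1 := by
  rw [clip, min_eq_left h, max_eq_right zero_le_one]

lemma clip_of_nonpos {y : ℝ} (h : y ≤ 0) : clip y = 0 := by
  rw [clip, min_eq_right (h.trans zero_le_one), max_eq_left h]

lemma abs_clip_sub_clip_le (y z : ℝ) : |clip y - clip z| ≤ |y - z| := by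
  unfold clip
  refine (abs_max_sub_max_le_max _ _ _ _).trans ?_
  simp only [sub_self, abs_zero]
  refine max_le (abs_nonneg _) ((abs_min_sub_min_le_max _ _ _ _).trans ?_)
  simp

lemma clip_one_sub (y : ℝ) : clip (1 - y) = 1 - clip y := by
  rcases le_total y 0 with h | h
  · rw [clip_of_nonpos h, clip_of_one_le (by linarith)]; simp
  · rcases le_total y 1 with h' | h'
    · rw [clip_of_mem h h', clip_of_mem (by linarith) (by linarith)]
    · rw [clip_of_one_le h', clip_of_nonpos (by linarith)]; simp

lemma inCube_hkStep {n : ℕ} (ε : ℝ) (S : Finset (Fin n)) (x u : Fin n → ℝ) :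
    InCube (hkStep ε S x u) :=
  fun _ => ⟨clip_nonneg _, clip_le_one _⟩

lemma InCube.one_sub {n : ℕ} {x : Fin n → ℝ} (hx : InCube x) : InCube (fun i => 1 - x i) :=
  fun i => ⟨by linarith [(hx i).2], by linarith [(hx i).1]⟩

lemma hkStep_one_sub {n : ℕ} {ε : ℝ} (hε : 0 ≤ ε) (S : Finset (Fin n)) (x u : Fin n → ℝ) :
    hkStep ε S (fun i => 1 - x i) (fun i => -u i) = fun i => 1 - hkStep ε S x u i := by
  funext i
  unfold hkStep
  rw [localMean_one_sub hε, ← clip_one_sub]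
  congr 1
  split_ifs <;> ring

lemma hkStep_of_notMem {n : ℕ} {ε : ℝ} (hε : 0 ≤ ε) {S : Finset (Fin n)} {x : Fin n → ℝ}
    (hx : InCube x) (u : Fin n → ℝ) {i : Fin n} (hi : i ∉ S) :
    hkStep ε S x u i = localMean ε x i := by
  rw [hkStep, if_neg hi, add_zero,
    clip_of_mem (hx.localMean_nonneg hε i) (hx.localMean_le_one hε i)]

lemma hkStep_of_mem {n : ℕ} {ε : ℝ} {S : Finset (Fin n)} {x : Fin n → ℝ}
    (u : Fin n → ℝ) {i : Fin n} (hi : i ∈ S) :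
    hkStep ε S x u i = clip (localMean ε x i + u i) := by
  rw [hkStep, if_pos hi]

lemma opinionDiam_le_iff {n : ℕ} [NeZero n] {x : Fin n → ℝ} {r : ℝ} :
    opinionDiam x ≤ r ↔ ∀ i j, |x i - x j| ≤ r := by
  constructor
  · intro h i j
    exact (le_ciSup (f := fun p : Fin n × Fin n => |x p.1 - x p.2|)
      (Set.finite_range _).bddAbove (i, j)).trans h
  · intro h
    exact ciSup_le fun p => h p.1 p.2

lemma lt_opinionDiam_of {n : ℕ} [NeZero n] {x : Fin n → ℝ} {r : ℝ} (i j : Fin n)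
    (h : r < x i - x j) : r < opinionDiam x := by
  refine lt_of_lt_of_le h ((le_abs_self _).trans ?_)
  exact opinionDiam_le_iff.1 le_rfl i j

lemma opinionDiam_one_sub {n : ℕ} (x : Fin n → ℝ) :
    opinionDiam (fun i => 1 - x i) = opinionDiam x := by
  unfold opinionDiam
  congr! 2 with p
  rw [← abs_neg]
  congr 1
  ring

lemma InCube.opinionDiam_le_one {n : ℕ} [NeZero n] {x : Fin n → ℝ} (hx : InCube x) :
    opinionDiam x ≤ 1 :=
  opinionDiam_le_iff.2 fun i j =>
    abs_le.2 ⟨by linarith [(hx i).1, (hx j).2], by linarith [(hx i).2, (hx j).1]⟩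

lemma opinionDiam_nonneg {n : ℕ} (x : Fin n → ℝ) : 0 ≤ opinionDiam x :=
  Real.iSup_nonneg fun _ => abs_nonneg _

/-- The average of all opinions. -/
noncomputable def globalMean {n : ℕ} (x : Fin n → ℝ) : ℝ := (∑ j, x j) / n

lemma localMean_eq_globalMean {n : ℕ} {ε : ℝ} {x : Fin n → ℝ} {i : Fin n}
    (h : ∀ j, |x j - x i| ≤ ε) : localMean ε x i = globalMean x := by
  have : neighbors ε x i = Finset.univ := by
    ext j; simpa [mem_neighbors] using h j
  rw [localMean_eq_div, this, globalMean, Finset.card_univ, Fintype.card_fin]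

lemma localMean_eq_globalMean_of_opinionDiam_le {n : ℕ} [NeZero n] {ε : ℝ} {x : Fin n → ℝ}
    (h : opinionDiam x ≤ ε) (i : Fin n) : localMean ε x i = globalMean x :=
  localMean_eq_globalMean fun j => opinionDiam_le_iff.1 h j i

/-! ### Steering by choosing the signs of the noise -/

/-- The noise values `u` with `u i ∈ Ip` for the noisy agents of `J` and `u i ∈ Im` for the other
noisy agents. -/
def signControl {n : ℕ} (S : Finset (Fin n)) (Ip Im : Set ℝ) (J : Set (Fin n)) :
    Set (Fin n → ℝ) :=
  {u | ∀ i ∈ S, (i ∈ J → u i ∈ Ip) ∧ (i ∉ J → u i ∈ Im)}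

/-- Within `L` steps one can force the state into `G`, where in each step one prescribes which
noisy agents receive noise from `Ip` and which from `Im`. -/
def Forces {n : ℕ} (ε : ℝ) (S : Finset (Fin n)) (Ip Im : Set ℝ) (G : (Fin n → ℝ) → Prop) :
    ℕ → (Fin n → ℝ) → Prop
  | 0, x => G x
  | L + 1, x => G x ∨ ∃ J : Set (Fin n), ∀ u ∈ signControl S Ip Im J,
      Forces ε S Ip Im G L (hkStep ε S x u)

section Forces

variable {n : ℕ} {ε : ℝ} {S : Finset (Fin n)} {Ip Im : Set ℝ} {G H K : (Fin n → ℝ) → Prop}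

lemma Forces.of_target {x : Fin n → ℝ} (h : G x) (L : ℕ) : Forces ε S Ip Im G L x := by
  cases L with
  | zero => exact h
  | succ L => exact Or.inl h

lemma Forces.trans {L M : ℕ} {x : Fin n → ℝ} (h : Forces ε S Ip Im G L x) (hx : InCube x)
    (hG : ∀ y, InCube y → G y → Forces ε S Ip Im H M y) : Forces ε S Ip Im H (L + M) x := by
  induction L generalizing x with
  | zero => rw [zero_add]; exact hG x hx h
  | succ L ih =>
    -- Idle steps may be appended. `Forces.mono` is itself deduced from the present lemma, hence the
    -- separate induction.
    have mono : ∀ (k M : ℕ) (y : Fin n → ℝ), Forces ε S Ip Im H M y →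
        Forces ε S Ip Im H (M + k) y := by
      intro k M
      induction M with
      | zero => intro y hy; exact Forces.of_target hy _
      | succ M ih =>
        intro y hy
        rw [Nat.succ_add]
        rcases hy with hy | ⟨J, hJ⟩
        · exact Or.inl hy
        · exact Or.inr ⟨J, fun u hu => ih _ (hJ u hu)⟩
    rcases h with h | ⟨J, hJ⟩
    · rw [add_comm]; exact mono _ _ _ (hG x hx h)
    · rw [Nat.succ_add]
      exact Or.inr ⟨J, fun u hu => ih (hJ u hu) (inCube_hkStep ε S x u)⟩

lemma Forces.mono_target {L : ℕ} {x : Fin n → ℝ} (h : Forces ε S Ip Im G L x) (hx : InCube x)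
    (hG : ∀ y, InCube y → G y → H y) : Forces ε S Ip Im H L x :=
  h.trans (M := 0) hx fun y hy hGy => hG y hy hGy

lemma Forces.mono {L M : ℕ} (hLM : L ≤ M) {x : Fin n → ℝ} (h : Forces ε S Ip Im G L x)
    (hx : InCube x) : Forces ε S Ip Im G M x := by
  obtain ⟨k, rfl⟩ := Nat.exists_eq_add_of_le hLM
  exact h.trans hx fun y _ hy => Forces.of_target hy k

lemma Forces.step {x : Fin n → ℝ} (J : Set (Fin n))
    (h : ∀ u ∈ signControl S Ip Im J, G (hkStep ε S x u)) : Forces ε S Ip Im G 1 x :=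
  Or.inr ⟨J, h⟩

/-- A quantity that can only shrink along the dynamics may be carried along. -/
lemma Forces.and_of_monotone {ι : Type*} [Preorder ι] {f : (Fin n → ℝ) → ι}
    (hf : ∀ x u, InCube x → f (hkStep ε S x u) ≤ f x) {L : ℕ} {x : Fin n → ℝ}
    (h : Forces ε S Ip Im G L x) (hx : InCube x) :
    Forces ε S Ip Im (fun y => G y ∧ f y ≤ f x) L x := by
  suffices ∀ y, InCube y → f y ≤ f x → Forces ε S Ip Im G L y →
      Forces ε S Ip Im (fun y => G y ∧ f y ≤ f x) L y from this x hx le_rfl h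
  clear h
  induction L with
  | zero => intro y _ hy h; exact ⟨h, hy⟩
  | succ L ih =>
    intro y hy hyx h
    rcases h with h | ⟨J, hJ⟩
    · exact Or.inl ⟨h, hyx⟩
    · exact Or.inr ⟨J, fun u hu => ih _ (inCube_hkStep ε S y u) ((hf y u hy).trans hyx) (hJ u hu)⟩

/-- If all trajectories that follow the policy `J` pass through `G` up to time `T`, then `G` can
be forced. -/
lemma Forces.of_policy (hIp : Ip.Nonempty) (hIm : Im.Nonempty) (J : (Fin n → ℝ) → Set (Fin n))
    (T : ℕ) {x : Fin n → ℝ}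
    (h : ∀ (z u : ℕ → Fin n → ℝ), z 0 = x →
      (∀ t, u t ∈ signControl S Ip Im (J (z t)) ∧ z (t + 1) = hkStep ε S (z t) (u t)) →
      ∃ t ≤ T, G (z t)) : Forces ε S Ip Im G T x := by
  classical
  have hne : ∀ J, (signControl S Ip Im J).Nonempty := by
    intro J
    obtain ⟨p, hp⟩ := hIp
    obtain ⟨m, hm⟩ := hIm
    refine ⟨fun i => if i ∈ J then p else m, fun i _ => ⟨fun hi => ?_, fun hi => ?_⟩⟩
    · simpa [hi] using hp
    · simpa [hi] using hm
  choose v hv using hne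
  induction T generalizing x with
  | zero =>
    let z : ℕ → Fin n → ℝ := fun t => Nat.rec x (fun _ y => hkStep ε S y (v (J y))) t
    obtain ⟨t, ht, hG⟩ := h z (fun t => v (J (z t))) rfl (fun t => ⟨hv _, rfl⟩)
    obtain rfl : t = 0 := by omega
    exact hG
  | succ T ih =>
    by_cases hx : G x
    · exact Or.inl hx
    refine Or.inr ⟨J x, fun w hw => ih fun z u hz hu => ?_⟩
    obtain ⟨t, ht, hG⟩ := h (fun t => Nat.casesOn t x z) (fun t => Nat.casesOn t w u) rfl
      (by
        intro t
        cases t with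
        | zero => exact ⟨hw, hz⟩
        | succ t => exact hu t)
    cases t with
    | zero => exact absurd hG hx
    | succ t => exact ⟨t, by omega, hG⟩

end Forces

/-- From every state satisfying `H` one can force `G` within a uniformly bounded time. -/
def Leads {n : ℕ} (ε : ℝ) (S : Finset (Fin n)) (Ip Im : Set ℝ) (H G : (Fin n → ℝ) → Prop) :
    Prop :=
  ∃ L, ∀ x, InCube x → H x → Forces ε S Ip Im G L x

section Leads

variable {n : ℕ} {ε : ℝ} {S : Finset (Fin n)} {Ip Im : Set ℝ} {G H K : (Fin n → ℝ) → Prop}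

lemma Leads.of_imp (h : ∀ x, InCube x → H x → G x) : Leads ε S Ip Im H G :=
  ⟨0, h⟩

lemma Leads.trans (h₁ : Leads ε S Ip Im H G) (h₂ : Leads ε S Ip Im G K) :
    Leads ε S Ip Im H K := by
  obtain ⟨L, hL⟩ := h₁
  obtain ⟨M, hM⟩ := h₂
  exact ⟨L + M, fun x hx h => (hL x hx h).trans hx hM⟩

lemma Leads.or (h₁ : Leads ε S Ip Im H K) (h₂ : Leads ε S Ip Im G K) :
    Leads ε S Ip Im (fun x => H x ∨ G x) K := by
  obtain ⟨L, hL⟩ := h₁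
  obtain ⟨M, hM⟩ := h₂
  refine ⟨max L M, fun x hx h => ?_⟩
  rcases h with h | h
  · exact (hL x hx h).mono (le_max_left _ _) hx
  · exact (hM x hx h).mono (le_max_right _ _) hx

lemma Leads.step (h : ∀ x, InCube x → H x → ∃ J : Set (Fin n),
    ∀ u ∈ signControl S Ip Im J, G (hkStep ε S x u)) : Leads ε S Ip Im H G :=
  ⟨1, fun x hx hH => let ⟨J, hJ⟩ := h x hx hH; Forces.step J hJ⟩

/-- If a bounded quantity can be lowered by a fixed amount in bounded time, unless `G` is reached,
then `G` can be forced. -/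
lemma Leads.of_descent (f : (Fin n → ℝ) → ℝ) {A B δ : ℝ} (hδ : 0 < δ) (L : ℕ)
    (hA : ∀ x, InCube x → H x → A ≤ f x) (hB : ∀ x, InCube x → H x → f x ≤ B)
    (h : ∀ x, InCube x → H x → Forces ε S Ip Im (fun y => G y ∨ (H y ∧ f y ≤ f x - δ)) L x) :
    Leads ε S Ip Im H G := by
  have key : ∀ N : ℕ, ∀ x, InCube x → H x → f x < A + N * δ → Forces ε S Ip Im G (N * L) x := by
    intro N
    induction N with
    | zero => intro x hx hH hf; simp at hf; linarith [hA x hx hH]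
    | succ N ih =>
      intro x hx hH hf
      rw [Nat.succ_mul, add_comm]
      refine (h x hx hH).trans hx fun y hy hGy => ?_
      rcases hGy with hGy | ⟨hHy, hfy⟩
      · exact Forces.of_target hGy _
      · refine ih y hy hHy ?_
        push_cast at hf
        linarith
  obtain ⟨N, hN⟩ := exists_nat_gt ((B - A) / δ)
  refine ⟨N * L, fun x hx hH => key N x hx hH ?_⟩
  rw [div_lt_iff₀ hδ] at hN
  linarith [hB x hx hH]

end Leads

/-- Reflecting the opinion interval exchanges the two kinds of noise. -/
lemma Forces.reflect {n : ℕ} {ε : ℝ} (hε : 0 ≤ ε) {S : Finset (Fin n)} {Ip Im : Set ℝ}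
    {G : (Fin n → ℝ) → Prop} {L : ℕ} {x : Fin n → ℝ}
    (h : Forces ε S {r | -r ∈ Im} {r | -r ∈ Ip} (fun y => G fun i => 1 - y i) L
      (fun i => 1 - x i)) : Forces ε S Ip Im G L x := by
  induction L generalizing x with
  | zero => simpa [Forces] using h
  | succ L ih =>
    rcases h with h | ⟨J, hJ⟩
    · exact Or.inl (by simpa using h)
    · refine Or.inr ⟨Jᶜ, fun u hu => ih ?_⟩
      rw [← hkStep_one_sub hε]
      refine hJ _ fun i hi => ⟨fun hiJ => ?_, fun hiJ => ?_⟩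
      · simpa using (hu i hi).2 (by simpa using hiJ)
      · simpa using (hu i hi).1 (by simpa using hiJ)

/-! ### Upward noise separates the agents into clusters -/

/-- Induction on the size of a set `L` of agents that contains `S` and stays out of reach above all
others. The minimum over `L` never decreases and is at most 1, so on some long stretch it is almost
constant. On such a stretch the agents near the minimum form a tight noise-free cluster that nobody
else in `L` interacts with. Removing this cluster leaves a smaller set of the same kind. -/
lemma exists_settled_aux {n : ℕ} {ε η a : ℝ} {S : Finset (Fin n)} (hS : S.Nonempty)
    (hη : 0 < η) (hηa : η < a) (hηε : n * η ≤ ε) (k : ℕ) : ∀ W : ℕ, ∃ T : ℕ,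
    ∀ (x : ℕ → Fin n → ℝ) (L : Finset (Fin n)), L.card ≤ k → S ⊆ L → (∀ t, InCube (x t)) →
    (∀ t < T, ∀ i ∉ S, x (t + 1) i = localMean ε (x t) i) →
    (∀ t < T, ∀ i ∈ S, min 1 (localMean ε (x t) i + a) ≤ x (t + 1) i) →
    (∀ t ≤ T, ∀ i ∈ L, ∀ j ∉ L, ε < x t i - x t j) →
    ∃ t, t + W ≤ T ∧ ∀ t', t ≤ t' → t' ≤ t + W →
      (∀ i ∈ L, ∀ j ∈ L, |x t' i - x t' j| ≤ η ∨ ε < |x t' i - x t' j|) ∧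
      ∀ s ∈ S, 1 - η ≤ x t' s := by
  obtain ⟨s₀, hs₀⟩ := hS
  have hn : 1 ≤ n := (Nat.zero_le _).trans_lt s₀.2
  have hnR : (1 : ℝ) ≤ n := by exact_mod_cast hn
  have hn0 : (0 : ℝ) < n := by linarith
  have hηε' : η ≤ ε := by nlinarith
  have hε : 0 ≤ ε := hη.le.trans hηε'
  have hηdiv : η ≤ ε / n := by rw [le_div_iff₀ hn0]; linarith
  induction k with
  | zero =>
    intro W
    refine ⟨0, fun x L hL hSL => ?_⟩
    rw [Nat.le_zero, Finset.card_eq_zero] at hL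
    subst hL
    exact absurd (hSL hs₀) (by simp)
  | succ k ih =>
    intro W
    obtain ⟨T₀, hT₀⟩ := ih W
    set δ : ℝ := η / n with hδdef
    have hδ : 0 < δ := div_pos hη hn0
    have hδη : δ ≤ η := div_le_self hη.le hnR
    obtain ⟨N, hN⟩ := exists_nat_gt (1 / δ)
    rw [div_lt_iff₀ hδ] at hN
    -- Besides the time `T₀` for the smaller set, a stretch needs one step to lift the noisy agents
    -- and spare steps at its end, since `hfar` and `hgap` look ahead in time.
    set V := T₀ + W + 3 with hV
    refine ⟨N * V, fun x L hLk hSL hx hnon hnoise hsep => ?_⟩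
    have hLne : L.Nonempty := ⟨s₀, hSL hs₀⟩
    let m : ℕ → ℝ := fun t => L.inf' hLne (x t)
    have hm_le : ∀ t, ∀ i ∈ L, m t ≤ x t i := fun t i hi => Finset.inf'_le _ hi
    have hm_ge : ∀ t B, (∀ i ∈ L, B ≤ x t i) → B ≤ m t := fun t B h =>
      Finset.le_inf' _ _ h
    have hnbr : ∀ t ≤ N * V, ∀ i ∈ L, ∀ j, |x t j - x t i| ≤ ε → j ∈ L := by
      intro t ht i hi j hj
      by_contra hjL
      have h1 := hsep t ht i hi j hjL
      rw [abs_sub_comm] at hj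
      linarith [le_abs_self (x t i - x t j)]
    have hlm : ∀ t ≤ N * V, ∀ i ∈ L, m t ≤ localMean ε (x t) i := fun t ht i hi =>
      le_localMean hε fun j hj => hm_le t j (hnbr t ht i hi j hj)
    have hstep : ∀ t < N * V, ∀ i ∈ L, ∀ B ≤ 1, B ≤ localMean ε (x t) i → B ≤ x (t + 1) i := by
      intro t ht i hi B hB1 hB
      by_cases hiS : i ∈ S
      · exact (le_min hB1 (by linarith)).trans (hnoise t ht i hiS)
      · rw [hnon t ht i hiS]; exact hB
    have hm_one : ∀ t, m t ≤ 1 := fun t => (hm_le t s₀ (hSL hs₀)).trans (hx t s₀).2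
    have hmono1 : ∀ t < N * V, m t ≤ m (t + 1) := fun t ht =>
      hm_ge _ _ fun i hi => hstep t ht i hi _ (hm_one t) (hlm t ht.le i hi)
    have hmono : ∀ t t', t ≤ t' → t' ≤ N * V → m t ≤ m t' := by
      intro t t' htt' ht'
      induction t', htt' using Nat.le_induction with
      | base => exact le_rfl
      | succ t' _ ih' => exact (ih' (by omega)).trans (hmono1 t' (by omega))
    -- Pigeonhole: a gain of δ on each of `N` stretches would carry the minimum above 1.
    obtain ⟨j, hjN, hj⟩ : ∃ j < N, m ((j + 1) * V) < m (j * V) + δ := by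
      by_contra! hcon
      have : ∀ j ≤ N, (j : ℝ) * δ ≤ m (j * V) := by
        intro j
        induction j with
        | zero => intro _; simpa using hm_ge _ _ fun i _ => (hx _ i).1
        | succ j ihj =>
          intro hj
          have h1 := ihj (by omega)
          have h2 := hcon j (by omega)
          push_cast
          linarith
      linarith [this N le_rfl, hm_one (N * V)]
    set t₀ := j * V with ht₀
    have hend : t₀ + V ≤ N * V := by
      have : (j + 1) * V ≤ N * V := Nat.mul_le_mul_right _ hjN
      rw [Nat.succ_mul] at this
      exact this
    rw [Nat.succ_mul] at hj
    set m₀ := m t₀ with hm₀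
    have hlow : ∀ t, t₀ ≤ t → t ≤ t₀ + V → ∀ i ∈ L, m₀ ≤ x t i := fun t h1 h2 i hi =>
      (hmono _ _ h1 (by omega)).trans (hm_le t i hi)
    have hlt : ∀ t, t ≤ t₀ + V → m t < m₀ + δ := fun t ht =>
      (hmono t _ ht hend).trans_lt hj
    -- An agent in `[m₀ + η, m₀ + ε]` would be seen by all agents of `L` below it, and those above
    -- it are high already. All of `L` would then rise to at least `m₀ + η / n`, too much for this
    -- stretch.
    have hgap : ∀ t, t₀ ≤ t → t < t₀ + V → ∀ i ∈ L, m₀ + η ≤ x t i → m₀ + ε < x t i := by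
      intro t h1 h2 i hi hi1
      by_contra! hi2
      refine absurd (hlt (t + 1) (by omega)) (not_lt.2 (hm_ge _ _ fun l hl => ?_))
      refine hstep t (by omega) l hl _ (by linarith [(hx t i).2]) ?_
      have hlL : ∀ j, |x t j - x t l| ≤ ε → m₀ ≤ x t j := fun j hj =>
        hlow t h1 h2.le j (hnbr t (by omega) l hl j hj)
      rcases le_total (x t l) (x t i) with h | h
      · refine le_localMean_add (k := i) hε hlL ?_ hη.le hi1
        rw [abs_of_nonneg (by linarith)]
        linarith [hlow t h1 h2.le l hl]
      · exact le_localMean_add (k := l) hε hlL (by simpa using hε) hη.le (by linarith)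
    -- A low noise-free agent that saw a high one would move into the forbidden zone of `hgap`: the
    -- high neighbour lifts its mean by `ε / n`, and its own opinion keeps the mean below `m₀ + ε`.
    have hfar : ∀ t, t₀ ≤ t → t + 2 ≤ t₀ + V → ∀ j ∈ L, j ∉ S → x t j < m₀ + η →
        ∀ i ∈ L, m₀ + η ≤ x t i → ε < x t i - x t j := by
      intro t h1 h2 j hj hjS hj1 i hi hi1
      by_contra! hle
      have hi2 := hgap t h1 (by omega) i hi hi1
      have hnear : |x t i - x t j| ≤ ε := by
        rw [abs_of_nonneg (by linarith)]; exact hle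
      have hA : m₀ + ε / n ≤ localMean ε (x t) j :=
        le_localMean_add (k := i) hε
          (fun l hl => hlow t h1 (by omega) l (hnbr t (by omega) j hj l hl)) hnear hε hi2.le
      have hB : localMean ε (x t) j ≤ x t j + ε - ε / n :=
        localMean_le_sub (k := j) hε (fun l hl => by linarith [(abs_le.1 hl).2])
          (by simpa using hε) hε (by linarith)
      rw [← hnon t (by omega) j hjS] at hA hB
      linarith [hgap (t + 1) (by omega) (by omega) j hj (by linarith)]
    by_cases hm1 : 1 - η < m₀
    · refine ⟨t₀, by omega, fun t' h1 h2 => ⟨fun i hi j hj => Or.inl ?_, fun s hs => ?_⟩⟩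
      · have hi' := hlow t' h1 (by omega) i hi
        have hj' := hlow t' h1 (by omega) j hj
        rw [abs_le]
        constructor <;> linarith [(hx t' i).2, (hx t' j).2]
      · linarith [hlow t' h1 (by omega) s (hSL hs)]
    push Not at hm1
    have hnoisy : ∀ t, t₀ + 1 ≤ t → t ≤ t₀ + V → ∀ s ∈ S, m₀ + η ≤ x t s := by
      intro t h1 h2 s hs
      obtain ⟨t, rfl⟩ : ∃ r, t = r + 1 := ⟨t - 1, by omega⟩
      refine (le_min (by linarith) ?_).trans (hnoise t (by omega) s hs)
      have := hlm t (by omega) s (hSL hs)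
      have := hmono t₀ t (by omega) (by omega)
      linarith
    have hfar' : ∀ t, t₀ + 1 ≤ t → t + 2 ≤ t₀ + V → ∀ j ∈ L, x t j < m₀ + η →
        ∀ i ∈ L, m₀ + η ≤ x t i → ε < x t i - x t j := fun t h1 h2 j hj hj1 i hi hi1 =>
      hfar t (by omega) h2 j hj
        (fun hjS => absurd (hnoisy t h1 (by omega) j hjS) (not_le.2 hj1)) hj1 i hi hi1
    have hinv : ∀ t, t₀ + 1 ≤ t → t + 1 ≤ t₀ + V → ∀ i ∈ L,
        (x (t₀ + 1) i < m₀ + η ↔ x t i < m₀ + η) := by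
      intro t h1 h2
      induction t, h1 using Nat.le_induction with
      | base => intro i _; rfl
      | succ t h1 ih' =>
        intro i hi
        rw [ih' (by omega) i hi]
        constructor
        · intro hlo
          have hiS : i ∉ S := fun hiS =>
            absurd (hnoisy t h1 (by omega) i hiS) (not_le.2 hlo)
          have hle : x (t + 1) i ≤ m₀ + η := by
            rw [hnon t (by omega) i hiS]
            refine localMean_le hε fun l hl => ?_
            by_contra! hl1
            have hlL := hnbr t (by omega) i hi l hl
            linarith [hfar' t h1 (by omega) i hi hlo l hlL hl1.le, (abs_le.1 hl).2]
          by_contra! hge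
          linarith [hgap (t + 1) (by omega) (by omega) i hi hge]
        · intro hlo
          by_contra! hhi
          by_cases hiS : i ∈ S
          · linarith [hnoisy (t + 1) (by omega) (by omega) i hiS]
          rw [hnon t (by omega) i hiS] at hlo
          refine absurd hlo (not_lt.2 (le_localMean hε fun l hl => ?_))
          by_contra! hl1
          have hlL := hnbr t (by omega) i hi l hl
          linarith [hfar' t h1 (by omega) l hlL hl1 i hi hhi, (abs_le.1 hl).1]
    -- The agent attaining the minimum is missing from `L'`, so the induction hypothesis applies to
    -- `L'`.
    set L' := L.filter fun i => m₀ + η ≤ x (t₀ + 1) i with hL'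
    have hcard : L'.card ≤ k := by
      obtain ⟨i, hi, him⟩ := Finset.exists_mem_eq_inf' hLne (x (t₀ + 1))
      have : L' ⊂ L := Finset.filter_ssubset.2 ⟨i, hi, not_le.2 ?_⟩
      · have := Finset.card_lt_card this
        omega
      · rw [← him]
        exact (hlt (t₀ + 1) (by omega)).trans_le (by linarith)
    have hmemL' : ∀ i, i ∈ L' ↔ i ∈ L ∧ m₀ + η ≤ x (t₀ + 1) i := fun i => Finset.mem_filter
    have hhigh : ∀ t, t₀ + 1 ≤ t → t + 1 ≤ t₀ + V → ∀ i ∈ L, (i ∈ L' ↔ m₀ + η ≤ x t i) := by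
      intro t h1 h2 i hi
      rw [hmemL', ← not_lt, hinv t h1 h2 i hi, not_lt]
      exact ⟨fun h => h.2, fun h => ⟨hi, h⟩⟩
    obtain ⟨t₁, ht₁, hres⟩ := hT₀ (fun t => x (t₀ + 1 + t)) L' hcard
      (fun s hs => (hmemL' s).2 ⟨hSL hs, hnoisy (t₀ + 1) le_rfl (by omega) s hs⟩)
      (fun t => hx _) (fun t ht => hnon (t₀ + 1 + t) (by omega))
      (fun t ht => hnoise (t₀ + 1 + t) (by omega))
      (by
        intro t ht i hi j hj
        have hiL := ((hmemL' i).1 hi).1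
        by_cases hjL : j ∈ L
        · refine hfar' _ (by omega) (by omega) j hjL ?_ i hiL
            ((hhigh _ (by omega) (by omega) i hiL).1 hi)
          by_contra! h
          exact hj ((hhigh _ (by omega) (by omega) j hjL).2 h)
        · exact hsep _ (by omega) i hiL j hjL)
    refine ⟨t₀ + 1 + t₁, by omega, fun t' h1 h2 => ?_⟩
    obtain ⟨r, rfl⟩ : ∃ r, t' = t₀ + 1 + r := ⟨t' - (t₀ + 1), by omega⟩
    obtain ⟨hr1, hr2⟩ := hres r (by omega) (by omega)
    refine ⟨fun i hi j hj => ?_, hr2⟩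
    have hiff := hhigh (t₀ + 1 + r) (by omega) (by omega)
    have hi0 := hlow (t₀ + 1 + r) (by omega) (by omega) i hi
    have hj0 := hlow (t₀ + 1 + r) (by omega) (by omega) j hj
    by_cases hi' : i ∈ L' <;> by_cases hj' : j ∈ L'
    · exact hr1 i hi' j hj'
    · rw [hiff i hi] at hi'
      rw [hiff j hj, not_le] at hj'
      exact Or.inr ((hfar' _ (by omega) (by omega) j hj hj' i hi hi').trans_le (le_abs_self _))
    · rw [hiff i hi, not_le] at hi'
      rw [hiff j hj] at hj'
      rw [abs_sub_comm]
      exact Or.inr ((hfar' _ (by omega) (by omega) i hi hi' j hj hj').trans_le (le_abs_self _))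
    · rw [hiff i hi, not_le] at hi'
      rw [hiff j hj, not_le] at hj'
      left
      rw [abs_le]
      constructor <;> linarith

/-- Every two opinions are `η`-close or more than `ε` apart, and the opinions of the agents of `S`
are `η`-close to `1`. -/
def Settled {n : ℕ} (ε η : ℝ) (S : Finset (Fin n)) (x : Fin n → ℝ) : Prop :=
  (∀ i j, |x i - x j| ≤ η ∨ ε < |x i - x j|) ∧ ∀ s ∈ S, 1 - η ≤ x s

/-- If all noise on `S` is bounded below by `a > 0` for long enough, the state is settled during a
time window of prescribed length. -/
theorem exists_settled {n : ℕ} {ε η a : ℝ} {S : Finset (Fin n)} (hS : S.Nonempty)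
    (hη : 0 < η) (hηa : η < a) (hηε : n * η ≤ ε) (W : ℕ) : ∃ T : ℕ,
    ∀ x : ℕ → Fin n → ℝ, (∀ t, InCube (x t)) →
    (∀ t < T, ∀ i ∉ S, x (t + 1) i = localMean ε (x t) i) →
    (∀ t < T, ∀ i ∈ S, min 1 (localMean ε (x t) i + a) ≤ x (t + 1) i) →
    ∃ t, t + W ≤ T ∧ ∀ t', t ≤ t' → t' ≤ t + W → Settled ε η S (x t') := by
  obtain ⟨T, hT⟩ := exists_settled_aux hS hη hηa hηε n W
  refine ⟨T, fun x hx h1 h2 => ?_⟩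
  obtain ⟨t, ht, h⟩ := hT x Finset.univ (by simp) (Finset.subset_univ _) hx h1 h2
    (fun t _ i _ j hj => absurd (Finset.mem_univ j) hj)
  exact ⟨t, ht, fun t' h3 h4 => ⟨fun i j => (h t' h3 h4).1 i (Finset.mem_univ i) j
    (Finset.mem_univ j), (h t' h3 h4).2⟩⟩

/-- Upward noise leads to a settled state, whose successor is settled as well. -/
lemma leads_settled {n : ℕ} {ε η a : ℝ} {S : Finset (Fin n)} (hS : S.Nonempty)
    (hη : 0 < η) (hηa : η < a) (hηε : n * η ≤ ε) {Ip Im : Set ℝ} (hIp : Ip.Nonempty)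
    (hIm : Im.Nonempty) (hpos : ∀ r ∈ Ip, a ≤ r) :
    Leads ε S Ip Im (fun _ => True) (fun y => Settled ε η S y ∧ ∃ x u, InCube x ∧
      Settled ε η S x ∧ y = hkStep ε S x u) := by
  obtain ⟨s₀, hs₀⟩ := id hS
  have hn : 1 ≤ n := (Nat.zero_le _).trans_lt s₀.2
  have hε : 0 ≤ ε := (by positivity : 0 ≤ n * η).trans hηε
  obtain ⟨T, hT⟩ := exists_settled hS hη hηa hηε 1
  refine ⟨T, fun x hx _ => Forces.of_policy hIp hIm (fun _ => Set.univ) T fun z u hz hu => ?_⟩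
  have hz' : ∀ t, InCube (z t) := by
    intro t
    cases t with
    | zero => rw [hz]; exact hx
    | succ t => rw [(hu t).2]; exact inCube_hkStep ε S (z t) (u t)
  obtain ⟨t, ht, h⟩ := hT z hz'
    (fun t _ i hi => by rw [(hu t).2, hkStep_of_notMem hε (hz' t) _ hi])
    (fun t _ i hi => by
      rw [(hu t).2, hkStep_of_mem _ hi]
      refine le_trans (min_le_min le_rfl ?_) (min_le_clip _)
      linarith [hpos _ (((hu t).1 i hi).1 (Set.mem_univ i))])
  exact ⟨t + 1, ht, h _ (by omega) le_rfl, z t, u t, hz' t, h t le_rfl (by omega), (hu t).2⟩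

/-! ### From steering to almost sure events -/

lemma measurable_localMean {n : ℕ} (ε : ℝ) (i : Fin n) :
    Measurable fun x : Fin n → ℝ => localMean ε x i := by
  have hset : ∀ j, MeasurableSet {x : Fin n → ℝ | |x j - x i| ≤ ε} := fun j =>
    measurableSet_le (by fun_prop) measurable_const
  have h1 : (fun x : Fin n → ℝ => localMean ε x i) = fun x =>
      (∑ j, if |x j - x i| ≤ ε then (1 : ℝ) else 0)⁻¹ *
        ∑ j, if |x j - x i| ≤ ε then x j else 0 := by
    funext x
    rw [localMean, neighbors, Finset.sum_filter, Finset.card_filter]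
    push_cast
    rfl
  rw [h1]
  refine Measurable.mul (Measurable.inv ?_) ?_
  · exact Finset.measurable_sum _ fun j _ =>
      Measurable.ite (hset j) measurable_const measurable_const
  · exact Finset.measurable_sum _ fun j _ =>
      Measurable.ite (hset j) (measurable_pi_apply j) measurable_const

lemma measurable_hkStep {n : ℕ} (ε : ℝ) (S : Finset (Fin n)) :
    Measurable fun p : (Fin n → ℝ) × (Fin n → ℝ) => hkStep ε S p.1 p.2 := by
  refine measurable_pi_lambda _ fun i => ?_
  unfold hkStep clip
  have := (measurable_localMean ε i).comp
    (measurable_fst : Measurable (Prod.fst : (Fin n → ℝ) × (Fin n → ℝ) → Fin n → ℝ))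
  refine measurable_const.max (measurable_const.min (Measurable.add this ?_))
  split_ifs
  · fun_prop
  · fun_prop

lemma measurable_opinionDiam {n : ℕ} : Measurable fun x : Fin n → ℝ => opinionDiam x :=
  Measurable.iSup fun p => by fun_prop

/-- The probability of staying in `D` during `k` steps when starting from `x`, where the noise of
each step has law `ν`. -/
noncomputable def stayProb {n : ℕ} (ε : ℝ) (S : Finset (Fin n)) (ν : Measure (Fin n → ℝ))
    (D : Set (Fin n → ℝ)) : ℕ → (Fin n → ℝ) → ENNReal
  | 0 => D.indicator fun _ => 1
  | k + 1 => D.indicator fun x => ∫⁻ u, stayProb ε S ν D k (hkStep ε S x u) ∂ν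

section stayProb

variable {n : ℕ} {ε : ℝ} {S : Finset (Fin n)} {ν : Measure (Fin n → ℝ)} {D : Set (Fin n → ℝ)}

lemma measurable_stayProb [SFinite ν] (hD : MeasurableSet D) (k : ℕ) :
    Measurable (stayProb ε S ν D k) := by
  induction k with
  | zero => exact measurable_const.indicator hD
  | succ k ih =>
    exact Measurable.indicator
      (Measurable.lintegral_prod_right' (ih.comp (measurable_hkStep ε S))) hD

lemma stayProb_of_notMem {x : Fin n → ℝ} (hx : x ∉ D) (k : ℕ) : stayProb ε S ν D k x = 0 := by
  cases k <;> exact Set.indicator_of_notMem hx _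

/-- This is the bound `(1 - p ^ L) * M`, written additively because subtraction in `ENNReal`
truncates. At each step the controller's choice is met with probability at least `p`; otherwise the
general bound `M` is used. -/
lemma stayProb_add_le {Ip Im : Set ℝ} [IsProbabilityMeasure ν]
    (hIp : MeasurableSet Ip) (hIm : MeasurableSet Im) {p : ENNReal}
    (hp : ∀ J, p ≤ ν (signControl S Ip Im J)) {M : ENNReal} {k : ℕ}
    (hM : ∀ L, ∀ x, InCube x → stayProb ε S ν D (k + L) x ≤ M) (L : ℕ) {x : Fin n → ℝ}
    (h : Forces ε S Ip Im (· ∉ D) L x) :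
    stayProb ε S ν D (k + L) x + p ^ L * M ≤ M := by
  have hp1 : p ≤ 1 := (hp ∅).trans prob_le_one
  have hmeas : ∀ J, MeasurableSet (signControl S Ip Im J) := by
    intro J
    have : signControl S Ip Im J = ⋂ i, ⋂ (_ : i ∈ S),
        ((fun u : Fin n → ℝ => u i) ⁻¹' {r | (i ∈ J → r ∈ Ip) ∧ (i ∉ J → r ∈ Im)}) := by
      ext u; simp [signControl]
    rw [this]
    refine MeasurableSet.iInter fun i => MeasurableSet.iInter fun _ => measurable_pi_apply i ?_
    by_cases hi : i ∈ J <;> simpa [hi]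
  have hout : ∀ L, ∀ x, x ∉ D → stayProb ε S ν D (k + L) x + p ^ L * M ≤ M := by
    intro L x hx
    rw [stayProb_of_notMem hx, zero_add]
    calc p ^ L * M ≤ 1 * M := by gcongr; exact pow_le_one₀ (zero_le) hp1
      _ = M := one_mul M
  induction L generalizing x with
  | zero => exact hout 0 x h
  | succ L ih =>
    rcases h with h | ⟨J, hJ⟩
    · exact hout _ x h
    have hJm := hmeas J
    calc stayProb ε S ν D (k + (L + 1)) x + p ^ (L + 1) * M
        ≤ (∫⁻ u, stayProb ε S ν D (k + L) (hkStep ε S x u) ∂ν) +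
          ∫⁻ u, (signControl S Ip Im J).indicator (fun _ => p ^ L * M) u ∂ν := by
          refine add_le_add (Set.indicator_le_self' (fun _ _ => zero_le) x) ?_
          rw [lintegral_indicator_const hJm, pow_succ, mul_right_comm]
          gcongr
          exact hp J
      _ = ∫⁻ u, (stayProb ε S ν D (k + L) (hkStep ε S x u) +
            (signControl S Ip Im J).indicator (fun _ => p ^ L * M) u) ∂ν :=
          (lintegral_add_right _ (measurable_const.indicator hJm)).symm
      _ ≤ ∫⁻ _, M ∂ν := by
          refine lintegral_mono fun u => ?_
          by_cases hu : u ∈ signControl S Ip Im J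
          · simpa [hu] using ih (hJ u hu)
          · simpa [hu] using hM L _ (inCube_hkStep ε S x u)
      _ = M := by simp

/-- Each block of `L` steps contributes a factor `1 - p ^ L`. The surplus `l` is carried along
because `stayProb_add_le` needs its bound for all longer horizons too. -/
lemma stayProb_le_pow {Ip Im : Set ℝ} [IsProbabilityMeasure ν]
    (hIp : MeasurableSet Ip) (hIm : MeasurableSet Im) {p : ENNReal}
    (hp : ∀ J, p ≤ ν (signControl S Ip Im J)) {L : ℕ}
    (h : ∀ x, InCube x → Forces ε S Ip Im (· ∉ D) L x) (j : ℕ) :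
    ∀ l, ∀ x, InCube x → stayProb ε S ν D (j * L + l) x ≤ (1 - p ^ L) ^ j := by
  have hp1 : p ≤ 1 := (hp ∅).trans prob_le_one
  induction j with
  | zero =>
    intro l
    rw [zero_mul, zero_add, pow_zero]
    induction l with
    | zero =>
      intro x _
      exact Set.indicator_le_self' (f := fun _ => (1 : ENNReal)) (fun _ _ => zero_le) x
    | succ l ih =>
      intro x _
      refine (Set.indicator_le_self' (fun _ _ => zero_le) x).trans ?_
      calc _ ≤ ∫⁻ _, (1 : ENNReal) ∂ν := lintegral_mono fun u => ih _ (inCube_hkStep ε S x u)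
        _ = 1 := by simp
  | succ j ih =>
    intro l x hx
    have h1 := stayProb_add_le (k := j * L + l) hIp hIm hp
      (fun L' x hx => by rw [add_assoc]; exact ih (l + L') x hx) L (h x hx)
    have h2 : (j + 1) * L + l = j * L + l + L := by ring
    have hfin : p ^ L * (1 - p ^ L) ^ j ≠ ⊤ := by
      refine ENNReal.mul_ne_top (ENNReal.pow_ne_top (hp1.trans_lt ENNReal.one_lt_top).ne)
        (ENNReal.pow_ne_top (tsub_le_self.trans_lt ENNReal.one_lt_top).ne)
    rw [h2, pow_succ, ENNReal.mul_sub (fun _ _ =>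
      ENNReal.pow_ne_top (tsub_le_self.trans_lt ENNReal.one_lt_top).ne), mul_one,
      mul_comm _ (p ^ L)]
    exact ENNReal.le_sub_of_add_le_right hfin h1

end stayProb

/-- Freezing a random variable that is independent of the past. -/
lemma setLIntegral_prodMk_of_indep {Ω α β : Type*} [MeasurableSpace α]
    [MeasurableSpace β] {m mΩ : MeasurableSpace Ω} (hm : m ≤ mΩ) {P : Measure Ω}
    [IsProbabilityMeasure P] {X : Ω → α} {U : Ω → β}
    (hX : Measurable[m] X) (hU : Measurable U)
    (hXU : Indep m (MeasurableSpace.comap U inferInstance) P)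
    {B : Set Ω} (hB : MeasurableSet[m] B) {g : α × β → ENNReal} (hg : Measurable g) :
    ∫⁻ ω in B, g (X ω, U ω) ∂P = ∫⁻ ω in B, ∫⁻ u, g (X ω, u) ∂(P.map U) ∂P := by
  -- The indicator of `B` becomes an extra coordinate, so that independence of the pair from `U` and
  -- Tonelli's theorem handle the restriction to `B`.
  let Z : Ω → ENNReal × α := fun ω => (B.indicator (fun _ => 1) ω, X ω)
  have hZ' : Measurable[m] Z :=
    Measurable.prodMk ((@measurable_const _ _ _ m (1 : ENNReal)).indicator hB) hX
  have hZ : Measurable Z := hZ'.mono hm le_rfl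
  have hind : IndepFun Z U P := indep_of_indep_of_le_left hXU hZ'.comap_le
  have hmap := (indepFun_iff_map_prod_eq_prod_map_map hZ.aemeasurable hU.aemeasurable).1 hind
  have hB' := hm _ hB
  let F : (ENNReal × α) × β → ENNReal := fun q => q.1.1 * g (q.1.2, q.2)
  have hF : Measurable F := (measurable_fst.comp measurable_fst).mul
    (hg.comp ((measurable_snd.comp measurable_fst).prodMk measurable_snd))
  have : IsProbabilityMeasure (P.map U) := Measure.isProbabilityMeasure_map hU.aemeasurable
  have e1 : ∫⁻ ω, F (Z ω, U ω) ∂P = ∫⁻ ω, ∫⁻ u, F (Z ω, u) ∂(P.map U) ∂P := by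
    rw [← lintegral_map (f := fun z => ∫⁻ u, F (z, u) ∂(P.map U)) hF.lintegral_prod_right' hZ,
      ← lintegral_prod _ hF.aemeasurable, ← hmap, lintegral_map hF (hZ.prodMk hU)]
  have e2 : ∀ h : Ω → ENNReal, ∫⁻ ω in B, h ω ∂P =
      ∫⁻ ω, B.indicator (fun _ => 1) ω * h ω ∂P := by
    intro h
    rw [← lintegral_indicator hB']
    refine lintegral_congr fun ω => ?_
    by_cases hω : ω ∈ B <;> simp [hω]
  rw [e2, e2]
  refine e1.trans (lintegral_congr fun ω => ?_)
  exact lintegral_const_mul _ (hg.comp measurable_prodMk_left)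

/-! ### The Markov property of the opinion process. -/

section NoiseHistory

variable {Ω : Type*} {n : ℕ} {S : Finset (Fin n)} {ξ : Fin n → ℕ → Ω → ℝ} {x0 : Fin n → ℝ} {ε : ℝ}

/-- The noise used in the step from time `t` to time `t + 1`. -/
def noiseStep (ξ : Fin n → ℕ → Ω → ℝ) (t : ℕ) (ω : Ω) : Fin n → ℝ := fun i => ξ i (t + 1) ω

/-- The opinions at time `t` as random variables. -/
noncomputable def randomState (ε : ℝ) (S : Finset (Fin n)) (x0 : Fin n → ℝ)
    (ξ : Fin n → ℕ → Ω → ℝ) (t : ℕ) (ω : Ω) : Fin n → ℝ :=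
  hkState ε S x0 (fun i t => ξ i t ω) t

lemma inCube_randomState (hx0 : InCube x0) (t : ℕ) (ω : Ω) :
    InCube (randomState ε S x0 ξ t ω) := by
  cases t with
  | zero => exact hx0
  | succ t => exact inCube_hkStep ε S _ _

/-- The events that are determined by the noise used before time `t`. -/
abbrev pastSpace (ξ : Fin n → ℕ → Ω → ℝ) (t : ℕ) : MeasurableSpace Ω :=
  MeasurableSpace.comap (fun ω (q : Fin n × Fin t) => ξ q.1 (q.2 + 1) ω) inferInstance

lemma measurable_noiseStep_pastSpace {r t : ℕ} (hrt : r < t) :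
    Measurable[pastSpace ξ t] (noiseStep ξ r) := by
  refine @measurable_pi_lambda _ _ _ (pastSpace ξ t) _ _ fun i => ?_
  exact (measurable_pi_apply (X := fun _ : Fin n × Fin t => ℝ) (i, ⟨r, hrt⟩)).comp
    (comap_measurable _)

lemma measurable_randomState_pastSpace {r t : ℕ} (hrt : r ≤ t) :
    Measurable[pastSpace ξ t] (randomState ε S x0 ξ r) := by
  induction r with
  | zero => exact @measurable_const _ _ _ (pastSpace ξ t) x0
  | succ r ih =>
    have := (measurable_hkStep ε S).comp
      ((ih (by omega)).prodMk (measurable_noiseStep_pastSpace (ξ := ξ) (t := t) (r := r) (by omega)))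
    exact this

variable [MeasurableSpace Ω] {P : Measure Ω}

lemma measurable_noiseStep (hmeas : ∀ i t, 1 ≤ t → Measurable (ξ i t)) (t : ℕ) :
    Measurable (noiseStep ξ t) :=
  measurable_pi_lambda _ fun i => hmeas i (t + 1) (by omega)

lemma pastSpace_le (hmeas : ∀ i t, 1 ≤ t → Measurable (ξ i t)) (t : ℕ) :
    pastSpace ξ t ≤ ‹MeasurableSpace Ω› :=
  Measurable.comap_le (measurable_pi_lambda _ fun q => hmeas q.1 (q.2 + 1) (by omega))

/-- The past and the next step use disjoint finite sets of the independent noise variables. -/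
lemma indep_pastSpace (hmeas : ∀ i t, 1 ≤ t → Measurable (ξ i t))
    (hindep : iIndepFun (fun (p : Fin n × {t : ℕ // 1 ≤ t}) => ξ p.1 p.2) P) (t : ℕ) :
    Indep (pastSpace ξ t) (MeasurableSpace.comap (noiseStep ξ t) inferInstance) P := by
  classical
  let A : Finset (Fin n × {t : ℕ // 1 ≤ t}) :=
    Finset.univ.image fun q : Fin n × Fin t => (q.1, ⟨q.2 + 1, by omega⟩)
  let B : Finset (Fin n × {t : ℕ // 1 ≤ t}) :=
    Finset.univ.image fun i : Fin n => (i, ⟨t + 1, by omega⟩)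
  have hAB : Disjoint A B := by
    rw [Finset.disjoint_left]
    intro q hA hB
    simp only [A, B, Finset.mem_image, Finset.mem_univ, true_and] at hA hB
    obtain ⟨⟨i, r⟩, rfl⟩ := hA
    obtain ⟨j, hj⟩ := hB
    have := congrArg (fun q => (q.2 : ℕ)) hj
    simp only at this
    omega
  have h := hindep.indepFun_finset A B hAB fun q => hmeas q.1 q.2 q.2.2
  have h2 := h.comp
    (φ := fun f (q : Fin n × Fin t) => f ⟨(q.1, ⟨q.2 + 1, by omega⟩),
      Finset.mem_image_of_mem (fun q : Fin n × Fin t =>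
        ((q.1, ⟨q.2 + 1, by omega⟩) : Fin n × {t : ℕ // 1 ≤ t})) (Finset.mem_univ q)⟩)
    (ψ := fun f (i : Fin n) => f ⟨(i, ⟨t + 1, by omega⟩),
      Finset.mem_image_of_mem (fun i : Fin n =>
        ((i, ⟨t + 1, by omega⟩) : Fin n × {t : ℕ // 1 ≤ t})) (Finset.mem_univ i)⟩)
    (measurable_pi_lambda _ fun q => measurable_pi_apply _)
    (measurable_pi_lambda _ fun q => measurable_pi_apply _)
  exact h2

variable [IsProbabilityMeasure P]

lemma map_noiseStep (hmeas : ∀ i t, 1 ≤ t → Measurable (ξ i t)) [NeZero n]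
    (hindep : iIndepFun (fun (p : Fin n × {t : ℕ // 1 ≤ t}) => ξ p.1 p.2) P)
    (hident : ∀ i t, 1 ≤ t → IdentDistrib (ξ i t) (ξ 0 1) P P) (t : ℕ) :
    P.map (noiseStep ξ t) = Measure.pi fun _ => P.map (ξ 0 1) := by
  have h1 : iIndepFun (fun i : Fin n => ξ i (t + 1)) P :=
    hindep.precomp (g := fun i : Fin n => ((i, ⟨t + 1, by omega⟩) : Fin n × {t : ℕ // 1 ≤ t}))
      fun i j hij => by simpa using hij
  have h2 := (iIndepFun_iff_map_fun_eq_pi_map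
    fun i => (hmeas i (t + 1) (by omega)).aemeasurable).1 h1
  refine Eq.trans h2 ?_
  congr 1
  funext i
  exact (hident i (t + 1) (by omega)).map_eq

/-- The one-step Markov property, on an event of the past. -/
lemma setLIntegral_randomState_succ (hmeas : ∀ i t, 1 ≤ t → Measurable (ξ i t))
    (hindep : iIndepFun (fun (p : Fin n × {t : ℕ // 1 ≤ t}) => ξ p.1 p.2) P) (t : ℕ)
    {B : Set Ω} (hB : MeasurableSet[pastSpace ξ t] B) {f : (Fin n → ℝ) → ENNReal}
    (hf : Measurable f) :
    ∫⁻ ω in B, f (randomState ε S x0 ξ (t + 1) ω) ∂P =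
      ∫⁻ ω in B, ∫⁻ u, f (hkStep ε S (randomState ε S x0 ξ t ω) u) ∂(P.map (noiseStep ξ t)) ∂P :=
  setLIntegral_prodMk_of_indep (pastSpace_le hmeas t) (measurable_randomState_pastSpace le_rfl)
    (measurable_noiseStep hmeas t) (indep_pastSpace hmeas hindep t) hB
    (g := fun q => f (hkStep ε S q.1 q.2)) (hf.comp (measurable_hkStep ε S))

/-- Staying forever implies staying during `k` further steps, and the Markov property, applied step
by step, turns the latter probability into `stayProb`. -/
lemma measure_stay_le (hmeas : ∀ i t, 1 ≤ t → Measurable (ξ i t)) [NeZero n]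
    (hindep : iIndepFun (fun (p : Fin n × {t : ℕ // 1 ≤ t}) => ξ p.1 p.2) P)
    (hident : ∀ i t, 1 ≤ t → IdentDistrib (ξ i t) (ξ 0 1) P P)
    {D : Set (Fin n → ℝ)} (hD : MeasurableSet D) (T k : ℕ) :
    P {ω | ∀ t ≥ T, randomState ε S x0 ξ t ω ∈ D} ≤
      ∫⁻ ω, stayProb ε S (Measure.pi fun _ => P.map (ξ 0 1)) D k
        (randomState ε S x0 ξ T ω) ∂P := by
  have : IsProbabilityMeasure (P.map (ξ 0 1)) :=
    Measure.isProbabilityMeasure_map (hmeas 0 1 le_rfl).aemeasurable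
  set ν : Measure (Fin n → ℝ) := Measure.pi fun _ => P.map (ξ 0 1) with hν
  let B : ℕ → Set Ω := fun j => {ω | ∀ t, T ≤ t → t < T + j → randomState ε S x0 ξ t ω ∈ D}
  -- The last state that `B j` inspects is the one at time `T + j - 1`, hence the shift by one.
  have hB : ∀ j r, T + j ≤ r + 1 → MeasurableSet[pastSpace ξ r] (B j) := by
    intro j r hjr
    have : B j = ⋂ t : ℕ, ⋂ (_ : T ≤ t), ⋂ (_ : t < T + j), randomState ε S x0 ξ t ⁻¹' D := by
      ext ω; simp [B]
    rw [this]
    exact MeasurableSet.iInter fun t => MeasurableSet.iInter fun _ => MeasurableSet.iInter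
      fun ht => measurable_randomState_pastSpace (by omega) hD
  have hsplit : ∀ j (g : (Fin n → ℝ) → ENNReal), ∫⁻ ω in B j, D.indicator g
      (randomState ε S x0 ξ (T + j) ω) ∂P =
      ∫⁻ ω in B (j + 1), g (randomState ε S x0 ξ (T + j) ω) ∂P := by
    intro j g
    have hBj := pastSpace_le hmeas (T + j) _ (hB j (T + j) (by omega))
    have hBj' := pastSpace_le hmeas (T + j) _ (hB (j + 1) (T + j) (by omega))
    rw [← lintegral_indicator hBj, ← lintegral_indicator hBj']
    refine lintegral_congr fun ω => ?_
    have hiff : ω ∈ B (j + 1) ↔ ω ∈ B j ∧ randomState ε S x0 ξ (T + j) ω ∈ D := by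
      constructor
      · exact fun h => ⟨fun t h1 h2 => h t h1 (by omega), h _ (by omega) (by omega)⟩
      · rintro ⟨h, h'⟩ t h1 h2
        rcases Nat.lt_or_ge t (T + j) with h3 | h3
        · exact h t h1 h3
        · obtain rfl : t = T + j := by omega
          exact h'
    by_cases h1 : ω ∈ B j <;> by_cases h2 : randomState ε S x0 ξ (T + j) ω ∈ D <;>
      simp [Set.indicator, hiff, h1, h2]
  have hstep : ∀ j ≤ k, ∫⁻ ω, stayProb ε S ν D k (randomState ε S x0 ξ T ω) ∂P =
      ∫⁻ ω in B j, stayProb ε S ν D (k - j) (randomState ε S x0 ξ (T + j) ω) ∂P := by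
    intro j
    induction j with
    | zero =>
      intro _
      have : B 0 = Set.univ := by
        ext ω
        simp only [B, Set.mem_ofPred_eq, Set.mem_univ, iff_true]
        intro t h1 h2
        omega
      rw [this, Measure.restrict_univ]
      simp
    | succ j ih =>
      intro hj
      obtain ⟨l, hl⟩ : ∃ l, k - j = l + 1 := ⟨k - j - 1, by omega⟩
      have hl' : k - (j + 1) = l := by omega
      rw [ih (by omega), hl, hl', stayProb, hsplit, ← add_assoc,
        setLIntegral_randomState_succ hmeas hindep (T + j) (hB (j + 1) (T + j) (by omega))
          (measurable_stayProb hD l), map_noiseStep hmeas hindep hident]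
  have hBk := pastSpace_le hmeas (T + k) _ (hB (k + 1) (T + k) (by omega))
  rw [hstep k le_rfl, Nat.sub_self, stayProb, hsplit, lintegral_one, Measure.restrict_apply_univ]
  exact measure_mono fun ω h t h1 _ => h t h1

/-- If the complement of `D` can be forced by noise of positive probability, then almost surely
the process does not stay in `D` forever. -/
theorem measure_eventually_mem_eq_zero (hmeas : ∀ i t, 1 ≤ t → Measurable (ξ i t)) [NeZero n]
    (hindep : iIndepFun (fun (p : Fin n × {t : ℕ // 1 ≤ t}) => ξ p.1 p.2) P)
    (hident : ∀ i t, 1 ≤ t → IdentDistrib (ξ i t) (ξ 0 1) P P) (hx0 : InCube x0)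
    {D : Set (Fin n → ℝ)} (hD : MeasurableSet D) {Ip Im : Set ℝ}
    (hIp : MeasurableSet Ip) (hIm : MeasurableSet Im)
    (hPp : 0 < P (ξ 0 1 ⁻¹' Ip)) (hPm : 0 < P (ξ 0 1 ⁻¹' Im))
    (h : Leads ε S Ip Im (fun _ => True) (· ∉ D)) (T : ℕ) :
    P {ω | ∀ t ≥ T, randomState ε S x0 ξ t ω ∈ D} = 0 := by
  have hm := hmeas 0 1 le_rfl
  have : IsProbabilityMeasure (P.map (ξ 0 1)) := Measure.isProbabilityMeasure_map hm.aemeasurable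
  obtain ⟨L, hL⟩ := h
  set μ := P.map (ξ 0 1) with hμ
  set ν : Measure (Fin n → ℝ) := Measure.pi fun _ => μ with hν
  -- A bound that does not depend on the chosen set `J`: each coordinate of the noise contributes a
  -- factor of at least the minimum.
  set p : ENNReal := min (μ Ip) (μ Im) ^ n with hp
  have hq : 0 < min (μ Ip) (μ Im) := by
    rw [hμ, Measure.map_apply hm hIp, Measure.map_apply hm hIm]
    exact lt_min hPp hPm
  have hpJ : ∀ J, p ≤ ν (signControl S Ip Im J) := by
    classical
    intro J
    have : signControl S Ip Im J = Set.pi Set.univ fun i =>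
        if i ∈ S then (if i ∈ J then Ip else Im) else Set.univ := by
      ext u
      simp only [signControl, Set.mem_ofPred_eq, Set.mem_pi, Set.mem_univ, true_imp_iff]
      refine forall_congr' fun i => ?_
      by_cases hi : i ∈ S <;> by_cases hJ : i ∈ J <;> simp [hi, hJ]
    rw [this, hν, Measure.pi_pi, hp]
    calc min (μ Ip) (μ Im) ^ n = ∏ _i : Fin n, min (μ Ip) (μ Im) := by simp
      _ ≤ _ := by
        refine Finset.prod_le_prod' fun i _ => ?_
        split_ifs
        · exact min_le_left _ _
        · exact min_le_right _ _
        · exact (min_le_left _ _).trans (by rw [measure_univ]; exact prob_le_one)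
  have hbound : ∀ j : ℕ, P {ω | ∀ t ≥ T, randomState ε S x0 ξ t ω ∈ D} ≤ (1 - p ^ L) ^ j := by
    intro j
    refine (measure_stay_le hmeas hindep hident hD T (j * L)).trans ?_
    calc _ ≤ ∫⁻ _, (1 - p ^ L) ^ j ∂P := lintegral_mono fun ω => by
            simpa using stayProb_le_pow hIp hIm hpJ (fun x hx => hL x hx trivial) j 0 _
              (inCube_randomState hx0 T ω)
      _ = (1 - p ^ L) ^ j := by simp
  have hlt : 1 - p ^ L < 1 :=
    ENNReal.sub_lt_self ENNReal.one_ne_top one_ne_zero (ENNReal.pow_pos (ENNReal.pow_pos hq n) L).ne'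
  exact le_antisymm (ge_of_tendsto' (ENNReal.tendsto_pow_atTop_nhds_zero_of_lt_one hlt) hbound)
    zero_le

end NoiseHistory

/-! ### Noise bounded by `ε / 2` -/

lemma exists_hull {n : ℕ} [NeZero n] (x : Fin n → ℝ) :
    ∃ p q, (∀ i, x q ≤ x i ∧ x i ≤ x p) ∧ opinionDiam x = x p - x q := by
  obtain ⟨p, hp⟩ := Finite.exists_max x
  obtain ⟨q, hq⟩ := Finite.exists_min x
  refine ⟨p, q, fun i => ⟨hq i, hp i⟩, le_antisymm ?_ ?_⟩
  · exact opinionDiam_le_iff.2 fun i j =>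
      abs_le.2 ⟨by linarith [hq i, hp j], by linarith [hp i, hq j]⟩
  · exact (le_abs_self _).trans (opinionDiam_le_iff.1 le_rfl p q)

lemma opinionDiam_le_of_forall {n : ℕ} [NeZero n] {x : Fin n → ℝ} {l r d : ℝ}
    (h : ∀ i, l ≤ x i ∧ x i ≤ r) (hd : r - l ≤ d) : opinionDiam x ≤ d :=
  opinionDiam_le_iff.2 fun i j => abs_le.2
    ⟨by linarith [(h i).1, (h j).2], by linarith [(h i).2, (h j).1]⟩

/-- The policy that pushes agents with local mean at most `θ` upwards and the others downwards. -/
def thresholdPolicy {n : ℕ} (ε θ : ℝ) (x : Fin n → ℝ) : Set (Fin n) := {i | localMean ε x i ≤ θ}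

section HalfRadius

variable {n : ℕ} {ε a c : ℝ} {S : Finset (Fin n)}

/-- The threshold lies at distance at least ε/2 from both ends of `[m, M]`, so a push toward the far
side stays inside `[m, M]`, and truncation never acts on the noisy agents. -/
lemma hkStep_thresholdPolicy {m M θ : ℝ} {x u : Fin n → ℝ} (ha : 0 < a) (hε : 0 ≤ ε)
    (hm0 : 0 ≤ m) (hM1 : M ≤ 1)
    (hu : u ∈ signControl S (Set.Icc a (ε / 2)) (Set.Icc (-(ε / 2)) (-a))
      (thresholdPolicy ε θ x)) (hml : m + ε / 2 ≤ θ) (hMl : θ ≤ M - ε / 2)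
    (hxM : ∀ i, m ≤ x i ∧ x i ≤ M) {s : Fin n} (hs : s ∈ S) :
    (localMean ε x s ≤ θ → localMean ε x s + a ≤ hkStep ε S x u s ∧
      hkStep ε S x u s ≤ localMean ε x s + ε / 2) ∧
    (θ < localMean ε x s → localMean ε x s - ε / 2 ≤ hkStep ε S x u s ∧
      hkStep ε S x u s ≤ localMean ε x s - a) := by
  have h1 : m ≤ localMean ε x s := le_localMean hε fun j _ => (hxM j).1
  have h2 : localMean ε x s ≤ M := localMean_le hε fun j _ => (hxM j).2
  rw [hkStep_of_mem u hs]
  constructor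
  · intro h
    obtain ⟨h3, h4⟩ := (hu s hs).1 h
    rw [clip_of_mem (by linarith) (by linarith)]
    constructor <;> linarith
  · intro h
    obtain ⟨h3, h4⟩ := (hu s hs).2 (not_le.2 h)
    rw [clip_of_mem (by linarith) (by linarith)]
    constructor <;> linarith

/-- With noise of size in `[a, ε / 2]`, the diameter can be lowered to `ε + c`. -/
lemma leads_opinionDiam_le_add [NeZero n] (hS : S.Nonempty) (ha : 0 < a) (haε : a ≤ ε / 2)
    (hc : 0 < c) (hca : c ≤ a) :
    Leads ε S (Set.Icc a (ε / 2)) (Set.Icc (-(ε / 2)) (-a))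
      (fun _ => True) (fun x => opinionDiam x ≤ ε + c) := by
  have hn : (1 : ℝ) ≤ n := by exact_mod_cast NeZero.one_le
  have hn0 : (0 : ℝ) < n := by linarith
  have hε : 0 < ε := by linarith
  set η : ℝ := c / (4 * n) with hη
  set δ : ℝ := η / n with hδ
  have hη0 : 0 < η := by positivity
  have hδ0 : 0 < δ := by positivity
  have hηc : η * (4 * n) = c := by rw [hη]; field_simp
  have hη4 : 4 * η ≤ c := by nlinarith
  have hδη : δ ≤ η := div_le_self hη0.le hn
  have hηn : η ≤ ε / n := by rw [le_div_iff₀ hn0]; nlinarith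
  obtain ⟨Ts, hTs⟩ := exists_settled (ε := ε) (η := η) (a := a) hS hη0 (by linarith)
    (by nlinarith) 0
  refine Leads.of_descent opinionDiam (A := 0) (B := 1) hδ0 (Ts + 3)
    (fun x _ _ => opinionDiam_nonneg x) (fun x hx _ => hx.opinionDiam_le_one) fun x hx _ => ?_
  by_cases hd : opinionDiam x ≤ ε + c
  · exact Forces.of_target (Or.inl hd) _
  push Not at hd
  refine Forces.mono_target (G := fun y => opinionDiam y ≤ opinionDiam x - δ) ?_ hx
    fun y _ hy => Or.inr ⟨trivial, hy⟩
  obtain ⟨p, q, hpq, hdx⟩ := exists_hull x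
  set M := x p
  set m := x q
  rw [hdx] at hd ⊢
  -- This threshold keeps every noisy agent at least `c / 2` below `M` after each step.
  set θ := M - ε / 2 - c / 2 with hθ
  refine Forces.of_policy (Set.nonempty_Icc.2 haε) (Set.nonempty_Icc.2 (by linarith))
    (thresholdPolicy ε θ) _ fun z u hz hu => ?_
  by_contra! hcon
  have hcube : ∀ t, InCube (z t) := by
    intro t
    cases t with
    | zero => rw [hz]; exact hx
    | succ t => rw [(hu t).2]; exact inCube_hkStep ε S (z t) (u t)
  have hm0 : 0 ≤ m := (hx q).1
  have hM1 : M ≤ 1 := (hx p).2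
  have hmean : ∀ t, (∀ i, m ≤ z t i ∧ z t i ≤ M) → ∀ i,
      m ≤ localMean ε (z t) i ∧ localMean ε (z t) i ≤ M := fun t ht i =>
    ⟨le_localMean hε.le fun j _ => (ht j).1, localMean_le hε.le fun j _ => (ht j).2⟩
  have hnoisy : ∀ t, (∀ i, m ≤ z t i ∧ z t i ≤ M) → ∀ s ∈ S,
      m ≤ z (t + 1) s ∧ z (t + 1) s ≤ M - c / 2 := by
    intro t ht s hs
    have h := hkStep_thresholdPolicy ha hε.le hm0 hM1 (hu t).1 (by linarith)
      (by linarith) ht hs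
    rw [← (hu t).2] at h
    have h1 := hmean t ht s
    rcases le_or_gt (localMean ε (z t) s) θ with h2 | h2
    · have := h.1 h2
      constructor <;> linarith
    · have := h.2 h2
      constructor <;> linarith
  have hnon : ∀ t, ∀ i ∉ S, z (t + 1) i = localMean ε (z t) i := fun t i hi => by
    rw [(hu t).2, hkStep_of_notMem hε.le (hcube t) _ hi]
  have hhull : ∀ t i, m ≤ z t i ∧ z t i ≤ M := by
    intro t
    induction t with
    | zero => rw [hz]; exact hpq
    | succ t ih =>
      intro i
      by_cases hi : i ∈ S
      · have := hnoisy t ih i hi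
        constructor <;> linarith
      · rw [hnon t i hi]; exact hmean t ih i
  have hmax : ∀ t ≤ Ts + 3, ∃ i, M - δ < z t i := by
    intro t ht
    by_contra! h
    exact absurd (hcon t ht) (not_lt.2 (opinionDiam_le_of_forall
      (fun i => ⟨(hhull t i).1, h i⟩) (by linarith)))
  -- As in `exists_settled_aux`, mirrored: an agent in `[M - ε, M - η]` would pull everyone down to
  -- `M - δ` at the next step, which would shrink the hull.
  have hgap : ∀ t, t + 1 ≤ Ts + 3 → ∀ j, M - ε ≤ z t j → M - η < z t j := by
    intro t ht j hj
    by_contra! hj'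
    obtain ⟨i, hi⟩ := hmax (t + 1) ht
    by_cases hiS : i ∈ S
    · linarith [(hnoisy t (hhull t) i hiS).2]
    rw [hnon t i hiS] at hi
    refine absurd hi (not_lt.2 ?_)
    rcases le_total (z t j) (z t i) with h | h
    · refine localMean_le_sub (k := j) hε.le (fun l _ => (hhull t l).2) ?_ hη0.le hj'
      rw [abs_of_nonpos (by linarith)]
      linarith [(hhull t i).2]
    · exact localMean_le_sub (k := i) hε.le (fun l _ => (hhull t l).2) (by simpa using hε.le)
        hη0.le (by linarith)
  have hlowS : ∀ t, t + 2 ≤ Ts + 3 → ∀ s ∈ S, z (t + 1) s < M - ε := by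
    intro t ht s hs
    by_contra! h
    linarith [hgap (t + 1) (by omega) s h, (hnoisy t (hhull t) s hs).2]
  -- A top agent seeing anyone below `M - ε` would land in the zone forbidden by `hgap`.
  have hfar : ∀ t, t + 3 ≤ Ts + 3 → ∀ i, M - ε ≤ z (t + 1) i → ∀ l, z (t + 1) l < M - ε →
      ε < z (t + 1) i - z (t + 1) l := by
    intro t ht i hi l hl
    by_contra! hle
    have hi' := hgap (t + 1) (by omega) i hi
    have hiS : i ∉ S := fun h => by linarith [hlowS t (by omega) i h]
    have hnear : |z (t + 1) l - z (t + 1) i| ≤ ε := by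
      rw [abs_of_nonpos (by linarith)]; linarith
    have hA : localMean ε (z (t + 1)) i ≤ M - ε / n :=
      localMean_le_sub (k := l) hε.le (fun l _ => (hhull _ l).2) hnear hε.le hl.le
    have hB : z (t + 1) i - ε + ε / n ≤ localMean ε (z (t + 1)) i :=
      le_localMean_add (k := i) hε.le (fun l hl => by linarith [(abs_le.1 hl).1])
        (by simpa using hε.le) hε.le (by linarith)
    rw [← hnon (t + 1) i hiS] at hA hB
    linarith [hgap (t + 1 + 1) (by omega) i (by linarith)]
  -- The noisy agents see nobody from the top group, so their means stay below the threshold and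
  -- they are always pushed up. They would have to come near 1, yet they are confined below `M - ε`.
  obtain ⟨t, ht, h⟩ := hTs (fun t => z (t + 1)) (fun t => hcube _) (fun t _ => hnon (t + 1))
    (by
      intro t ht s hs
      have hlow : localMean ε (z (t + 1)) s ≤ M - ε := by
        refine localMean_le hε.le fun j hj => ?_
        by_contra! hj'
        linarith [hfar t (by omega) j hj'.le s (hlowS t (by omega) s hs), (abs_le.1 hj).2]
      have h := (hkStep_thresholdPolicy ha hε.le hm0 hM1 (hu (t + 1)).1
        (by linarith) (by linarith) (hhull (t + 1)) hs).1 (by linarith)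
      rw [← (hu (t + 1)).2] at h
      exact (min_le_right _ _).trans h.1)
  obtain ⟨s, hs⟩ := hS
  linarith [(h t le_rfl le_rfl).2 s hs, hlowS t (by omega) s hs]

/-- If the opinions form two tight clusters at the ends of the interval `[m, M]`, an agent `s` of
the top cluster and an agent `j` of the bottom cluster that does not see some agent of the top
cluster have clearly different local means. -/
lemma localMean_sub_localMean_ge {ε r m M : ℝ} {x : Fin n → ℝ} (hr : 0 ≤ r)
    (hrε : r ≤ ε) (hgap : m + r < M - r) (hεM : ε ≤ M - m) (hx : ∀ i, m ≤ x i ∧ x i ≤ M)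
    (htight : ∀ i, x i < m + r ∨ M - r < x i) {s j i : Fin n} (hs : M - r < x s)
    (hj : x j < m + r) (hi : M - r < x i) (hji : ε < |x i - x j|) :
    ε / n ^ 2 - 2 * r ≤ localMean ε x s - localMean ε x j := by
  classical
  set top : Finset (Fin n) := {k | M - r < x k} with htop
  set bot : Finset (Fin n) := {k | ¬ M - r < x k} with hbot
  have hcard : top.card + bot.card = n := by
    have := Finset.card_filter_add_card_filter_not (s := (Finset.univ : Finset (Fin n)))
      (fun k => M - r < x k)
    rw [Finset.card_univ, Fintype.card_fin] at this
    exact this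
  have hsplit : ∀ l, (neighbors ε x l).card = ((neighbors ε x l).filter (M - r < x ·)).card +
      ((neighbors ε x l).filter (¬ M - r < x ·)).card := fun l =>
    (Finset.card_filter_add_card_filter_not _).symm
  have hmean : ∀ l (A B : ℝ), (∀ k, |x k - x l| ≤ ε → M - r < x k → A ≤ x k) →
      (∀ k, |x k - x l| ≤ ε → ¬ M - r < x k → B ≤ x k) →
      ((neighbors ε x l).filter (M - r < x ·)).card * A +
      ((neighbors ε x l).filter (¬ M - r < x ·)).card * B ≤ ∑ k ∈ neighbors ε x l, x k := by
    intro l A B hA hB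
    rw [← Finset.sum_filter_add_sum_filter_not (neighbors ε x l) (M - r < x ·)]
    refine add_le_add ?_ ?_
    · rw [← nsmul_eq_mul]
      exact Finset.card_nsmul_le_sum _ _ _ fun k hk =>
        hA k (mem_neighbors.1 (Finset.mem_filter.1 hk).1) (Finset.mem_filter.1 hk).2
    · rw [← nsmul_eq_mul]
      exact Finset.card_nsmul_le_sum _ _ _ fun k hk =>
        hB k (mem_neighbors.1 (Finset.mem_filter.1 hk).1) (Finset.mem_filter.1 hk).2
  have hmean' : ∀ l (A B : ℝ), (∀ k, |x k - x l| ≤ ε → M - r < x k → x k ≤ A) →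
      (∀ k, |x k - x l| ≤ ε → ¬ M - r < x k → x k ≤ B) →
      ∑ k ∈ neighbors ε x l, x k ≤ ((neighbors ε x l).filter (M - r < x ·)).card * A +
      ((neighbors ε x l).filter (¬ M - r < x ·)).card * B := by
    intro l A B hA hB
    rw [← Finset.sum_filter_add_sum_filter_not (neighbors ε x l) (M - r < x ·)]
    refine add_le_add ?_ ?_
    · rw [← nsmul_eq_mul]
      exact Finset.sum_le_card_nsmul _ _ _ fun k hk =>
        hA k (mem_neighbors.1 (Finset.mem_filter.1 hk).1) (Finset.mem_filter.1 hk).2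
    · rw [← nsmul_eq_mul]
      exact Finset.sum_le_card_nsmul _ _ _ fun k hk =>
        hB k (mem_neighbors.1 (Finset.mem_filter.1 hk).1) (Finset.mem_filter.1 hk).2
  have h1 := hmean s (M - r) m (fun k _ h => h.le) (fun k _ _ => (hx k).1)
  have h2 := hmean' j M (m + r) (fun k _ _ => (hx k).2)
    (fun k _ h => ((htight k).resolve_right h).le)
  have hst : (neighbors ε x s).filter (M - r < x ·) = top := by
    ext k
    simp only [htop, Finset.mem_filter, Finset.mem_univ, true_and, mem_neighbors,
      and_iff_right_iff_imp]
    intro hk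
    rw [abs_le]
    constructor <;> linarith [(hx k).2, (hx s).2]
  have hjb : (neighbors ε x j).filter (¬ M - r < x ·) = bot := by
    ext k
    simp only [hbot, Finset.mem_filter, Finset.mem_univ, true_and, mem_neighbors,
      and_iff_right_iff_imp]
    intro hk
    have := (htight k).resolve_right hk
    rw [abs_le]
    constructor <;> linarith [(hx k).1, (hx j).1]
  have hsb : ((neighbors ε x s).filter (¬ M - r < x ·)).card ≤ bot.card :=
    Finset.card_le_card (Finset.filter_subset_filter _ (Finset.subset_univ _))
  have hjt : ((neighbors ε x j).filter (M - r < x ·)).card + 1 ≤ top.card := by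
    refine Finset.card_lt_card (Finset.ssubset_iff_of_subset
      (Finset.filter_subset_filter _ (Finset.subset_univ _)) |>.2 ⟨i, ?_, ?_⟩)
    · simpa [htop] using hi
    · simp only [Finset.mem_filter, mem_neighbors, not_and_or]
      exact Or.inl (not_le.2 hji)
  have hbot1 : 1 ≤ bot.card := Finset.card_pos.2 ⟨j, by simp [hbot]; linarith⟩
  have e1 := localMean_eq_div ε x s
  have e2 := localMean_eq_div ε x j
  rw [hsplit, hst] at e1
  rw [hsplit, hjb] at e2
  rw [hst] at h1
  rw [hjb] at h2
  generalize ((neighbors ε x s).filter (¬ M - r < x ·)).card = b' at *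
  generalize ((neighbors ε x j).filter (M - r < x ·)).card = a' at *
  generalize top.card = A at *
  generalize bot.card = B at *
  have hn : (n : ℝ) = A + B := by rw [← hcard]; push_cast; ring
  have hb'B : (b' : ℝ) ≤ B := by exact_mod_cast hsb
  have ha'A : (a' : ℝ) + 1 ≤ A := by exact_mod_cast hjt
  have hB1 : (1 : ℝ) ≤ B := by exact_mod_cast hbot1
  have hb0 : (0 : ℝ) ≤ b' := by positivity
  have ha0 : (0 : ℝ) ≤ a' := by positivity
  have f1 : M - (M - m) * (B / (A + B)) - r ≤ localMean ε x s := by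
    rw [e1]
    push_cast
    rw [le_div_iff₀ (by linarith)]
    have : B / (A + B) * (A + b') ≥ (b' : ℝ) := by
      rw [ge_iff_le, div_mul_eq_mul_div, le_div_iff₀ (by linarith)]
      nlinarith
    nlinarith
  have f2 : localMean ε x j ≤ m + (M - m) * (a' / (a' + B)) + r := by
    rw [e2]
    push_cast
    rw [div_le_iff₀ (by linarith)]
    have : (a' : ℝ) / (a' + B) * (a' + B) = a' := div_mul_cancel₀ _ (by linarith)
    nlinarith
  -- With exact clusters, `s` gives the top cluster weight at least `A / (A + B)` and `j` gives it
  -- weight `a' / (a' + B)`. These weights differ because `j` misses at least one top agent.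
  have f3 : (1 : ℝ) / n ^ 2 ≤ 1 - B / (A + B) - a' / (a' + B) := by
    have : (1 : ℝ) - B / (A + B) - a' / (a' + B) = B * (A - a') / ((A + B) * (a' + B)) := by
      have h3 : (A : ℝ) + B ≠ 0 := by linarith
      have h4 : (a' : ℝ) + B ≠ 0 := by linarith
      field_simp
      ring
    rw [this, hn, sq]
    refine div_le_div₀ (by nlinarith) (by nlinarith) (by nlinarith) ?_
    exact mul_le_mul_of_nonneg_left (by linarith) (by linarith)
  have f4 : ε / n ^ 2 = ε * (1 / n ^ 2) := by ring
  have f5 : ε * (1 / n ^ 2) ≤ (M - m) * (1 - B / (A + B) - a' / (a' + B)) :=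
    mul_le_mul hεM f3 (by positivity) (by linarith)
  rw [f4]
  nlinarith

/-- The target is the window of width ε centred in `[m, M]`, whose ends are at most `c / 2` inside.
The push moves a noisy agent in by `a ≥ c`, and a neighbour at depth `n * c` moves a noise-free mean
in by `c`. -/
lemma opinionDiam_hkStep_le_of_middle [NeZero n] {m M : ℝ} {x u : Fin n → ℝ} (ha : 0 < a)
    (hε : 0 ≤ ε) (hc : 0 ≤ c) (hca : c ≤ a) (hx : InCube x) (hm0 : 0 ≤ m) (hM1 : M ≤ 1)
    (hxM : ∀ i, m ≤ x i ∧ x i ≤ M) (h1 : ε ≤ M - m) (h2 : M - m ≤ ε + c)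
    (hu : u ∈ signControl S (Set.Icc a (ε / 2)) (Set.Icc (-(ε / 2)) (-a))
      (thresholdPolicy ε ((m + M) / 2) x))
    (hmid : ∀ i ∉ S, ∃ k, |x k - x i| ≤ ε ∧ m + n * c ≤ x k ∧ x k ≤ M - n * c) :
    opinionDiam (hkStep ε S x u) ≤ ε := by
  have hn0 : (n : ℝ) ≠ 0 := by exact_mod_cast NeZero.ne n
  refine opinionDiam_le_of_forall (l := (m + M) / 2 - ε / 2) (r := (m + M) / 2 + ε / 2)
    (fun i => ?_) (by linarith)
  by_cases hi : i ∈ S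
  · have h := hkStep_thresholdPolicy ha hε hm0 hM1 hu (by linarith) (by linarith) hxM hi
    have h3 : m ≤ localMean ε x i := le_localMean hε fun j _ => (hxM j).1
    have h4 : localMean ε x i ≤ M := localMean_le hε fun j _ => (hxM j).2
    rcases le_or_gt (localMean ε x i) ((m + M) / 2) with h5 | h5
    · have := h.1 h5
      constructor <;> linarith
    · have := h.2 h5
      constructor <;> linarith
  · obtain ⟨k, hk, hk1, hk2⟩ := hmid i hi
    have h3 := localMean_le_sub hε (fun j _ => (hxM j).2) hk
      (by positivity : 0 ≤ n * c) hk2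
    have h4 := le_localMean_add hε (fun j _ => (hxM j).1) hk
      (by positivity : 0 ≤ n * c) hk1
    rw [mul_div_cancel_left₀ _ hn0] at h3 h4
    rw [hkStep_of_notMem hε hx u hi]
    constructor <;> linarith

/-- If the step puts nobody in the middle, then every agent that sees both end clusters is noisy,
and every noisy agent sees both. A noise-free agent therefore misses part of the opposite cluster.
This makes the means of two noisy agents, one in each cluster, so different that pushing one of them
lands it in the middle after all. -/
lemma exists_middle_of_tight [NeZero n] {m M : ℝ} {x u : Fin n → ℝ} (hS : S.Nonempty)
    (ha : 0 < a) (haε : a ≤ ε / 2) (hc : 0 < c) (hca : 8 * n ^ 3 * c ≤ a) (hx : InCube x)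
    (hm0 : 0 ≤ m) (hM1 : M ≤ 1) (hxM : ∀ i, m ≤ x i ∧ x i ≤ M) (h1 : ε ≤ M - m)
    (h2 : M - m ≤ ε + c) (htight : ∀ i, x i < m + n * c ∨ M - n * c < x i)
    (hu : u ∈ signControl S (Set.Icc a (ε / 2)) (Set.Icc (-(ε / 2)) (-a))
      (thresholdPolicy ε ((m + M) / 2) x)) :
    opinionDiam (hkStep ε S x u) ≤ ε ∨ ∃ k, m + 2 * (n * c) ≤ hkStep ε S x u k ∧
      hkStep ε S x u k ≤ M - 2 * (n * c) := by
  have hn : (1 : ℝ) ≤ n := by exact_mod_cast NeZero.one_le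
  have hn0 : (0 : ℝ) < n := by linarith
  have hε : 0 < ε := by linarith
  set r : ℝ := n * c with hr
  have hr0 : 0 < r := by positivity
  have hrn : 8 * (n * r) ≤ a := by
    have : (n : ℝ) ^ 2 ≤ n ^ 3 := pow_le_pow_right₀ hn (by norm_num)
    nlinarith
  have hra : 8 * r ≤ a := by nlinarith
  have hcr : c ≤ r := by nlinarith
  have hrε : 6 * r ≤ ε / n ^ 2 := by
    rw [le_div_iff₀ (by positivity)]
    have : 6 * r * n ^ 2 = 6 * n ^ 3 * c := by rw [hr]; ring
    nlinarith
  have hγ : ∀ A : ℝ, r * n ≤ A → r ≤ A / n := fun A hA => by rwa [le_div_iff₀ hn0]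
  by_contra! hcon
  obtain ⟨hdiam, hmid⟩ := hcon
  set y := hkStep ε S x u with hy
  have hpol : ∀ s ∈ S, _ := fun s hs =>
    hkStep_thresholdPolicy ha hε.le hm0 hM1 hu (by linarith) (by linarith) hxM hs
  have hside : ∀ i k l, |x k - x i| ≤ ε → M - r < x k → |x l - x i| ≤ ε → x l < m + r →
      i ∈ S := by
    intro i k l hk hk1 hl hl1
    by_contra hi
    have h3 := localMean_le_sub (θ := M - m - r) hε.le (fun j _ => (hxM j).2) hl
      (by linarith) (by linarith)
    have h4 := le_localMean_add (θ := M - m - r) hε.le (fun j _ => (hxM j).1) hk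
      (by linarith) (by linarith)
    have h5 : 2 * r ≤ (M - m - r) / n := by
      rw [le_div_iff₀ hn0]
      nlinarith
    have h6 := hmid i (by rw [hy, hkStep_of_notMem hε.le hx u hi]; linarith)
    rw [hy, hkStep_of_notMem hε.le hx u hi] at h6
    linarith
  have hseeBot : ∀ s ∈ S, ∃ l, |x l - x s| ≤ ε ∧ x l < m + r := by
    intro s hs
    by_contra! h
    have h3 : M - r ≤ localMean ε x s := le_localMean hε.le fun j hj =>
      ((htight j).resolve_left (not_lt.2 (h j hj))).le
    have h4 := (hpol s hs).2 (by linarith)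
    have h5 : localMean ε x s ≤ M := localMean_le hε.le fun j _ => (hxM j).2
    linarith [hmid s (by linarith)]
  have hseeTop : ∀ s ∈ S, ∃ l, |x l - x s| ≤ ε ∧ M - r < x l := by
    intro s hs
    by_contra! h
    have h3 : localMean ε x s ≤ m + r := localMean_le hε.le fun j hj =>
      ((htight j).resolve_right (not_lt.2 (h j hj))).le
    have h4 := (hpol s hs).1 (by linarith)
    have h5 : m ≤ localMean ε x s := le_localMean hε.le fun j _ => (hxM j).1
    linarith [hmid s (by linarith)]
  -- A noisy agent sees someone in the opposite cluster; that agent sees both clusters as well, so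
  -- it is noisy too.
  obtain ⟨s, j, hsS, hjS, hs, hj⟩ : ∃ s j, s ∈ S ∧ j ∈ S ∧ M - r < x s ∧ x j < m + r := by
    obtain ⟨s₀, hs₀⟩ := hS
    have hself : ∀ i, |x i - x i| ≤ ε := fun i => by simpa using hε.le
    rcases htight s₀ with h | h
    · obtain ⟨p, hp, hp1⟩ := hseeTop s₀ hs₀
      exact ⟨p, s₀, hside p p s₀ (hself p) hp1 (by rwa [abs_sub_comm]) h, hs₀, hp1, h⟩
    · obtain ⟨q, hq, hq1⟩ := hseeBot s₀ hs₀
      exact ⟨s₀, q, hs₀, hside q s₀ q (by rwa [abs_sub_comm]) h (hself q) hq1, h, hq1⟩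
  obtain ⟨i, hi⟩ : ∃ i, i ∉ S := by
    by_contra! hall
    refine hdiam.not_ge (opinionDiam_hkStep_le_of_middle ha hε.le hc.le (by linarith) hx hm0 hM1
      hxM h1 h2 hu fun i hi => absurd (hall i) hi)
  have hdiff : ε / n ^ 2 - 2 * r ≤ localMean ε x s - localMean ε x j := by
    rcases htight i with h | h
    · have h3 : ε < |x i - x s| := by
        by_contra! h3
        exact hi (hside i s i (by rwa [abs_sub_comm]) hs (by simpa using hε.le) h)
      have := localMean_sub_localMean_ge (ε := ε) (x := fun k => 1 - x k) (m := 1 - M) (M := 1 - m)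
        (s := j) (j := s) (i := i) hr0.le (by linarith) (by linarith) (by linarith)
        (fun k => ⟨by linarith [(hxM k).2], by linarith [(hxM k).1]⟩)
        (fun k => (htight k).symm.imp (fun h => by linarith) (fun h => by linarith))
        (by linarith) (by linarith) (by linarith)
        (by rw [← abs_neg]; convert h3 using 2; ring)
      rw [localMean_one_sub hε.le, localMean_one_sub hε.le] at this
      linarith
    · have h3 : ε < |x i - x j| := by
        by_contra! h3
        exact hi (hside i i j (by simpa using hε.le) h (by rwa [abs_sub_comm]) hj)
      exact localMean_sub_localMean_ge hr0.le (by linarith) (by linarith) h1 hxM htight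
        hs hj h h3
  have hm' : ∀ k, m ≤ localMean ε x k := fun k => le_localMean hε.le fun j _ => (hxM j).1
  have hM' : ∀ k, localMean ε x k ≤ M := fun k => localMean_le hε.le fun j _ => (hxM j).2
  -- The two means differ by at least `4 * r`. Either that of `s` is `2 * r` above the midpoint or
  -- that of `j` is `2 * r` below it, and a push across the midpoint then ends in the middle.
  rcases le_or_gt ((m + M) / 2 + 2 * r) (localMean ε x s) with h | h
  · have h3 := (hpol s hsS).2 (by linarith)
    linarith [hmid s (by linarith), hM' s]
  · have h3 := (hpol j hjS).1 (by linarith)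
    linarith [hmid j (by linarith [hm' j])]

/-- With noise of size in `[a, ε / 2]`, one can force the diameter below `ε`. -/
theorem leads_opinionDiam_le_of_half [NeZero n] (hS : S.Nonempty) (ha : 0 < a)
    (haε : a ≤ ε / 2) :
    Leads ε S (Set.Icc a (ε / 2)) (Set.Icc (-(ε / 2)) (-a))
      (fun _ => True) (fun x => opinionDiam x ≤ ε) := by
  have hn : (1 : ℝ) ≤ n := by exact_mod_cast NeZero.one_le
  have hn3 : (1 : ℝ) ≤ n ^ 3 := one_le_pow₀ hn
  have hε : 0 < ε := by linarith
  set c := a / (8 * n ^ 3) with hc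
  have hc0 : 0 < c := by positivity
  have hca : 8 * n ^ 3 * c ≤ a := by rw [hc]; field_simp; exact le_rfl
  have hca' : c ≤ a := by nlinarith
  refine (leads_opinionDiam_le_add hS ha haε hc0 hca').trans ?_
  let Mid : (Fin n → ℝ) → Prop := fun x => ε < opinionDiam x ∧ opinionDiam x ≤ ε + c ∧
    ∃ p q k, opinionDiam x = x p - x q ∧ (∀ i, x q ≤ x i ∧ x i ≤ x p) ∧
      x q + n * c ≤ x k ∧ x k ≤ x p - n * c
  have hMid : Leads ε S (Set.Icc a (ε / 2)) (Set.Icc (-(ε / 2)) (-a)) Mid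
      (fun x => opinionDiam x ≤ ε) := by
    refine Leads.step fun x hx ⟨h1, h2, p, q, k, hd, hpq, hk1, hk2⟩ =>
      ⟨thresholdPolicy ε ((x q + x p) / 2) x, fun u hu => ?_⟩
    rw [hd] at h1 h2
    refine opinionDiam_hkStep_le_of_middle ha hε.le hc0.le hca' hx (hx q).1 (hx p).2 hpq h1.le h2
      hu fun i _ => ⟨k, ?_, hk1, hk2⟩
    rw [abs_le]
    constructor <;> nlinarith [(hpq i).1, (hpq i).2]
  refine Leads.trans (G := fun x => opinionDiam x ≤ ε ∨ Mid x) ?_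
    ((Leads.of_imp fun _ _ h => h).or hMid)
  have hstep : Leads ε S (Set.Icc a (ε / 2)) (Set.Icc (-(ε / 2)) (-a))
      (fun x => ε < opinionDiam x ∧ opinionDiam x ≤ ε + c ∧ ¬ Mid x)
      (fun x => opinionDiam x ≤ ε ∨ Mid x) := by
    refine Leads.step fun x hx ⟨h1, h2, h3⟩ => ?_
    obtain ⟨p, q, hpq, hd⟩ := exists_hull x
    refine ⟨thresholdPolicy ε ((x q + x p) / 2) x, fun u hu => ?_⟩
    have h1' := h1
    have h2' := h2
    rw [hd] at h1' h2'
    have htight : ∀ i, x i < x q + n * c ∨ x p - n * c < x i := by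
      intro i
      by_contra! h
      exact h3 ⟨h1, h2, p, q, i, hd, hpq, h.1, h.2⟩
    rcases exists_middle_of_tight hS ha haε hc0 hca hx (hx q).1 (hx p).2 hpq h1'.le h2' htight hu
      with h | ⟨k, hk1, hk2⟩
    · exact Or.inl h
    rcases le_or_gt (opinionDiam (hkStep ε S x u)) ε with h | h
    · exact Or.inl h
    obtain ⟨p', q', hpq', hd'⟩ := exists_hull (hkStep ε S x u)
    have hin : ∀ i, x q ≤ hkStep ε S x u i ∧ hkStep ε S x u i ≤ x p := by
      intro i
      have h4 : x q ≤ localMean ε x i := le_localMean hε.le fun j _ => (hpq j).1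
      have h5 : localMean ε x i ≤ x p := localMean_le hε.le fun j _ => (hpq j).2
      by_cases hi : i ∈ S
      · have hs := hkStep_thresholdPolicy ha hε.le (hx q).1 (hx p).2 hu (by linarith)
          (by linarith) hpq hi
        rcases le_or_gt (localMean ε x i) ((x q + x p) / 2) with h6 | h6
        · have := hs.1 h6
          constructor <;> linarith
        · have := hs.2 h6
          constructor <;> linarith
      · rw [hkStep_of_notMem hε.le hx u hi]
        exact ⟨h4, h5⟩
    -- The new hull lies in the old one and is longer than ε, so each end has moved by at most `c`.
    -- Depth `2 * (n * c)` in the old hull leaves depth `n * c` in the new one.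
    rw [hd'] at h
    refine Or.inr ⟨by rw [hd']; exact h, ?_, p', q', k, hd', hpq', ?_, ?_⟩
    · rw [hd']
      linarith [(hin p').2, (hin q').1]
    · nlinarith [(hin p').2, (hin q').1]
    · nlinarith [(hin p').2, (hin q').1]
  obtain ⟨L, hL⟩ := hstep
  refine ⟨L, fun x hx h => ?_⟩
  by_cases h1 : opinionDiam x ≤ ε
  · exact Forces.of_target (Or.inl h1) L
  by_cases h2 : Mid x
  · exact Forces.of_target (Or.inr h2) L
  exact hL x hx ⟨not_le.1 h1, h, h2⟩

end HalfRadius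

/-! ### A single noisy agent with noise bounded by `ε` -/

lemma localMean_lt {n : ℕ} {ε : ℝ} (hε : 0 ≤ ε) {x : Fin n → ℝ} {i : Fin n} {B : ℝ}
    (h : ∀ j, |x j - x i| ≤ ε → x j < B) : localMean ε x i < B := by
  obtain ⟨k, hk, hmax⟩ := Finset.exists_max_image (neighbors ε x i) x
    ⟨i, self_mem_neighbors hε x i⟩
  exact (localMean_le hε fun j hj => hmax j (mem_neighbors.2 hj)).trans_lt
    (h k (mem_neighbors.1 hk))

lemma localMean_eq_const {n : ℕ} {ε : ℝ} (hε : 0 ≤ ε) {x : Fin n → ℝ} {i : Fin n} {B : ℝ}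
    (h : ∀ j, |x j - x i| ≤ ε → x j = B) : localMean ε x i = B :=
  le_antisymm (localMean_le hε fun j hj => (h j hj).le)
    (le_localMean hε fun j hj => (h j hj).ge)

/-- Two clusters `P` at `p` and `Q` at `q` of noise-free agents; all other noise-free agents are
out of reach below `Q`. -/
structure TwoClusters {n : ℕ} (ε : ℝ) (s : Fin n) (P Q : Finset (Fin n)) (p q : ℝ)
    (x : Fin n → ℝ) : Prop where
  nonempty_left : P.Nonempty
  nonempty_right : Q.Nonempty
  notMem_left : s ∉ P
  notMem_right : s ∉ Q
  disjoint : Disjoint P Q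
  eq_left : ∀ i ∈ P, x i = p
  eq_right : ∀ i ∈ Q, x i = q
  lt_of_notMem : ∀ i, i ≠ s → i ∉ P → i ∉ Q → x i < q - ε

/-- Two noise-free agents with different opinions are about to merge. -/
def AboutToMerge {n : ℕ} (ε : ℝ) (s : Fin n) (x : Fin n → ℝ) : Prop :=
  ∃ i j, i ≠ s ∧ j ≠ s ∧ x i ≠ x j ∧ localMean ε x i = localMean ε x j

/-- Two clusters within reach of each other, with the noisy agent not below the reach of the upper
one. -/
def ClustersInReach {n : ℕ} (ε : ℝ) (s : Fin n) (x : Fin n → ℝ) : Prop :=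
  ∃ P Q p q, TwoClusters ε s P Q p q x ∧ q < p ∧ p - q ≤ ε ∧ p - ε ≤ x s

/-- Two clusters out of reach of each other, with the noisy agent in between. -/
def ClustersApart {n : ℕ} (ε : ℝ) (s : Fin n) (D : ℝ) (x : Fin n → ℝ) : Prop :=
  ∃ P Q p q, TwoClusters ε s P Q p q x ∧ ε < p - q ∧ p - q ≤ 2 * ε ∧ q ≤ x s ∧ x s ≤ p ∧
    p - q ≤ D

/-- Noise-free agents agree or are more than `ε` apart, and the noisy agent is on top and sees at
most one opinion. -/
structure TopSeparated {n : ℕ} (ε : ℝ) (s : Fin n) (x : Fin n → ℝ) : Prop where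
  sep : ∀ i j, i ≠ s → j ≠ s → x i = x j ∨ ε < |x i - x j|
  one : ∀ i j, i ≠ s → j ≠ s → |x i - x s| ≤ ε → |x j - x s| ≤ ε → x i = x j
  top : ∀ i, i ≠ s → x i ≤ x s + ε

/-! ### Motion of two noise-free clusters under one noisy agent. -/

section TwoClusters

variable {n : ℕ} {ε a : ℝ} {s : Fin n} {P Q : Finset (Fin n)} {p q : ℝ} {x : Fin n → ℝ}

lemma TwoClusters.card_le (h : TwoClusters ε s P Q p q x) :
    (1 : ℝ) ≤ P.card ∧ (1 : ℝ) ≤ Q.card ∧ (P.card : ℝ) + Q.card + 1 ≤ n := by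
  refine ⟨by exact_mod_cast h.nonempty_left.card_pos, by exact_mod_cast h.nonempty_right.card_pos,
    ?_⟩
  have h1 : (insert s (P ∪ Q)).card ≤ n := by
    simpa using Finset.card_le_univ (insert s (P ∪ Q))
  rw [Finset.card_insert_of_notMem (by simp [h.notMem_left, h.notMem_right]),
    Finset.card_union_of_disjoint h.disjoint] at h1
  exact_mod_cast h1

-- For an agent not below `q`, only `P`, `Q` and `s` can be in reach, so its mean is a weighted
-- average of three values. Multiplying out avoids division while the cases of visibility are being
-- resolved.
open Classical in
lemma TwoClusters.localMean_mul (h : TwoClusters ε s P Q p q x) (hε : 0 ≤ ε) {i : Fin n} {z : ℝ}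
    (hi : x i = z) (hz : q ≤ z) :
    localMean ε x i * ((if |p - z| ≤ ε then (P.card : ℝ) else 0) +
      (if |q - z| ≤ ε then (Q.card : ℝ) else 0) + (if |x s - z| ≤ ε then 1 else 0)) =
    (if |p - z| ≤ ε then P.card * p else 0) + (if |q - z| ≤ ε then Q.card * q else 0) +
      (if |x s - z| ≤ ε then x s else 0) := by
  have hsum : ∀ f : Fin n → ℝ, ∑ l ∈ neighbors ε x i, f l =
      (if |p - z| ≤ ε then ∑ l ∈ P, f l else 0) + (if |q - z| ≤ ε then ∑ l ∈ Q, f l else 0) +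
      (if |x s - z| ≤ ε then f s else 0) := by
    intro f
    rw [neighbors, Finset.sum_filter, hi]
    have hsub : ∑ l ∈ insert s (P ∪ Q), (if |x l - z| ≤ ε then f l else 0) =
        ∑ l, (if |x l - z| ≤ ε then f l else 0) := by
      refine Finset.sum_subset (Finset.subset_univ _) fun l _ hl => if_neg ?_
      simp only [Finset.mem_insert, Finset.mem_union, not_or] at hl
      have := h.lt_of_notMem l hl.1 hl.2.1 hl.2.2
      intro hl'
      linarith [(abs_le.1 hl').1]
    rw [← hsub, Finset.sum_insert (by simp [h.notMem_left, h.notMem_right]),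
      Finset.sum_union h.disjoint]
    have hP : ∑ l ∈ P, (if |x l - z| ≤ ε then f l else 0) =
        if |p - z| ≤ ε then ∑ l ∈ P, f l else 0 := by
      rw [Finset.sum_congr rfl fun l hl => by rw [h.eq_left l hl]]
      split_ifs <;> simp
    have hQ : ∑ l ∈ Q, (if |x l - z| ≤ ε then f l else 0) =
        if |q - z| ≤ ε then ∑ l ∈ Q, f l else 0 := by
      rw [Finset.sum_congr rfl fun l hl => by rw [h.eq_right l hl]]
      split_ifs <;> simp
    rw [hP, hQ]
    ring
  have hcard := hsum fun _ => 1
  have hx := hsum x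
  simp only [Finset.sum_const, nsmul_eq_mul, mul_one] at hcard
  rw [Finset.sum_congr rfl h.eq_left, Finset.sum_congr rfl h.eq_right] at hx
  simp only [Finset.sum_const, nsmul_eq_mul] at hx
  rw [← hcard, ← hx, localMean_eq_div, div_mul_cancel₀ _ (card_neighbors_pos hε x i).ne']

/-- The remaining agents lie more than ε below both clusters and the noisy agent, so they average
only among themselves and stay out of reach. -/
lemma TwoClusters.step (h : TwoClusters ε s P Q p q x) (hε : 0 ≤ ε) (hx : InCube x)
    (hqp : q ≤ p) (hqs : q ≤ x s) (u : Fin n → ℝ) {p' q' : ℝ}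
    (hp' : ∀ i ∈ P, localMean ε x i = p') (hq' : ∀ i ∈ Q, localMean ε x i = q') (hqq' : q ≤ q') :
    TwoClusters ε s P Q p' q' (hkStep ε {s} x u) := by
  have hne : ∀ i, i ≠ s → i ∉ ({s} : Finset (Fin n)) := fun i hi => by simpa using hi
  refine ⟨h.1, h.2, h.3, h.4, h.5, fun i hi => ?_, fun i hi => ?_, fun i his hiP hiQ => ?_⟩
  · rw [hkStep_of_notMem hε hx u (hne i fun e => h.notMem_left (e ▸ hi))]
    exact hp' i hi
  · rw [hkStep_of_notMem hε hx u (hne i fun e => h.notMem_right (e ▸ hi))]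
    exact hq' i hi
  · rw [hkStep_of_notMem hε hx u (hne i his)]
    refine (localMean_lt (B := q - ε) hε fun j hj => ?_).trans_le (by linarith)
    have hi := h.lt_of_notMem i his hiP hiQ
    have hj' := (abs_le.1 hj).2
    refine h.lt_of_notMem j ?_ ?_ ?_
    · rintro rfl; linarith
    · intro hjP; linarith [h.eq_left j hjP]
    · intro hjQ; linarith [h.eq_right j hjQ]

lemma le_clip {y : ℝ} (h : y ≤ 1) : y ≤ clip y := by
  simpa [min_eq_right h] using min_le_clip y

lemma hkStep_singleton_down {u : Fin n → ℝ} (hx : InCube x) (hε : 0 ≤ ε) (ha : 0 ≤ a)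
    (hu : u ∈ signControl {s} (Set.Icc a ε) (Set.Icc (-ε) (-a)) ∅) :
    localMean ε x s - ε ≤ hkStep ε {s} x u s ∧
      hkStep ε {s} x u s ≤ max 0 (localMean ε x s - a) := by
  obtain ⟨h1, h2⟩ := (hu s (by simp)).2 (by simp)
  have h3 := hx.localMean_le_one hε s
  rw [hkStep_of_mem u (by simp)]
  refine ⟨le_trans (by linarith) (le_clip (by linarith)), (clip_le_max _).trans ?_⟩
  exact max_le_max le_rfl (by linarith)

lemma hkStep_singleton_up {u : Fin n → ℝ} (hx : InCube x) (hε : 0 ≤ ε)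
    (hu : u ∈ signControl {s} (Set.Icc a ε) (Set.Icc (-ε) (-a)) Set.univ) :
    min 1 (localMean ε x s + a) ≤ hkStep ε {s} x u s ∧
      hkStep ε {s} x u s ≤ localMean ε x s + ε := by
  obtain ⟨h1, h2⟩ := (hu s (by simp)).1 (by simp)
  have h3 := hx.localMean_nonneg hε s
  rw [hkStep_of_mem u (by simp)]
  refine ⟨(min_le_min le_rfl (by linarith)).trans (min_le_clip _), (clip_le_max _).trans ?_⟩
  exact max_le (by linarith) (by linarith)

/-- The noisy agent sees the upper but not the lower cluster. -/
lemma TwoClusters.down (h : TwoClusters ε s P Q p q x) (ha : 0 < a) (haε : a ≤ ε) (hx : InCube x)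
    (h1 : ε < p - q) (h2 : p - q ≤ 2 * ε) (hps : x s ≤ p + ε) (hs : q + ε < x s)
    {u : Fin n → ℝ} (hu : u ∈ signControl {s} (Set.Icc a ε) (Set.Icc (-ε) (-a)) ∅) :
    ∃ p', TwoClusters ε s P Q p' q (hkStep ε {s} x u) ∧ p' * (P.card + 1) = P.card * p + x s ∧
      p' - ε ≤ hkStep ε {s} x u s ∧ hkStep ε {s} x u s ≤ p' - a := by
  have hε : 0 < ε := by linarith
  obtain ⟨k1, k2, k3⟩ := h.card_le
  have a1 : |p - x s| ≤ ε := abs_le.2 ⟨by linarith, by linarith⟩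
  have a2 : ¬ |q - x s| ≤ ε := fun hh => by linarith [(abs_le.1 hh).1]
  have a3 : ¬ |q - p| ≤ ε := fun hh => by linarith [(abs_le.1 hh).1]
  have eS := h.localMean_mul hε.le (i := s) rfl (by linarith)
  have eP : ∀ i ∈ P, _ := fun i hi => h.localMean_mul hε.le (h.eq_left i hi) (by linarith)
  have eQ : ∀ i ∈ Q, _ := fun i hi => h.localMean_mul hε.le (h.eq_right i hi) le_rfl
  simp only [a1, a2, sub_self, abs_zero, hε.le, if_true, if_false, add_zero] at eS
  simp only [a3, abs_sub_comm (x s) p, a1, sub_self, abs_zero, hε.le, if_true, if_false,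
    add_zero] at eP
  simp only [abs_sub_comm p q, a3, abs_sub_comm (x s) q, a2, sub_self, abs_zero, hε.le, if_true,
    if_false, add_zero, zero_add] at eQ
  have hk : (P.card : ℝ) + 1 ≠ 0 := by linarith
  have hk' : (Q.card : ℝ) ≠ 0 := by linarith
  obtain ⟨d1, d2⟩ := hkStep_singleton_down hx hε.le ha.le hu
  have hq0 : 0 ≤ q := by
    obtain ⟨j, hj⟩ := h.nonempty_right
    rw [← h.eq_right j hj]; exact (hx j).1
  have hlow : q + ε < localMean ε x s := by nlinarith
  refine ⟨localMean ε x s, h.step hε.le hx (by linarith) (by linarith) u ?_ ?_ le_rfl, eS, d1,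
    ?_⟩
  · exact fun i hi => mul_right_cancel₀ hk ((eP i hi).trans eS.symm)
  · intro i hi
    exact mul_right_cancel₀ hk' ((eQ i hi).trans (mul_comm _ _))
  · rwa [max_eq_right (by linarith)] at d2

/-- The noisy agent sees the lower but not the upper cluster. -/
lemma TwoClusters.up (h : TwoClusters ε s P Q p q x) (ha : 0 < a) (haε : a ≤ ε) (hx : InCube x)
    (h1 : ε < p - q) (h2 : p - q ≤ 2 * ε) (hqs : q ≤ x s) (hs : x s < p - ε)
    {u : Fin n → ℝ} (hu : u ∈ signControl {s} (Set.Icc a ε) (Set.Icc (-ε) (-a)) Set.univ) :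
    ∃ q', TwoClusters ε s P Q p q' (hkStep ε {s} x u) ∧ q' * (Q.card + 1) = Q.card * q + x s ∧
      q' + a ≤ hkStep ε {s} x u s ∧ hkStep ε {s} x u s ≤ q' + ε := by
  have hε : 0 < ε := by linarith
  obtain ⟨k1, k2, k3⟩ := h.card_le
  have a1 : |q - x s| ≤ ε := abs_le.2 ⟨by linarith, by linarith⟩
  have a2 : ¬ |p - x s| ≤ ε := fun hh => by linarith [(abs_le.1 hh).2]
  have a3 : ¬ |q - p| ≤ ε := fun hh => by linarith [(abs_le.1 hh).1]
  have eS := h.localMean_mul hε.le (i := s) rfl (by linarith)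
  have eP : ∀ i ∈ P, _ := fun i hi => h.localMean_mul hε.le (h.eq_left i hi) (by linarith)
  have eQ : ∀ i ∈ Q, _ := fun i hi => h.localMean_mul hε.le (h.eq_right i hi) le_rfl
  simp only [a1, a2, sub_self, abs_zero, hε.le, if_true, if_false, zero_add] at eS
  simp only [a3, abs_sub_comm (x s) p, a2, sub_self, abs_zero, hε.le, if_true, if_false,
    add_zero] at eP
  simp only [abs_sub_comm p q, a3, abs_sub_comm (x s) q, a1, sub_self, abs_zero, hε.le, if_true,
    if_false, zero_add] at eQ
  have hk : (P.card : ℝ) ≠ 0 := by linarith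
  have hk' : (Q.card : ℝ) + 1 ≠ 0 := by linarith
  obtain ⟨d1, d2⟩ := hkStep_singleton_up hx hε.le hu
  have hp1 : p ≤ 1 := by
    obtain ⟨j, hj⟩ := h.nonempty_left
    rw [← h.eq_left j hj]; exact (hx j).2
  have hupp : localMean ε x s < p - ε := by nlinarith
  have hlow : q ≤ localMean ε x s := by nlinarith
  refine ⟨localMean ε x s, h.step hε.le hx (by linarith) hqs u ?_ ?_ hlow, eS, ?_, d2⟩
  · intro i hi
    exact mul_right_cancel₀ hk ((eP i hi).trans (mul_comm _ _))
  · exact fun i hi => mul_right_cancel₀ hk' ((eQ i hi).trans eS.symm)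
  · rwa [min_eq_right (by linarith)] at d1

/-- If the noisy agent sees both clusters, the distance of the clusters shrinks, even if the noisy
agent jumps above the upper cluster. -/
lemma overshoot_le {k k' A B : ℝ} {n : ℕ} (hk : 1 ≤ k) (hk' : 1 ≤ k')
    (hn : k + k' + 1 ≤ n) (hA : 0 ≤ A) (hB : 0 ≤ B) (hAB : ε ≤ A + B) :
    (ε - A * k / (k + 1) + (k * A - k' * B) / (k + k' + 1)) / (k + 1) - A / (k + 1) -
      B / (k' + 1) ≤ - ((A + B) / n ^ 3) := by
  have hK : (0 : ℝ) < k + k' + 1 := by linarith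
  have hk1 : (0 : ℝ) < k + 1 := by linarith
  have hk1' : (0 : ℝ) < k' + 1 := by linarith
  have hn0 : (0 : ℝ) < n := by linarith
  calc (ε - A * k / (k + 1) + (k * A - k' * B) / (k + k' + 1)) / (k + 1) - A / (k + 1) -
        B / (k' + 1)
      ≤ (A + B - A * k / (k + 1) + (k * A - k' * B) / (k + k' + 1)) / (k + 1) - A / (k + 1) -
        B / (k' + 1) := by gcongr
    _ = - (A * (k * k' / ((k + k' + 1) * (k + 1) ^ 2)) + B * (k / ((k + k' + 1) * (k' + 1)))) := by
        field_simp
        ring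
    _ ≤ - (A * (1 / n ^ 3) + B * (1 / n ^ 3)) := by
        have e1 : 1 / (n : ℝ) ^ 3 ≤ k * k' / ((k + k' + 1) * (k + 1) ^ 2) := by
          refine div_le_div₀ (by positivity) (by nlinarith) (by positivity) ?_
          rw [pow_succ' (n : ℝ) 2]
          gcongr
          linarith
        have e2 : 1 / (n : ℝ) ^ 3 ≤ k / ((k + k' + 1) * (k' + 1)) := by
          refine div_le_div₀ (by positivity) (by linarith) (by positivity) ?_
          calc (k + k' + 1) * (k' + 1) ≤ n * n := by gcongr; linarith
            _ ≤ n ^ 3 := by nlinarith [mul_pos hn0 hn0]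
        gcongr
    _ = - ((A + B) / n ^ 3) := by ring

set_option maxHeartbeats 800000 in
/-- The noisy agent sees both clusters. -/
lemma TwoClusters.forces_of_sees_both (h : TwoClusters ε s P Q p q x) (ha : 0 < a) (haε : a ≤ ε)
    (hx : InCube x) (h1 : ε < p - q) (h2 : p - q ≤ 2 * ε) (hqs : q ≤ x s) (hsp : x s ≤ p)
    (hs1 : p - ε ≤ x s) (hs2 : x s ≤ q + ε) {δ : ℝ} (hδ : δ ≤ ε / n ^ 3) :
    Forces ε {s} (Set.Icc a ε) (Set.Icc (-ε) (-a)) (fun y => AboutToMerge ε s y ∨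
      ClustersInReach ε s y ∨ ClustersApart ε s (p - q - δ) y) 2 x := by
  have hε : 0 < ε := by linarith
  obtain ⟨k1, k2, k3⟩ := h.card_le
  have a1 : |q - x s| ≤ ε := abs_le.2 ⟨by linarith, by linarith⟩
  have a2 : |p - x s| ≤ ε := abs_le.2 ⟨by linarith, by linarith⟩
  have a3 : ¬ |q - p| ≤ ε := fun hh => by linarith [(abs_le.1 hh).1]
  have eS := h.localMean_mul hε.le (i := s) rfl (by linarith)
  have eP : ∀ i ∈ P, _ := fun i hi => h.localMean_mul hε.le (h.eq_left i hi) (by linarith)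
  have eQ : ∀ i ∈ Q, _ := fun i hi => h.localMean_mul hε.le (h.eq_right i hi) le_rfl
  simp only [a1, a2, sub_self, abs_zero, hε.le, if_true] at eS
  simp only [a3, abs_sub_comm (x s) p, a2, sub_self, abs_zero, hε.le, if_true, if_false,
    add_zero] at eP
  simp only [abs_sub_comm p q, a3, abs_sub_comm (x s) q, a1, sub_self, abs_zero, hε.le, if_true,
    if_false, zero_add] at eQ
  set k : ℝ := (P.card : ℝ)
  set k' : ℝ := (Q.card : ℝ)
  have hk : (0 : ℝ) < k + 1 := by linarith
  have hk' : (0 : ℝ) < k' + 1 := by linarith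
  have hK : (0 : ℝ) < k + k' + 1 := by linarith
  have hn0 : (0 : ℝ) < n := by linarith
  set A := p - x s with hA
  set B := x s - q with hB
  set p' : ℝ := p - A / (k + 1) with hp'
  set q' : ℝ := q + B / (k' + 1) with hq'
  have hP : ∀ i ∈ P, localMean ε x i = p' := fun i hi => by
    have := eP i hi
    refine mul_right_cancel₀ hk.ne' (this.trans ?_)
    rw [hp', sub_mul, div_mul_cancel₀ _ hk.ne', hA]
    ring
  have hQ : ∀ i ∈ Q, localMean ε x i = q' := fun i hi => by
    have := eQ i hi
    refine mul_right_cancel₀ hk'.ne' (this.trans ?_)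
    rw [hq', add_mul, div_mul_cancel₀ _ hk'.ne', hB]
    ring
  have hσ : localMean ε x s = x s + (k * A - k' * B) / (k + k' + 1) := by
    refine mul_right_cancel₀ hK.ne' (eS.trans ?_)
    rw [add_mul, div_mul_cancel₀ _ hK.ne', hA, hB]
    ring
  have hA0 : 0 ≤ A := by linarith
  have hB0 : 0 ≤ B := by linarith
  have hp's : x s ≤ p' := by
    have : A / (k + 1) ≤ A := div_le_self hA0 (by linarith)
    linarith
  have hq's : q' ≤ x s := by
    have : B / (k' + 1) ≤ B := div_le_self hB0 (by linarith)
    linarith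
  have hqq' : q ≤ q' := by
    have : 0 ≤ B / (k' + 1) := div_nonneg hB0 hk'.le
    linarith
  have hp'p : p' ≤ p := by
    have : 0 ≤ A / (k + 1) := div_nonneg hA0 hk.le
    linarith
  have hbound := overshoot_le (ε := ε) (n := n) (k := k) (k' := k') k1 k2 k3 hA0 hB0
    (by linarith)
  have hδ' : δ ≤ (A + B) / n ^ 3 := hδ.trans (by gcongr; linarith)
  have hn1 : (1 : ℝ) ≤ n := by linarith
  have hfirst : δ ≤ A / (k + 1) + B / (k' + 1) := by
    refine hδ'.trans ?_
    rw [add_div]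
    have hn3 : (n : ℝ) ≤ n ^ 3 := by
      have := pow_le_pow_right₀ hn1 (show 1 ≤ 3 by norm_num)
      simpa using this
    exact add_le_add (div_le_div_of_nonneg_left hA0 hk (by linarith))
      (div_le_div_of_nonneg_left hB0 hk' (by linarith))
  obtain ⟨i, hi⟩ := h.nonempty_left
  obtain ⟨j, hj⟩ := h.nonempty_right
  have his : i ≠ s := fun e => h.notMem_left (e ▸ hi)
  have hjs : j ≠ s := fun e => h.notMem_right (e ▸ hj)
  -- The clusters may meet exactly; this counts as success, since their opinions still differ in
  -- `x`.
  rcases eq_or_ne p' q' with heq | hne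
  · refine Forces.of_target (Or.inl ⟨i, j, his, hjs, ?_, ?_⟩) _
    · rw [h.eq_left i hi, h.eq_right j hj]
      intro e
      linarith
    · rw [hP i hi, hQ j hj, heq]
  have hqp' : q' < p' := lt_of_le_of_ne (hq's.trans hp's) hne.symm
  -- Pushing up keeps the noisy agent above the lower cluster, so that it cannot interfere with the
  -- agents further below.
  refine Or.inr ⟨Set.univ, fun u hu => ?_⟩
  obtain ⟨d1, d2⟩ := hkStep_singleton_up hx hε.le hu
  have hy := h.step hε.le hx (by linarith) hqs u hP hQ hqq'
  have hycube := inCube_hkStep ε {s} x u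
  set y := hkStep ε {s} x u with hydef
  have hq'σ : q' ≤ localMean ε x s := by
    have e : (localMean ε x s - q') * (k + k' + 1) = k * (p - q') := by
      linear_combination eS - eQ j hj + (k' + 1) * hQ j hj
    have h0 : 0 ≤ (localMean ε x s - q') * (k + k' + 1) := by
      rw [e]; exact mul_nonneg (by linarith) (by linarith)
    have := nonneg_of_mul_nonneg_left h0 hK
    linarith
  have hσp' : localMean ε x s ≤ p' := by
    have e : (p' - localMean ε x s) * (k + k' + 1) = k' * (p' - q) := by
      linear_combination eP i hi - eS - (k + 1) * hP i hi
    have h0 : 0 ≤ (p' - localMean ε x s) * (k + k' + 1) := by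
      rw [e]; exact mul_nonneg (by linarith) (by linarith)
    have := nonneg_of_mul_nonneg_left h0 hK
    linarith
  have hq'1 : q' ≤ 1 := hq's.trans (hx s).2
  have hys : q' ≤ y s := (le_min hq'1 (by linarith)).trans d1
  rcases le_or_gt (p' - q') ε with hD | hD
  · exact Forces.of_target (Or.inr (Or.inl ⟨P, Q, p', q', hy, hqp', hD, by linarith⟩)) _
  rcases le_or_gt (y s) p' with hyp | hyp
  · refine Forces.of_target (Or.inr (Or.inr ⟨P, Q, p', q', hy, hD, by linarith, hys, hyp, ?_⟩)) _
    linarith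
  -- The noisy agent has jumped above `p'`. A downward push brings it back between the clusters, at
  -- the price of dragging `P` up. By `overshoot_le` the distance has still decreased over the two
  -- steps.
  refine Forces.step ∅ fun v hv => Or.inr (Or.inr ?_)
  obtain ⟨p'', hz, hp'', d3, d4⟩ := hy.down ha haε hycube hD (by linarith) (by linarith)
    (by linarith) hv
  have hp''eq : p'' = p' + (y s - p') / (k + 1) := by
    refine mul_right_cancel₀ hk.ne' (hp''.trans ?_)
    rw [add_mul, div_mul_cancel₀ _ hk.ne']
    ring
  have hge : p' ≤ p'' := by
    have : 0 ≤ (y s - p') / (k + 1) := div_nonneg (by linarith) hk.le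
    linarith
  have hle : p'' - q' ≤ p - q - (A + B) / n ^ 3 := by
    have : (y s - p') / (k + 1) ≤
        (ε - A * k / (k + 1) + (k * A - k' * B) / (k + k' + 1)) / (k + 1) := by
      gcongr
      have : A / (k + 1) - A = - (A * k / (k + 1)) := by field_simp; ring
      linarith
    linarith
  refine ⟨P, Q, p'', q', hz, by linarith, ?_, by linarith, by linarith, by linarith⟩
  linarith [div_nonneg (by linarith : 0 ≤ A + B) (by positivity : (0 : ℝ) ≤ n ^ 3)]

end TwoClusters

/-! ### Merging all noise-free agents with one noisy agent. -/

section SingleNoisyAgent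

variable {n : ℕ} {ε a : ℝ} {s : Fin n} {P Q : Finset (Fin n)} {p q : ℝ} {x : Fin n → ℝ}

/-- One round of the approach of two clusters. -/
lemma ClustersApart.forces_closer {D : ℝ} (h : ClustersApart ε s D x) (ha : 0 < a)
    (haε : a ≤ ε) (hx : InCube x) {δ : ℝ} (hδ : δ ≤ ε / n ^ 3) (hδa : δ ≤ a / n) :
    Forces ε {s} (Set.Icc a ε) (Set.Icc (-ε) (-a)) (fun y => AboutToMerge ε s y ∨
      ClustersInReach ε s y ∨ ClustersApart ε s (D - δ) y) 3 x := by
  have hε : 0 < ε := by linarith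
  obtain ⟨P, Q, p, q, hc, h1, h2, hqs, hsp, hD⟩ := h
  have hweak : ∀ D' ≤ D, ∀ y, InCube y → (AboutToMerge ε s y ∨ ClustersInReach ε s y ∨
      ClustersApart ε s (D' - δ) y) → (AboutToMerge ε s y ∨ ClustersInReach ε s y ∨
      ClustersApart ε s (D - δ) y) := by
    rintro D' hD' y - (h | h | ⟨P, Q, p, q, g1, g2, g3, g4, g5, g6⟩)
    · exact Or.inl h
    · exact Or.inr (Or.inl h)
    · exact Or.inr (Or.inr ⟨P, Q, p, q, g1, g2, g3, g4, g5, by linarith⟩)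
  obtain ⟨k1, k2, k3⟩ := hc.card_le
  have hn0 : (0 : ℝ) < n := by linarith
  have ha' : a / n ≤ a / (P.card + 1) ∧ a / n ≤ a / (Q.card + 1) :=
    ⟨div_le_div_of_nonneg_left ha.le (by linarith) (by linarith),
      div_le_div_of_nonneg_left ha.le (by linarith) (by linarith)⟩
  -- If the noisy agent sees one cluster only, it is pushed toward the other and drags the seen
  -- cluster along. When it sees both, `forces_of_sees_both` takes over.
  rcases lt_or_ge (q + ε) (x s) with hs | hs
  · refine Or.inr ⟨∅, fun u hu => ?_⟩
    obtain ⟨p', hy, hp', d1, d2⟩ := hc.down ha haε hx h1 h2 (by linarith) hs hu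
    have hycube := inCube_hkStep ε {s} x u
    set y := hkStep ε {s} x u
    have hp's : x s ≤ p' := by nlinarith
    have hp'p : p' ≤ p := by nlinarith
    rcases lt_or_ge (q + ε) (y s) with hys | hys
    · refine Forces.mono (L := 1) one_le_two (Forces.step ∅ fun v hv => ?_) hycube
      obtain ⟨p'', hz, hp'', e1, e2⟩ := hy.down ha haε hycube (by linarith) (by linarith)
        (by linarith) hys hv
      have hge : y s ≤ p'' := by nlinarith
      have hle : p'' ≤ p' - a / (P.card + 1) := by
        have : p'' = p' - (p' - y s) / (P.card + 1) := by
          have hk : (P.card : ℝ) + 1 ≠ 0 := by linarith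
          refine mul_right_cancel₀ hk (hp''.trans ?_)
          rw [sub_mul, div_mul_cancel₀ _ hk]
          ring
        rw [this]
        gcongr
        linarith
      exact Or.inr (Or.inr ⟨P, Q, p'', q, hz, by linarith, by linarith [div_pos ha hn0],
        by linarith, by linarith, by linarith⟩)
    · exact (hy.forces_of_sees_both ha haε hycube (by linarith) (by linarith) (by linarith)
        (by linarith) (by linarith) hys hδ).mono_target hycube (hweak _ (by linarith))
  rcases lt_or_ge (x s) (p - ε) with hs' | hs'
  · refine Or.inr ⟨Set.univ, fun u hu => ?_⟩
    obtain ⟨q', hy, hq', d1, d2⟩ := hc.up ha haε hx h1 h2 hqs hs' hu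
    have hycube := inCube_hkStep ε {s} x u
    set y := hkStep ε {s} x u
    have hq's : q' ≤ x s := by nlinarith
    have hq'q : q ≤ q' := by nlinarith
    rcases lt_or_ge (y s) (p - ε) with hys | hys
    · refine Forces.mono (L := 1) one_le_two (Forces.step Set.univ fun v hv => ?_) hycube
      obtain ⟨q'', hz, hq'', e1, e2⟩ := hy.up ha haε hycube (by linarith) (by linarith)
        (by linarith) hys hv
      have hge : q'' ≤ y s := by nlinarith
      have hle : q' + a / (Q.card + 1) ≤ q'' := by
        have : q'' = q' + (y s - q') / (Q.card + 1) := by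
          have hk : (Q.card : ℝ) + 1 ≠ 0 := by linarith
          refine mul_right_cancel₀ hk (hq''.trans ?_)
          rw [add_mul, div_mul_cancel₀ _ hk]
          ring
        rw [this]
        gcongr
        linarith
      exact Or.inr (Or.inr ⟨P, Q, p, q'', hz, by linarith, by linarith [div_pos ha hn0],
        by linarith, by linarith, by linarith⟩)
    · exact (hy.forces_of_sees_both ha haε hycube (by linarith) (by linarith) (by linarith)
        (by linarith) (by linarith) (by linarith) hδ).mono_target hycube (hweak _ (by linarith))
  · exact ((hc.forces_of_sees_both ha haε hx h1 h2 hqs hsp hs' hs hδ).mono_target hx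
      (hweak _ hD)).mono (by omega) hx

lemma leads_of_clustersApart (ha : 0 < a) (haε : a ≤ ε) :
    Leads ε {s} (Set.Icc a ε) (Set.Icc (-ε) (-a)) (ClustersApart ε s (2 * ε))
      (fun y => AboutToMerge ε s y ∨ ClustersInReach ε s y) := by
  have hε : 0 < ε := by linarith
  have hn0 : (0 : ℝ) < n := Nat.cast_pos.2 ((Nat.zero_le _).trans_lt s.2)
  set δ := min (ε / n ^ 3) (a / n) with hδ
  have hδ0 : 0 < δ := lt_min (by positivity) (by positivity)
  have key : ∀ N : ℕ, ∀ x, InCube x → ClustersApart ε s (ε + N * δ) x →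
      Forces ε {s} (Set.Icc a ε) (Set.Icc (-ε) (-a))
        (fun y => AboutToMerge ε s y ∨ ClustersInReach ε s y) (N * 3) x := by
    intro N
    induction N with
    | zero =>
      rintro x - ⟨P, Q, p, q, -, h1, -, -, -, h2⟩
      simp at h2
      linarith
    | succ N ih =>
      intro x hx h
      rw [Nat.succ_mul, add_comm]
      refine (h.forces_closer ha haε hx (min_le_left _ _) (min_le_right _ _)).trans hx
        fun y hy hy' => ?_
      rcases hy' with h | h | h
      · exact Forces.of_target (Or.inl h) _
      · exact Forces.of_target (Or.inr h) _
      · refine ih y hy ?_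
        have : ε + ((N + 1 : ℕ) : ℝ) * δ - δ = ε + N * δ := by push_cast; ring
        rwa [← this]
  obtain ⟨N, hN⟩ := exists_nat_gt (ε / δ)
  rw [div_lt_iff₀ hδ0] at hN
  refine ⟨N * 3, fun x hx ⟨P, Q, p, q, g1, g2, g3, g4, g5, g6⟩ => key N x hx
    ⟨P, Q, p, q, g1, g2, g3, g4, g5, by linarith⟩⟩

/-- The clusters see each other, and the noisy agent is seen by both or by neither. All members then
have the same neighbours, hence the same mean. -/
lemma TwoClusters.aboutToMerge (h : TwoClusters ε s P Q p q x) (hε : 0 ≤ ε) (h1 : q < p)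
    (h2 : p - q ≤ ε) (h3 : p - ε ≤ x s) (h4 : x s ≤ q + ε ∨ p + ε < x s) :
    AboutToMerge ε s x := by
  obtain ⟨i, hi⟩ := h.nonempty_left
  obtain ⟨j, hj⟩ := h.nonempty_right
  refine ⟨i, j, fun e => h.notMem_left (e ▸ hi), fun e => h.notMem_right (e ▸ hj), ?_,
    localMean_congr fun k => ?_⟩
  · rw [h.eq_left i hi, h.eq_right j hj]
    exact h1.ne'
  rw [h.eq_left i hi, h.eq_right j hj]
  by_cases hkP : k ∈ P
  · rw [h.eq_left k hkP]
    simp only [sub_self, abs_zero, hε, true_iff]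
    rw [abs_le]
    constructor <;> linarith
  by_cases hkQ : k ∈ Q
  · rw [h.eq_right k hkQ]
    simp only [sub_self, abs_zero, hε, iff_true]
    rw [abs_le]
    constructor <;> linarith
  by_cases hks : k = s
  · subst hks
    rw [abs_le, abs_le]
    rcases h4 with h4 | h4
    · exact iff_of_true ⟨by linarith, by linarith⟩ ⟨by linarith, by linarith⟩
    · exact iff_of_false (fun h => by linarith [h.2]) (fun h => by linarith [h.2])
  · have := h.lt_of_notMem k hks hkP hkQ
    rw [abs_le, abs_le]
    exact iff_of_false (fun h => by linarith [h.1]) (fun h => by linarith [h.1])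

/-- The only obstacle to merging is that `P` sees the noisy agent and `Q` does not. Downward noise
preserves the configuration and lowers the noisy agent by at least `a` each time, so the obstacle
disappears in bounded time. -/
lemma leads_of_clustersInReach (ha : 0 < a) (haε : a ≤ ε) :
    Leads ε {s} (Set.Icc a ε) (Set.Icc (-ε) (-a)) (ClustersInReach ε s) (AboutToMerge ε s) := by
  have hε : 0 < ε := by linarith
  have key : ∀ N : ℕ, ∀ x, InCube x → ClustersInReach ε s x → x s ≤ N * a →
      Forces ε {s} (Set.Icc a ε) (Set.Icc (-ε) (-a)) (AboutToMerge ε s) N x := by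
    intro N
    induction N with
    | zero =>
      rintro x hx ⟨P, Q, p, q, hc, h1, h2, h3⟩ hN
      obtain ⟨j, hj⟩ := hc.nonempty_right
      have hq := (hx j).1
      rw [hc.eq_right j hj] at hq
      simp only [Nat.cast_zero, zero_mul] at hN
      exact hc.aboutToMerge hε.le h1 h2 h3 (Or.inl (by linarith))
    | succ N ih =>
      rintro x hx ⟨P, Q, p, q, hc, h1, h2, h3⟩ hN
      by_cases h4 : x s ≤ q + ε ∨ p + ε < x s
      · exact Forces.of_target (hc.aboutToMerge hε.le h1 h2 h3 h4) _
      rw [not_or, not_le, not_lt] at h4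
      obtain ⟨h4, h5⟩ := h4
      refine Or.inr ⟨∅, fun u hu => ?_⟩
      obtain ⟨d1, d2⟩ := hkStep_singleton_down hx hε.le ha.le hu
      obtain ⟨k1, k2, -⟩ := hc.card_le
      have a1 : |p - x s| ≤ ε := abs_le.2 ⟨by linarith, by linarith⟩
      have a2 : ¬ |q - x s| ≤ ε := fun hh => by linarith [(abs_le.1 hh).1]
      have a3 : |q - p| ≤ ε := abs_le.2 ⟨by linarith, by linarith⟩
      have eS := hc.localMean_mul hε.le (i := s) rfl (by linarith)
      have eP : ∀ i ∈ P, _ := fun i hi => hc.localMean_mul hε.le (hc.eq_left i hi) (by linarith)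
      have eQ : ∀ i ∈ Q, _ := fun i hi => hc.localMean_mul hε.le (hc.eq_right i hi) le_rfl
      simp only [a1, a2, sub_self, abs_zero, hε.le, if_true, if_false, add_zero] at eS
      simp only [a3, abs_sub_comm (x s) p, a1, sub_self, abs_zero, hε.le, if_true] at eP
      simp only [abs_sub_comm p q, a3, abs_sub_comm (x s) q, a2, sub_self, abs_zero, hε.le,
        if_true, if_false, add_zero] at eQ
      set k : ℝ := (P.card : ℝ)
      set k' : ℝ := (Q.card : ℝ)
      have hk : 0 < k + 1 := by linarith
      have hk' : 0 < k + k' := by linarith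
      have hK : 0 < k + k' + 1 := by linarith
      set p' := (k * p + k' * q + x s) / (k + k' + 1) with hp'
      set q' := (k * p + k' * q) / (k + k') with hq'
      have hq'1 : q ≤ q' := by
        rw [hq', le_div_iff₀ hk']
        nlinarith
      have hq'2 : q' ≤ p := by
        rw [hq', div_le_iff₀ hk']
        nlinarith
      have hq'm : q' * (k + k') = k * p + k' * q := div_mul_cancel₀ _ hk'.ne'
      have hpq' : p' = q' + (x s - q') / (k + k' + 1) := by
        refine mul_right_cancel₀ hK.ne' ?_
        rw [hp', add_mul, div_mul_cancel₀ _ hK.ne', div_mul_cancel₀ _ hK.ne']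
        linarith
      have hpos : 0 < (x s - q') / (k + k' + 1) := div_pos (by linarith) hK
      have hle : (x s - q') / (k + k' + 1) ≤ ε := by
        rw [div_le_iff₀ hK]
        nlinarith
      have hσ : p' ≤ localMean ε x s := by
        have e : (localMean ε x s - p') * (k + k' + 1) = k' * (localMean ε x s - q) := by
          have := div_mul_cancel₀ (k * p + k' * q + x s) hK.ne'
          rw [← hp'] at this
          linear_combination eS - this
        have hqσ : q ≤ localMean ε x s := by nlinarith
        have h0 : 0 ≤ (localMean ε x s - p') * (k + k' + 1) := by
          rw [e]; exact mul_nonneg (by linarith) (by linarith)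
        have := nonneg_of_mul_nonneg_left h0 hK
        linarith
      have hσ' : localMean ε x s ≤ x s := by nlinarith
      refine ih _ (inCube_hkStep ε {s} x u) ⟨P, Q, p', q', hc.step hε.le hx h1.le
        (by linarith) u ?_ ?_ hq'1, by linarith, by linarith, by linarith⟩ ?_
      · intro i hi
        rw [hp', eq_div_iff hK.ne']
        exact eP i hi
      · intro i hi
        rw [hq', eq_div_iff hk'.ne']
        exact eQ i hi
      · refine d2.trans (max_le (by positivity) ?_)
        push_cast at hN
        linarith
  obtain ⟨N, hN⟩ := exists_nat_gt (1 / a)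
  rw [div_lt_iff₀ ha] at hN
  exact ⟨N, fun x hx h => key N x hx h ((hx s).2.trans hN.le)⟩

/-- Upward noise brings the noisy agent to the top of a separated configuration. -/
lemma leads_topSeparated (ha : 0 < a) (haε : a ≤ ε) :
    Leads ε {s} (Set.Icc a ε) (Set.Icc (-ε) (-a)) (fun _ => True) (TopSeparated ε s) := by
  have hn : (1 : ℝ) ≤ n := by exact_mod_cast (Nat.zero_le _).trans_lt s.2
  have hε : 0 < ε := by linarith
  set η : ℝ := a / (4 * n) with hη
  have hη0 : 0 < η := by positivity
  have hηn : η * (4 * n) = a := by rw [hη]; field_simp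
  have hη4 : 4 * η ≤ a := by nlinarith
  refine (leads_settled (ε := ε) (η := η) (a := a) (S := {s}) (Finset.singleton_nonempty s) hη0
    (by linarith) (by nlinarith) (Set.nonempty_Icc.2 haε) (Set.nonempty_Icc.2 (by linarith))
    (fun r hr => hr.1)).trans (Leads.of_imp ?_)
  rintro y hy ⟨⟨hy1, hy2⟩, x, u, hx, ⟨hx1, hx2⟩, rfl⟩
  set y := hkStep ε {s} x u with hydef
  have hmean : ∀ i, i ≠ s → y i = localMean ε x i := fun i hi =>
    hkStep_of_notMem hε.le hx u (by simpa using hi)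
  have hclose : ∀ i j, |x j - x i| ≤ ε → |x j - x i| ≤ η := fun i j h =>
    (hx1 j i).resolve_right (not_lt.2 h)
  have hfar : ∀ i j, i ≠ s → j ≠ s → x i + ε < x j → ε < |y i - y j| := by
    intro i j hi hj h
    refine (hy1 i j).resolve_left fun hle => ?_
    have h3 : y i ≤ x i + η := by
      rw [hmean i hi]
      exact localMean_le hε.le fun k hk => by linarith [(abs_le.1 (hclose i k hk)).2]
    have h4 : x j - η ≤ y j := by
      rw [hmean j hj]
      exact le_localMean hε.le fun k hk => by linarith [(abs_le.1 (hclose j k hk)).1]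
    linarith [(abs_le.1 hle).1]
  have hsep : ∀ i j, i ≠ s → j ≠ s → y i = y j ∨ ε < |y i - y j| := by
    intro i j hi hj
    rcases hx1 i j with h | h
    · left
      rw [hmean i hi, hmean j hj]
      obtain ⟨h1, h2⟩ := abs_le.1 h
      -- In a settled state, agents within reach are η-close, and `2 * η ≤ ε` makes visibility
      -- transitive. Clustermates thus have equal neighbourhoods and agree exactly after one step,
      -- which is why a settled predecessor is needed.
      refine localMean_congr fun k => ⟨fun hk => ?_, fun hk => ?_⟩
      · obtain ⟨h3, h4⟩ := abs_le.1 (hclose i k hk)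
        exact abs_le.2 ⟨by linarith, by linarith⟩
      · obtain ⟨h3, h4⟩ := abs_le.1 (hclose j k hk)
        exact abs_le.2 ⟨by linarith, by linarith⟩
    · right
      rcases lt_abs.1 h with h | h
      · rw [abs_sub_comm]
        exact hfar j i hj hi (by linarith)
      · exact hfar i j hi hj (by linarith)
  refine ⟨hsep, fun i j hi hj hi' hj' => (hsep i j hi hj).resolve_right ?_, fun i hi => ?_⟩
  · obtain ⟨h1, h2⟩ := abs_le.1 ((hy1 i s).resolve_right (not_lt.2 hi'))
    obtain ⟨h3, h4⟩ := abs_le.1 ((hy1 j s).resolve_right (not_lt.2 hj'))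
    rw [not_lt, abs_le]
    constructor <;> linarith
  · linarith [(hy i).2, hy2 s (by simp)]

/-- One downward step from a separated configuration. -/
lemma TopSeparated.step [NeZero n] (h : TopSeparated ε s x) (ha : 0 < a) (haε : a ≤ ε)
    (hx : InCube x) {u : Fin n → ℝ}
    (hu : u ∈ signControl {s} (Set.Icc a ε) (Set.Icc (-ε) (-a)) ∅) :
    opinionDiam x ≤ ε ∨ opinionDiam (hkStep ε {s} x u) ≤ ε ∨
      ClustersApart ε s (2 * ε) (hkStep ε {s} x u) ∨
      (TopSeparated ε s (hkStep ε {s} x u) ∧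
        localMean ε (hkStep ε {s} x u) s ≤ localMean ε x s - a / n) := by
  classical
  have hn : (1 : ℝ) ≤ n := by exact_mod_cast NeZero.one_le
  have hε : 0 < ε := by linarith
  obtain ⟨d1, d2⟩ := hkStep_singleton_down hx hε.le ha.le hu
  have hycube := inCube_hkStep ε {s} x u
  have hmean : ∀ i, i ≠ s → hkStep ε {s} x u i = localMean ε x i := fun i hi =>
    hkStep_of_notMem hε.le hx u (by simpa using hi)
  set y := hkStep ε {s} x u with hydef
  have hself : |x s - x s| ≤ ε := by simpa using hε.le
  have hunseen : ∀ i, i ≠ s → ¬ |x i - x s| ≤ ε → x i < x s - ε ∧ y i = x i := by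
    intro i hi his
    have h1 : x i < x s - ε := by
      by_contra! h1
      exact his (abs_le.2 ⟨by linarith, by linarith [h.top i hi]⟩)
    refine ⟨h1, ?_⟩
    rw [hmean i hi]
    refine localMean_eq_const hε.le fun j hj => ?_
    have hjs : j ≠ s := by
      rintro rfl
      exact his (by rwa [abs_sub_comm])
    exact (h.sep j i hjs hi).resolve_right (not_lt.2 hj)
  by_cases hseen : ∃ i₀, i₀ ≠ s ∧ |x i₀ - x s| ≤ ε
  · obtain ⟨i₀, hi₀, hi₀s⟩ := hseen
    set σ := localMean ε x s with hσ
    have hlow : ∀ j, j ≠ s → ¬ |x j - x s| ≤ ε → x j + ε < x i₀ := by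
      intro j hj hjs
      have h1 := (hunseen j hj hjs).1
      rcases h.sep j i₀ hj hi₀ with h2 | h2
      · rw [h2] at hjs; exact absurd hi₀s hjs
      · rcases lt_abs.1 h2 with h3 | h3
        · linarith [(abs_le.1 hi₀s).1]
        · linarith
    have hclass : ∀ i, i ≠ s → |x i - x s| ≤ ε → y i = σ := by
      intro i hi his
      rw [hmean i hi, hσ]
      have hii₀ := h.one i i₀ hi hi₀ his hi₀s
      refine localMean_congr fun k => ?_
      by_cases hks : k = s
      · subst hks
        simp only [hself, iff_true]
        rwa [abs_sub_comm]
      constructor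
      · intro hk
        by_contra hk'
        linarith [hlow k hks hk', (abs_le.1 hk).1]
      · intro hk
        rw [h.one k i hks hi hk his]
        simpa using hε.le
    -- If everyone is seen, all noise-free agents move to the mean `σ`, and the noisy agent ends
    -- within ε of it.
    by_cases hother : ∃ j, j ≠ s ∧ ¬ |x j - x s| ≤ ε
    swap
    · right; left
      push Not at hother
      refine opinionDiam_le_of_forall (l := min σ (y s)) (r := max σ (y s)) (fun i => ?_) ?_
      · by_cases hi : i = s
        · rw [hi]; exact ⟨min_le_right _ _, le_max_right _ _⟩
        · rw [hclass i hi (hother i hi)]; exact ⟨min_le_left _ _, le_max_left _ _⟩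
      · have hσ0 : 0 ≤ σ := hx.localMean_nonneg hε.le s
        have hle : y s ≤ σ ∨ σ < y s := le_or_gt _ _
        rcases hle with hle | hle
        · rw [min_eq_right hle, max_eq_left hle]; linarith
        · rw [min_eq_left hle.le, max_eq_right hle.le]
          linarith [max_le (by linarith : (0 : ℝ) ≤ σ + ε) (by linarith : σ - a ≤ σ + ε)]
    have hσlow : ∀ j, j ≠ s → ¬ |x j - x s| ≤ ε → x j + ε < σ := by
      intro j hj hjs
      have h1 := (hunseen j hj hjs).1
      have h2 := hlow j hj hjs
      refine lt_of_lt_of_le (lt_min h2 (by linarith : x j + ε < x s)) (le_localMean hε.le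
        fun k hk => ?_)
      by_cases hks : k = s
      · rw [hks]; exact min_le_right _ _
      · rw [h.one k i₀ hks hi₀ hk hi₀s]; exact min_le_left _ _
    obtain ⟨j₀, hj₀, hj₀s⟩ := hother
    have hσε : ε < σ := by linarith [hσlow j₀ hj₀ hj₀s, (hx j₀).1]
    rw [max_eq_right (by linarith)] at d2
    have hyother : ∀ j, j ≠ s → ¬ |x j - x s| ≤ ε → y j = x j ∧ y j + ε < σ ∧ y j < y s := by
      intro j hj hjs
      have h1 := hσlow j hj hjs
      have h2 := (hunseen j hj hjs).2
      exact ⟨h2, by rw [h2]; exact h1, by rw [h2]; linarith⟩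
    have hysep : ∀ i j, i ≠ s → j ≠ s → y i = y j ∨ ε < |y i - y j| := by
      intro i j hi hj
      by_cases hi' : |x i - x s| ≤ ε <;> by_cases hj' : |x j - x s| ≤ ε
      · left; rw [hclass i hi hi', hclass j hj hj']
      · right
        rw [hclass i hi hi']
        exact lt_of_lt_of_le (by linarith [hyother j hj hj']) (le_abs_self _)
      · right
        rw [hclass j hj hj', abs_sub_comm]
        exact lt_of_lt_of_le (by linarith [hyother i hi hi']) (le_abs_self _)
      · rw [(hyother i hi hi').1, (hyother j hj hj').1]
        exact h.sep i j hi hj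
    -- The agents seen before now sit at `σ`. If the noisy agent has come within reach of a lower
    -- cluster, that cluster is at most `2 * ε` below `σ`. Otherwise the configuration persists with
    -- a lower mean.
    by_cases hsee2 : ∃ j, j ≠ s ∧ ¬ |x j - x s| ≤ ε ∧ |y j - y s| ≤ ε
    · right; right; left
      obtain ⟨j, hj, hjs, hjy⟩ := hsee2
      obtain ⟨h1, h2, h3⟩ := hyother j hj hjs
      have h4 := (abs_le.1 hjy).1
      have hij : y i₀ = σ := hclass i₀ hi₀ hi₀s
      refine ⟨Finset.univ.filter fun i => i ≠ s ∧ y i = σ,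
        Finset.univ.filter fun i => i ≠ s ∧ y i = y j, σ, y j,
        ⟨⟨i₀, by simp [hi₀, hij]⟩, ⟨j, by simp [hj]⟩, by simp, by simp, ?_, by simp, by simp, ?_⟩,
        by linarith, by linarith, h3.le, by linarith, by linarith⟩
      · rw [Finset.disjoint_left]
        intro i hi hi'
        simp only [Finset.mem_filter] at hi hi'
        linarith [hi.2.2, hi'.2.2]
      · intro i hi hiP hiQ
        simp only [Finset.mem_filter, Finset.mem_univ, true_and, hi, ne_eq, not_false_iff]
          at hiP hiQ
        have hi' : ¬ |x i - x s| ≤ ε := fun hh => hiP (hclass i hi hh)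
        rcases lt_abs.1 ((hysep i j hi hj).resolve_left hiQ) with h5 | h5
        · linarith [(hyother i hi hi').2.2]
        · linarith
    · right; right; right
      push Not at hsee2
      have hyseen : ∀ i, i ≠ s → |y i - y s| ≤ ε → y i = σ := by
        intro i hi his
        by_cases hi' : |x i - x s| ≤ ε
        · exact hclass i hi hi'
        · exact absurd his (not_le.2 (hsee2 i hi (not_le.1 hi')))
      refine ⟨⟨hysep, fun i j hi hj hi' hj' => by rw [hyseen i hi hi', hyseen j hj hj'],
        fun i hi => ?_⟩, ?_⟩
      · by_cases hi' : |x i - x s| ≤ ε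
        · rw [hclass i hi hi']; linarith
        · linarith [(hyother i hi hi').2.2]
      · refine localMean_le_sub (k := s) hε.le (fun j hj => ?_) (by simpa using hε.le) ha.le d2
        by_cases hjs : j = s
        · rw [hjs]; linarith
        · exact (hyseen j hjs hj).le
  · push Not at hseen
    by_cases hone : ∃ i, i ≠ s
    swap
    · left
      push Not at hone
      refine opinionDiam_le_iff.2 fun i j => ?_
      rw [hone i, hone j]
      exact hself
    obtain ⟨i₁, hi₁⟩ := hone
    have hσ : localMean ε x s = x s := by
      refine localMean_eq_const hε.le fun j hj => ?_
      by_contra hne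
      exact absurd hj (not_le.2 (hseen j fun e => hne (by rw [e])))
    rw [hσ] at d1 d2 ⊢
    have hun := fun i hi => hunseen i hi (not_le.2 (hseen i hi))
    rw [max_eq_right (by linarith [(hun i₁ hi₁).1, (hx i₁).1])] at d2
    have hlt : ∀ i, i ≠ s → y i < y s := fun i hi => by
      rw [(hun i hi).2]
      linarith [(hun i hi).1]
    have hysep : ∀ i j, i ≠ s → j ≠ s → y i = y j ∨ ε < |y i - y j| := by
      intro i j hi hj
      rw [(hun i hi).2, (hun j hj).2]
      exact h.sep i j hi hj
    right; right; right
    refine ⟨⟨hysep, fun i j hi hj hi' hj' => (hysep i j hi hj).resolve_right ?_, fun i hi => ?_⟩,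
      ?_⟩
    · rw [not_lt, abs_le]
      constructor <;> linarith [hlt i hi, hlt j hj, (abs_le.1 hi').1, (abs_le.1 hj').1]
    · linarith [hlt i hi]
    · have : localMean ε y s ≤ y s := localMean_le hε.le fun j _ => by
        by_cases hj : j = s
        · rw [hj]
        · exact (hlt j hj).le
      have := div_le_self ha.le hn
      linarith

/-- The pairs of noise-free agents with different opinions. -/
noncomputable def disagreeingPairs (s : Fin n) (x : Fin n → ℝ) : Finset (Fin n × Fin n) := by
  classical exact {e | e.1 ≠ s ∧ e.2 ≠ s ∧ x e.1 ≠ x e.2}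

lemma mem_disagreeingPairs {e : Fin n × Fin n} :
    e ∈ disagreeingPairs s x ↔ e.1 ≠ s ∧ e.2 ≠ s ∧ x e.1 ≠ x e.2 := by
  simp [disagreeingPairs]

/-- Noise-free agents with equal opinions have equal neighbourhoods and stay equal. Their
disagreements can only disappear, which makes the number of disagreeing pairs the potential for the
final descent. -/
lemma disagreeingPairs_hkStep_subset (hε : 0 ≤ ε) (hx : InCube x) (u : Fin n → ℝ) :
    disagreeingPairs s (hkStep ε {s} x u) ⊆ disagreeingPairs s x := by
  intro e he
  rw [mem_disagreeingPairs] at he ⊢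
  obtain ⟨h1, h2, h3⟩ := he
  refine ⟨h1, h2, fun h => h3 ?_⟩
  rw [hkStep_of_notMem hε hx u (by simpa using h1), hkStep_of_notMem hε hx u (by simpa using h2)]
  exact localMean_eq_of_eq h

/-- With a single noisy agent and noise of size in `[a, ε]`, one can force the diameter below
`ε`. -/
theorem leads_opinionDiam_le_of_singleton [NeZero n] (ha : 0 < a) (haε : a ≤ ε) :
    Leads ε {s} (Set.Icc a ε) (Set.Icc (-ε) (-a)) (fun _ => True)
      (fun x => opinionDiam x ≤ ε) := by
  have hε : 0 < ε := by linarith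
  have hn0 : (0 : ℝ) < n := by exact_mod_cast NeZero.pos n
  have hdescend : Leads ε {s} (Set.Icc a ε) (Set.Icc (-ε) (-a)) (TopSeparated ε s)
      (fun x => opinionDiam x ≤ ε ∨ ClustersApart ε s (2 * ε) x) := by
    refine Leads.of_descent (fun x => localMean ε x s) (A := 0) (B := 1) (div_pos ha hn0) 1
      (fun x hx _ => hx.localMean_nonneg hε.le s) (fun x hx _ => hx.localMean_le_one hε.le s)
      fun x hx h => ?_
    by_cases hd : opinionDiam x ≤ ε
    · exact Forces.of_target (Or.inl (Or.inl hd)) _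
    refine Forces.step ∅ fun u hu => ?_
    rcases h.step ha haε hx hu with h1 | h1 | h1 | h1
    · exact absurd h1 hd
    · exact Or.inl (Or.inl h1)
    · exact Or.inl (Or.inr h1)
    · exact Or.inr h1
  have hmerge : Leads ε {s} (Set.Icc a ε) (Set.Icc (-ε) (-a)) (fun _ => True)
      (fun x => opinionDiam x ≤ ε ∨ AboutToMerge ε s x) := by
    refine (leads_topSeparated ha haε).trans (hdescend.trans (Leads.or ?_ ?_))
    · exact Leads.of_imp fun _ _ h => Or.inl h
    · refine (leads_of_clustersApart ha haε).trans (Leads.or ?_ ?_)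
      · exact Leads.of_imp fun _ _ h => Or.inr h
      · exact (leads_of_clustersInReach ha haε).trans (Leads.of_imp fun _ _ h => Or.inr h)
  obtain ⟨L, hL⟩ := hmerge
  refine Leads.of_descent (fun x => ((disagreeingPairs s x).card : ℝ)) (A := 0)
    (B := (n * n : ℕ)) one_pos (L + 1) (fun x _ _ => Nat.cast_nonneg _) (fun x _ _ => ?_)
    fun x hx _ => ?_
  · have := Finset.card_le_univ (disagreeingPairs s x)
    rw [Fintype.card_prod, Fintype.card_fin] at this
    exact_mod_cast this
  · refine ((hL x hx trivial).and_of_monotone (f := disagreeingPairs s)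
      (fun x u hx => disagreeingPairs_hkStep_subset hε.le hx u) hx).trans hx fun y hy h => ?_
    obtain ⟨h | ⟨i, j, hi, hj, hne, heq⟩, hsub⟩ := h
    · exact Forces.of_target (Or.inl h) _
    refine Forces.step ∅ fun u _ => Or.inr ⟨trivial, ?_⟩
    have hss : disagreeingPairs s (hkStep ε {s} y u) ⊂ disagreeingPairs s y := by
      refine (Finset.ssubset_iff_of_subset (disagreeingPairs_hkStep_subset hε.le hy u)).2
        ⟨(i, j), mem_disagreeingPairs.2 ⟨hi, hj, hne⟩, fun h => ?_⟩
      rw [mem_disagreeingPairs] at h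
      refine h.2.2 ?_
      rw [hkStep_of_notMem hε.le hy u (by simpa using hi),
        hkStep_of_notMem hε.le hy u (by simpa using hj)]
      exact heq
    have h1 := Finset.card_lt_card hss
    have h2 := Finset.card_le_card hsub
    have : (disagreeingPairs s (hkStep ε {s} y u)).card + 1 ≤ (disagreeingPairs s x).card := by
      omega
    have : ((disagreeingPairs s (hkStep ε {s} y u)).card : ℝ) + 1 ≤
      (disagreeingPairs s x).card := by exact_mod_cast this
    linarith

end SingleNoisyAgent

/-! ### Forcing a large diameter -/

section LargeDiameter

variable {n : ℕ} {ε e c : ℝ} {S : Finset (Fin n)} {Ip Im : Set ℝ} {x : Fin n → ℝ}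

lemma Leads.reflect {G : (Fin n → ℝ) → Prop} (hε : 0 ≤ ε)
    (h : Leads ε S {r | -r ∈ Im} {r | -r ∈ Ip} (fun _ => True) (fun y => G fun i => 1 - y i)) :
    Leads ε S Ip Im (fun _ => True) G := by
  obtain ⟨L, hL⟩ := h
  exact ⟨L, fun x hx _ => (hL _ hx.one_sub trivial).reflect hε⟩

lemma Leads.opinionDiam_reflect (hε : 0 ≤ ε) {d : ℝ}
    (h : Leads ε S {r | -r ∈ Im} {r | -r ∈ Ip} (fun _ => True) (fun y => d < opinionDiam y)) :
    Leads ε S Ip Im (fun _ => True) (fun y => d < opinionDiam y) :=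
  Leads.reflect hε (by simpa only [opinionDiam_one_sub] using h)

lemma le_clip_add_of_le {y z r a : ℝ} (hr : a ≤ r) (h : z ≤ y + a) (h1 : z ≤ 1) :
    z ≤ clip (y + r) :=
  le_trans (le_min h1 (by linarith)) (min_le_clip _)

lemma clip_add_le_of_le {y z r a : ℝ} (hr : r ≤ a) (h : y + a ≤ z) (h0 : 0 ≤ z) :
    clip (y + r) ≤ z :=
  (clip_le_max _).trans (max_le h0 (by linarith))

/-- A single noisy agent whose noise may exceed `ε` in both directions can leave the others. -/
theorem leads_lt_opinionDiam_of_singleton [NeZero n] {s : Fin n} (hn : 2 ≤ n) (hε : 0 < ε)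
    (he : 0 < e) (hec : 8 * (n * e) ≤ c) (he1 : 8 * (n * e) ≤ 1 - ε) (heε : n * e ≤ ε)
    (he2 : ε < 1 / 2 → 8 * (n * e) ≤ 1 - 2 * ε)
    (hIp : ∀ r ∈ Ip, ε + c ≤ r) (hIm : ∀ r ∈ Im, r ≤ -(ε + c)) (hIp' : Ip.Nonempty)
    (hIm' : Im.Nonempty) :
    Leads ε {s} Ip Im (fun _ => True) (fun y => ε + e < opinionDiam y) := by
  have hn2 : (2 : ℝ) ≤ n := by exact_mod_cast hn
  have hn0 : (0 : ℝ) < n := by linarith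
  have hne : 2 * e ≤ n * e := by nlinarith
  obtain ⟨i₀, hi₀⟩ : ∃ i : Fin n, i ≠ s := by
    have : Nontrivial (Fin n) := Fin.nontrivial_iff_two_le.2 hn
    exact exists_ne s
  have hclip : ∀ (y u : Fin n → ℝ), hkStep ε {s} y u s = clip (localMean ε y s + u s) :=
    fun y u => hkStep_of_mem u (by simp)
  have hmean : ∀ y : Fin n → ℝ, InCube y → ∀ u i, i ≠ s →
      hkStep ε {s} y u i = localMean ε y i := fun y hy u i hi =>
    hkStep_of_notMem hε.le hy u (by simpa using hi)
  refine (leads_settled (η := e) (a := ε + c) (Finset.singleton_nonempty s) he (by linarith) heε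
    hIp' hIm' hIp).trans ⟨2, ?_⟩
  rintro x hx ⟨⟨h1, h2⟩, -⟩
  have hxs : 1 - e ≤ x s := h2 s (by simp)
  by_cases hviol : ε + e < opinionDiam x
  · exact Forces.of_target hviol _
  have hclose : ∀ i j, |x j - x i| ≤ ε → |x j - x i| ≤ e := fun i j h =>
    (h1 j i).resolve_right (not_lt.2 h)
  refine Or.inr ⟨∅, fun u hu => ?_⟩
  have hus : u s ≤ -(ε + c) := hIm _ ((hu s (by simp)).2 (by simp))
  have hycube := inCube_hkStep ε {s} x u
  have hys : hkStep ε {s} x u s ≤ max 0 (1 - ε - c) := by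
    rw [hclip]
    exact clip_add_le_of_le hus (le_max_of_le_right (by linarith [hx.localMean_le_one hε.le s]))
      (le_max_left _ _)
  have hy := hmean x hx u
  set y := hkStep ε {s} x u with hydef
  -- A noise-free agent near 1 stays there while the noisy agent drops by more than ε.
  by_cases hA : ∃ i, i ≠ s ∧ |x i - x s| ≤ ε
  · obtain ⟨i, hi, his⟩ := hA
    refine Forces.of_target (lt_opinionDiam_of i s ?_) _
    have : 1 - 3 * e ≤ y i := by
      rw [hy i hi]
      refine le_localMean hε.le fun k hk => ?_
      linarith [(abs_le.1 (hclose i k hk)).1, (abs_le.1 (hclose s i his)).1]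
    rcases max_cases 0 (1 - ε - c) with h | h <;> linarith
  push Not at hA
  have hrange : ∀ i, i ≠ s → 1 - ε - 2 * e ≤ x i ∧ x i ≤ 1 - ε := by
    intro i hi
    have h3 : x i < x s - ε := by
      by_contra! h3
      refine absurd (hA i hi) (not_lt.2 (abs_le.2 ⟨by linarith, ?_⟩))
      linarith [(hx i).2]
    refine ⟨?_, by linarith [(hx s).2]⟩
    by_contra! h4
    exact hviol (lt_opinionDiam_of s i (by linarith))
  have hyrange : ∀ i, i ≠ s → 1 - ε - 2 * e ≤ y i ∧ y i ≤ 1 - ε := by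
    intro i hi
    have hne : ∀ k, |x k - x i| ≤ ε → k ≠ s := by
      rintro k hk rfl
      rw [abs_sub_comm] at hk
      exact absurd (hA i hi) (not_lt.2 hk)
    rw [hy i hi]
    exact ⟨le_localMean hε.le fun k hk => (hrange k (hne k hk)).1,
      localMean_le hε.le fun k hk => (hrange k (hne k hk)).2⟩
  have hys1 : y s ≤ 1 - ε - min c (1 - ε) := by
    rcases min_cases c (1 - ε) with h | h <;> rcases max_cases 0 (1 - ε - c) with h' | h' <;>
      linarith
  have hymax : ∀ k, y k ≤ 1 - ε := by
    intro k
    by_cases hk : k = s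
    · rw [hk]; linarith [le_min (by linarith : 0 ≤ c) (by linarith : 0 ≤ 1 - ε)]
    · exact (hyrange k hk).2
  have hθ : 8 * (n * e) ≤ min c (1 - ε) := le_min hec he1
  -- Everyone sees everyone, and the dropped noisy agent pulls the common mean at least `8 * e`
  -- below `1 - ε`. The other agents move to this mean while an upward push takes `s` more than `ε +
  -- e` above it, even if truncated at 1.
  by_cases hB : ∀ i, i ≠ s → y i - y s ≤ ε
  · refine Forces.step Set.univ fun v hv => lt_opinionDiam_of s i₀ ?_
    have hvs : ε + c ≤ v s := hIp _ ((hv s (by simp)).1 (by simp))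
    have hnear : ∀ i j, |y j - y i| ≤ ε := by
      intro i j
      have hlow : ∀ i, y s ≤ y i := fun i => by
        by_cases hi : i = s
        · rw [hi]
        · linarith [(hyrange i hi).1]
      have hup : ∀ i, y i ≤ y s + ε := fun i => by
        by_cases hi : i = s
        · rw [hi]; linarith
        · linarith [hB i hi]
      exact abs_le.2 ⟨by linarith [hlow j, hup i], by linarith [hlow i, hup j]⟩
    have hσ : localMean ε y s ≤ 1 - ε - min c (1 - ε) / n :=
      localMean_le_sub (k := s) hε.le (fun k _ => hymax k) (hnear s s) (by linarith) hys1
    have hdiv : 8 * e ≤ min c (1 - ε) / n := by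
      rw [le_div_iff₀ hn0]; linarith
    have heq : localMean ε y i₀ = localMean ε y s :=
      localMean_congr fun k => iff_of_true (hnear _ _) (hnear _ _)
    have h5 : min 1 (localMean ε y s + (ε + c)) ≤ hkStep ε {s} y v s := by
      rw [hclip]
      exact le_clip_add_of_le hvs (min_le_right _ _) (min_le_left _ _)
    rw [hmean y hycube v i₀ hi₀, heq]
    rcases min_cases 1 (localMean ε y s + (ε + c)) with h | h <;> linarith
  · push Not at hB
    obtain ⟨i, hi, hiB⟩ := hB
    -- A drop of more than ε from at most `1 - ε` down to a nonnegative opinion requires ε < 1/2.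
    -- The agent `i` no longer sees `s`, so a second downward push separates them.
    have hhalf := he2 (by linarith [hymax i, (hycube s).1])
    refine Forces.step ∅ fun v hv => lt_opinionDiam_of i s ?_
    have hvs : v s ≤ -(ε + c) := hIm _ ((hv s (by simp)).2 (by simp))
    have h5 : hkStep ε {s} y v s ≤ max 0 (1 - 2 * ε - c) := by
      rw [hclip]
      refine clip_add_le_of_le hvs (le_max_of_le_right ?_) (le_max_left _ _)
      linarith [localMean_le (ε := ε) (x := y) (i := s) hε.le fun k _ => hymax k]
    have h6 : 1 - ε - 2 * e ≤ hkStep ε {s} y v i := by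
      rw [hmean y hycube v i hi]
      refine le_localMean hε.le fun k hk => (hyrange k ?_).1
      rintro rfl
      linarith [(abs_le.1 hk).1]
    rcases max_cases 0 (1 - 2 * ε - c) with h | h <;> linarith

/-- Two noisy agents separate if downward noise may exceed `ε`. -/
theorem leads_lt_opinionDiam_of_large [NeZero n] (hS : 1 < S.card) (hε : 0 < ε)
    (he : 0 < e) (hec : e < c) (he1 : ε + e < 1) (heε : 8 * (n * e) ≤ ε)
    (hIp : ∀ r ∈ Ip, ε / 2 ≤ r) (hIm : ∀ r ∈ Im, r ≤ -(ε + c)) (hIp' : Ip.Nonempty)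
    (hIm' : Im.Nonempty) :
    Leads ε S Ip Im (fun _ => True) (fun y => ε + e < opinionDiam y) := by
  obtain ⟨s₁, hs₁, s₂, hs₂, hne⟩ := Finset.one_lt_card.1 hS
  have hn1 : (1 : ℝ) ≤ n := by exact_mod_cast NeZero.one_le
  have hne' : e ≤ n * e := by nlinarith
  refine (leads_settled (η := e) (a := ε / 2) (Finset.card_pos.1 (by omega)) he (by linarith)
    (by linarith) hIp' hIm' hIp).trans (Leads.step ?_)
  rintro x hx ⟨⟨h1, h2⟩, -⟩
  -- Upward noise puts `s₁` at 1, and downward noise takes `s₂` at least `ε + c` below 1 or to 0.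
  refine ⟨{s₁}, fun u hu => lt_opinionDiam_of s₁ s₂ ?_⟩
  have h3 : 1 - 2 * e ≤ localMean ε x s₁ := by
    refine le_localMean hε.le fun k hk => ?_
    linarith [(abs_le.1 ((h1 k s₁).resolve_right (not_lt.2 hk))).1, h2 s₁ hs₁]
  have h4 : 1 ≤ hkStep ε S x u s₁ := by
    rw [hkStep_of_mem u hs₁]
    exact le_clip_add_of_le (hIp _ ((hu s₁ hs₁).1 rfl)) (by linarith) le_rfl
  have h5 : hkStep ε S x u s₂ ≤ max 0 (1 - ε - c) := by
    rw [hkStep_of_mem u hs₂]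
    exact clip_add_le_of_le (hIm _ ((hu s₂ hs₂).2 hne.symm))
      (le_max_of_le_right (by linarith [hx.localMean_le_one hε.le s₂])) (le_max_left _ _)
  rcases max_cases 0 (1 - ε - c) with h | h <;> linarith

end LargeDiameter

/-! ### Separating two noisy agents whose noise lies between ε/2 and ε. -/

section TwoNoisyAgents

variable {n : ℕ} {ε e c p q : ℝ} {S : Finset (Fin n)} {Ip Im : Set ℝ} {x u : Fin n → ℝ}

/-- In a state of small diameter, two noisy agents pushed in opposite directions separate. -/
lemma forces_lt_opinionDiam_of_split [NeZero n] (hS : 1 < S.card)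
    (hIp : ∀ r ∈ Ip, p ≤ r) (hIm : ∀ r ∈ Im, r ≤ -q) (hd : opinionDiam x ≤ ε) {δ : ℝ}
    (h1 : ε + e < globalMean x + p) (h2 : globalMean x ≤ q + δ) (hδ : 0 ≤ δ)
    (h3 : δ + ε + e < 1) (hpq : ε + e < p + q) :
    Forces ε S Ip Im (fun y => ε + e < opinionDiam y) 1 x := by
  obtain ⟨s₁, hs₁, s₂, hs₂, hne⟩ := Finset.one_lt_card.1 hS
  refine Forces.step {s₁} fun u hu => lt_opinionDiam_of s₁ s₂ ?_
  have h4 : min 1 (globalMean x + p) ≤ hkStep ε S x u s₁ := by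
    rw [hkStep_of_mem u hs₁, localMean_eq_globalMean_of_opinionDiam_le hd]
    exact le_clip_add_of_le (hIp _ ((hu s₁ hs₁).1 rfl)) (min_le_right _ _) (min_le_left _ _)
  have h5 : hkStep ε S x u s₂ ≤ max 0 (globalMean x - q) := by
    rw [hkStep_of_mem u hs₂, localMean_eq_globalMean_of_opinionDiam_le hd]
    exact clip_add_le_of_le (hIm _ ((hu s₂ hs₂).2 hne.symm))
      (le_max_of_le_right (by linarith)) (le_max_left _ _)
  rcases min_cases 1 (globalMean x + p) with h | h <;>
    rcases max_cases 0 (globalMean x - q) with h' | h' <;> linarith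

lemma InCube.globalMean_mem [NeZero n] (hx : InCube x) :
    0 ≤ globalMean x ∧ globalMean x ≤ 1 := by
  have h := localMean_eq_globalMean_of_opinionDiam_le hx.opinionDiam_le_one (0 : Fin n)
  rw [← h]
  exact ⟨hx.localMean_nonneg zero_le_one _, hx.localMean_le_one zero_le_one _⟩

/-- Downward noise decreases the common mean. -/
lemma leads_globalMean_le [NeZero n] (hS : S.Nonempty) (hε : 0 < ε) (he : 0 < e) (heq : e ≤ q)
    (hIm : ∀ r ∈ Im, -ε ≤ r ∧ r ≤ -q) :
    Leads ε S Ip Im (fun x => opinionDiam x ≤ ε)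
      (fun x => opinionDiam x ≤ ε ∧ globalMean x ≤ e) := by
  obtain ⟨s, hs⟩ := hS
  have hn0 : (0 : ℝ) < n := by exact_mod_cast NeZero.pos n
  refine Leads.of_descent globalMean (A := 0) (B := 1) (div_pos he hn0) 1
    (fun x hx _ => hx.globalMean_mem.1) (fun x hx _ => hx.globalMean_mem.2) fun x hx hd => ?_
  by_cases hg : globalMean x ≤ e
  · exact Forces.of_target (Or.inl ⟨hd, hg⟩) _
  push Not at hg
  have hm := localMean_eq_globalMean_of_opinionDiam_le hd
  refine Forces.step ∅ fun u hu => Or.inr ?_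
  have hz : ∀ i, globalMean x - ε ≤ hkStep ε S x u i ∧ hkStep ε S x u i ≤ globalMean x := by
    intro i
    by_cases hi : i ∈ S
    · obtain ⟨h1, h2⟩ := hIm _ ((hu i hi).2 (by simp))
      rw [hkStep_of_mem u hi, hm]
      exact ⟨le_clip_add_of_le h1 (by linarith) (by linarith [hx.globalMean_mem.2]),
        clip_add_le_of_le h2 (by linarith) hx.globalMean_mem.1⟩
    · rw [hkStep_of_notMem hε.le hx u hi, hm]
      exact ⟨by linarith, le_rfl⟩
  have hd' : opinionDiam (hkStep ε S x u) ≤ ε := opinionDiam_le_of_forall hz (by linarith)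
  refine ⟨hd', ?_⟩
  rw [← localMean_eq_globalMean_of_opinionDiam_le hd' s]
  refine localMean_le_sub (k := s) hε.le (fun j _ => (hz j).2) (by simpa using hε.le) he.le ?_
  rw [hkStep_of_mem u hs, hm]
  exact clip_add_le_of_le (hIm _ ((hu s hs).2 (by simp))).2 (by linarith) (by linarith)

lemma globalMean_mem_of_forall [NeZero n] {J : Finset (Fin n)} {a b r : ℝ}
    (h : ∀ i, (a + if i ∈ J then r else 0) ≤ x i ∧ x i ≤ a + (if i ∈ J then r else 0) + b) :
    a + J.card * r / n ≤ globalMean x ∧ globalMean x ≤ a + J.card * r / n + b := by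
  have hn0 : (0 : ℝ) < n := by exact_mod_cast NeZero.pos n
  have h1 := Finset.sum_le_sum fun i (_ : i ∈ Finset.univ) => (h i).1
  have h2 := Finset.sum_le_sum fun i (_ : i ∈ Finset.univ) => (h i).2
  simp only [Finset.sum_add_distrib, Finset.sum_ite_mem, Finset.univ_inter, Finset.sum_const,
    Finset.card_univ, Fintype.card_fin, nsmul_eq_mul] at h1 h2
  have e1 : (a + J.card * r / n) * n = n * a + J.card * r := by field_simp
  rw [globalMean, le_div_iff₀ hn0, div_le_iff₀ hn0]
  constructor <;> linarith

/-- Upward noise raises the common mean in controlled steps until two noisy agents can be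
separated. -/
lemma forces_lt_opinionDiam_of_rise [NeZero n] (hS : 1 < S.card) (hε : 0 < ε) (he : 0 < e)
    (hp : ε + e < 2 * p) (hpq : p ≤ q) (he1 : 8 * (n * e) ≤ 1 - ε)
    (hIp : ∀ r ∈ Ip, p ≤ r ∧ r ≤ p + e ∧ r ≤ ε) (hIm : ∀ r ∈ Im, -ε ≤ r ∧ r ≤ -q) (r : ℕ) :
    ∀ x (E : ℝ), InCube x → opinionDiam x ≤ ε → p - r * (S.card * p / n) ≤ globalMean x →
      globalMean x ≤ p - r * (S.card * p / n) + E → E + r * e ≤ 4 * (n * e) → 0 ≤ E →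
      Forces ε S Ip Im (fun y => ε + e < opinionDiam y) (r + 1) x := by
  have hn1 : (1 : ℝ) ≤ n := by exact_mod_cast NeZero.one_le
  have hne : e ≤ n * e := by nlinarith
  have hn0 : (0 : ℝ) < n := by linarith
  have hp0 : 0 < p := by linarith
  have ht : 0 ≤ S.card * p / n := by positivity
  induction r with
  | zero =>
    intro x E hx hd h1 h2 hE hE0
    simp only [Nat.cast_zero, zero_mul, sub_zero, add_zero] at h1 h2 hE
    exact forces_lt_opinionDiam_of_split hS (fun r hr => (hIp r hr).1) (fun r hr => (hIm r hr).2)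
      hd (δ := E) (by linarith) (by linarith) hE0 (by linarith) (by linarith)
  | succ r ih =>
    intro x E hx hd h1 h2 hE hE0
    push_cast at h1 h2 hE
    have hr : 0 ≤ r * (S.card * p / n) := by positivity
    have hre : 0 ≤ r * e := by positivity
    -- If the mean is already large enough, the agents are split at once. Otherwise the upward push
    -- is not truncated, and it raises the mean by `S.card * p / n` up to an error `e`.
    by_cases hg : ε + e < globalMean x + p
    · exact (forces_lt_opinionDiam_of_split hS (fun r hr => (hIp r hr).1)
        (fun r hr => (hIm r hr).2) hd (δ := E) hg (by nlinarith) hE0 (by linarith)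
        (by linarith)).mono (by omega) hx
    push Not at hg
    have hg0 := hx.globalMean_mem.1
    have hm := localMean_eq_globalMean_of_opinionDiam_le hd
    refine Or.inr ⟨Set.univ, fun u hu => ?_⟩
    have hz : ∀ i, hkStep ε S x u i = globalMean x + if i ∈ S then u i else 0 := by
      intro i
      by_cases hi : i ∈ S
      · obtain ⟨h3, h4, -⟩ := hIp _ ((hu i hi).1 trivial)
        rw [hkStep_of_mem u hi, hm, if_pos hi, clip_of_mem (by linarith) (by linarith)]
      · rw [hkStep_of_notMem hε.le hx u hi, hm, if_neg hi, add_zero]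
    have hd' : opinionDiam (hkStep ε S x u) ≤ ε := by
      refine opinionDiam_le_of_forall (l := globalMean x) (r := globalMean x + ε) (fun i => ?_)
        (by linarith)
      rw [hz]
      split_ifs with hi
      · obtain ⟨h3, -, h5⟩ := hIp _ ((hu i hi).1 trivial)
        constructor <;> linarith
      · constructor <;> linarith
    have hg' := globalMean_mem_of_forall (x := hkStep ε S x u) (J := S) (a := globalMean x)
      (r := p) (b := e) (fun i => by
        rw [hz]
        split_ifs with hi
        · obtain ⟨h3, h4, -⟩ := hIp _ ((hu i hi).1 trivial)
          constructor <;> linarith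
        · constructor <;> linarith)
    refine ih _ (E + e) (inCube_hkStep ε S x u) hd' ?_ ?_ ?_ (by linarith)
    · linarith [hg'.1]
    · linarith [hg'.2]
    · linarith

/-- Splitting needs a mean roughly between `ε - p` and `q`, and when `p` is close to ε/2 this range
may be narrower than one rise of the mean. The first push is therefore calibrated so that a whole
number of rises ends near `p`. -/
lemma leads_lt_opinionDiam_of_globalMean_le [NeZero n] (hS : 1 < S.card) (hε : 0 < ε)
    (he : 0 < e) (hp : ε + e < 2 * p) (hpq : p ≤ q) (heε : 32 * (n * e) ≤ ε / n)
    (he1 : 32 * (n * e) ≤ 1 - ε)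
    (hIp : ∀ r ∈ Ip, p ≤ r ∧ r ≤ p + e ∧ r ≤ ε) (hIm : ∀ r ∈ Im, -ε ≤ r ∧ r ≤ -q) :
    Leads ε S Ip Im (fun x => opinionDiam x ≤ ε ∧ globalMean x ≤ e)
      (fun y => ε + e < opinionDiam y) := by
  have hn1 : (1 : ℝ) ≤ n := by exact_mod_cast NeZero.one_le
  have hne : e ≤ n * e := by nlinarith
  have hn0 : (0 : ℝ) < n := by linarith
  have hp0 : 0 < p := by linarith
  have hEε : ε / n ≤ ε := div_le_self hε.le hn1
  obtain ⟨s, hs⟩ := Finset.card_pos.1 (zero_lt_one.trans hS)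
  -- For `p` this close to ε the calibrated push might exceed diameter ε. But then a mean of `ε / n
  -- / 2` already suffices, and one push of all noisy agents provides it.
  by_cases hpε : ε - 4 * (n * e) ≤ p
  · refine ⟨1 + 1, fun x hx ⟨hd, hg⟩ => ?_⟩
    have hg0 := hx.globalMean_mem.1
    have hm := localMean_eq_globalMean_of_opinionDiam_le hd
    refine Or.inr ⟨Set.univ, fun u hu => ?_⟩
    have hz : ∀ i, globalMean x ≤ hkStep ε S x u i ∧ hkStep ε S x u i ≤ globalMean x + ε := by
      intro i
      by_cases hi : i ∈ S
      · obtain ⟨h3, -, h5⟩ := hIp _ ((hu i hi).1 trivial)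
        rw [hkStep_of_mem u hi, hm]
        exact ⟨le_clip_add_of_le h3 (by linarith) hx.globalMean_mem.2,
          clip_add_le_of_le h5 le_rfl (by linarith)⟩
      · rw [hkStep_of_notMem hε.le hx u hi, hm]
        constructor <;> linarith
    have hd' : opinionDiam (hkStep ε S x u) ≤ ε := opinionDiam_le_of_forall hz (by linarith)
    have hm' := localMean_eq_globalMean_of_opinionDiam_le hd' s
    obtain ⟨h3, h4, h5⟩ := hIp _ ((hu s hs).1 trivial)
    have hlow : p / n ≤ globalMean (hkStep ε S x u) := by
      rw [← hm', ← zero_add (p / n)]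
      refine le_localMean_add (k := s) hε.le (fun j _ => (inCube_hkStep ε S x u j).1)
        (by simpa using hε.le) hp0.le ?_
      rw [hkStep_of_mem u hs, hm]
      exact le_clip_add_of_le h3 (by linarith) (by linarith)
    have hup : globalMean (hkStep ε S x u) ≤ globalMean x + ε := by
      rw [← hm']
      exact localMean_le hε.le fun j _ => (hz j).2
    have hpn : ε / n / 2 ≤ p / n := by
      rw [div_right_comm]
      gcongr
      linarith
    exact forces_lt_opinionDiam_of_split hS (fun r hr => (hIp r hr).1) (fun r hr => (hIm r hr).2)
      hd' (δ := 4 * (n * e) + e) (by linarith) (by linarith) (by linarith) (by linarith)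
      (by linarith)
  · push Not at hpε
    -- Pushing only `j` noisy agents up from near 0 gives a mean of about `j * p / n`, and `r` full
    -- rises then add up to `p`.
    obtain ⟨r, j, hj0, hjS, hnj⟩ : ∃ r j, 0 < j ∧ j ≤ S.card ∧ n = j + r * S.card := by
      refine ⟨(n - 1) / S.card, (n - 1) % S.card + 1, by omega, Nat.mod_lt _ (by omega), ?_⟩
      have h1 := Nat.mod_add_div (n - 1) S.card
      have h2 := NeZero.pos n
      rw [mul_comm] at h1
      omega
    obtain ⟨J, hJS, hJ⟩ := Finset.exists_subset_card_eq hjS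
    have hrn : (r : ℝ) ≤ n := by
      have : r ≤ n := by nlinarith
      exact_mod_cast this
    have hjp : (J.card : ℝ) * p / n = p - r * (S.card * p / n) := by
      have : (n : ℝ) = J.card + r * S.card := by rw [hJ]; exact_mod_cast hnj
      have h2 : (J.card : ℝ) = n - r * S.card := by linarith
      rw [h2]
      field_simp
    refine ⟨r + 1 + 1, fun x hx ⟨hd, hg⟩ => Or.inr ⟨J, fun u hu => ?_⟩⟩
    have hg0 := hx.globalMean_mem.1
    have hm := localMean_eq_globalMean_of_opinionDiam_le hd
    have hz : ∀ i, (0 + if i ∈ J then p else 0) ≤ hkStep ε S x u i ∧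
        hkStep ε S x u i ≤ 0 + (if i ∈ J then p else 0) + 2 * e := by
      intro i
      refine ⟨?_, ?_⟩
      · split_ifs with hi
        · rw [hkStep_of_mem u (hJS hi), hm]
          exact le_clip_add_of_le (hIp _ ((hu i (hJS hi)).1 hi)).1 (by linarith) (by linarith)
        · simpa using (inCube_hkStep ε S x u i).1
      · by_cases hi : i ∈ S
        · rw [hkStep_of_mem u hi, hm]
          split_ifs with hiJ
          · exact clip_add_le_of_le (hIp _ ((hu i hi).1 hiJ)).2.1 (by linarith) (by linarith)
          · exact clip_add_le_of_le (hIm _ ((hu i hi).2 hiJ)).2 (by linarith) (by linarith)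
        · rw [hkStep_of_notMem hε.le hx u hi, hm, if_neg fun h => hi (hJS h)]
          linarith
    have hd' : opinionDiam (hkStep ε S x u) ≤ ε := by
      refine opinionDiam_le_of_forall (l := 0) (r := p + 2 * e)
        (fun i => ⟨(inCube_hkStep ε S x u i).1, (hz i).2.trans ?_⟩) (by linarith)
      split_ifs <;> linarith
    have hg' := globalMean_mem_of_forall hz
    rw [hjp, zero_add] at hg'
    refine forces_lt_opinionDiam_of_rise hS hε he hp hpq (by linarith) hIp hIm r _ (2 * e)
      (inCube_hkStep ε S x u) hd' hg'.1 hg'.2 ?_ (by linarith)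
    have : r * e ≤ n * e := by gcongr
    linarith

lemma leads_settled_bottom {η a : ℝ} (hS : S.Nonempty) (hη : 0 < η) (hηa : η < a)
    (hηε : n * η ≤ ε) (hIp : Ip.Nonempty) (hIm : Im.Nonempty) (hneg : ∀ r ∈ Im, r ≤ -a) :
    Leads ε S Ip Im (fun _ => True) (fun y => (∀ i j, |y i - y j| ≤ η ∨ ε < |y i - y j|) ∧
      ∀ s ∈ S, y s ≤ η) := by
  have hε : 0 ≤ ε := (by positivity : 0 ≤ n * η).trans hηε
  have hIp' : {r | -r ∈ Ip}.Nonempty := by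
    obtain ⟨r, hr⟩ := hIp; exact ⟨-r, by simpa using hr⟩
  have hIm' : {r | -r ∈ Im}.Nonempty := by
    obtain ⟨r, hr⟩ := hIm; exact ⟨-r, by simpa using hr⟩
  refine Leads.reflect hε ((leads_settled hS hη hηa hηε hIm' hIp' fun r hr => ?_).trans
    (Leads.of_imp ?_))
  · linarith [hneg _ hr]
  · rintro y - ⟨⟨h1, h2⟩, -⟩
    refine ⟨fun i j => ?_, fun s hs => by linarith [h2 s hs]⟩
    have : 1 - y i - (1 - y j) = -(y i - y j) := by ring
    rw [this, abs_neg]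
    exact h1 i j

/-- One can force the diameter either below `ε` or noticeably above `ε`. -/
lemma leads_opinionDiam_le_or_lt [NeZero n] (hS : 1 < S.card) (hε : 0 < ε)
    (he : 0 < e) (hp : ε + e < 2 * p) (hpq : p ≤ q) (heε : 32 * (n * e) ≤ ε / n)
    (he1 : 32 * (n * e) ≤ 1 - ε)
    (hIp : ∀ r ∈ Ip, p ≤ r ∧ r ≤ p + e ∧ r ≤ ε) (hIm : ∀ r ∈ Im, -ε ≤ r ∧ r ≤ -q)
    (hIp' : Ip.Nonempty) (hIm' : Im.Nonempty) :
    Leads ε S Ip Im (fun _ => True) (fun y => opinionDiam y ≤ ε ∨ ε + e < opinionDiam y) := by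
  have hn1 : (1 : ℝ) ≤ n := by exact_mod_cast NeZero.one_le
  have hne : e ≤ n * e := by nlinarith
  have hn0 : (0 : ℝ) < n := by linarith
  have hp0 : 0 < p := by linarith
  have hEε : ε / n ≤ ε := div_le_self hε.le hn1
  obtain ⟨s₁, hs₁, s₂, hs₂, hs⟩ := Finset.one_lt_card.1 hS
  refine (leads_settled_bottom (η := e) (Finset.card_pos.1 (by omega)) he (a := q) (by linarith)
    (by linarith) hIp' hIm' fun r hr => (hIm r hr).2).trans ⟨1 + 1, ?_⟩
  rintro x hx ⟨h1, h2⟩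
  by_cases hd1 : opinionDiam x ≤ ε
  · exact Forces.of_target (Or.inl hd1) _
  by_cases hd2 : ε + e < opinionDiam x
  · exact Forces.of_target (Or.inr hd2) _
  push Not at hd2
  -- The noisy agents are near 0 and the diameter barely exceeds ε, so there are two groups, near 0
  -- and near ε, that do not see each other.
  have hdic : ∀ i, x i ≤ 2 * e ∨ (ε ≤ x i ∧ x i ≤ ε + 2 * e) := by
    intro i
    have h3 := h2 s₁ hs₁
    rcases h1 i s₁ with h | h
    · left; linarith [(abs_le.1 h).2]
    · right
      have h4 := (abs_le.1 (opinionDiam_le_iff.1 hd2 i s₁)).2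
      rcases lt_abs.1 h with h | h
      · constructor <;> linarith [(hx s₁).1]
      · linarith [(hx i).1]
  have hlow : ∀ i, x i ≤ 2 * e → localMean ε x i ≤ 2 * e := by
    intro i hi
    refine localMean_le hε.le fun k hk => ?_
    rcases hdic k with h | h
    · exact h
    · linarith [(abs_le.1 ((h1 k i).resolve_right (not_lt.2 hk))).2]
  have hhigh : ∀ i, ε ≤ x i ∧ x i ≤ ε + 2 * e → ε ≤ localMean ε x i ∧
      localMean ε x i ≤ ε + 2 * e := by
    intro i hi
    have : ∀ k, |x k - x i| ≤ ε → ε ≤ x k ∧ x k ≤ ε + 2 * e := by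
      intro k hk
      rcases hdic k with h | h
      · linarith [(abs_le.1 ((h1 k i).resolve_right (not_lt.2 hk))).1]
      · exact h
    exact ⟨le_localMean hε.le fun k hk => (this k hk).1,
      localMean_le hε.le fun k hk => (this k hk).2⟩
  have hSlow : ∀ s ∈ S, localMean ε x s ≤ 2 * e := fun s hs =>
    hlow s (by linarith [h2 s hs])
  have hpε : p ≤ ε := by
    obtain ⟨r, hr⟩ := hIp'
    linarith [hIp r hr]
  have hqε : q ≤ ε := by
    obtain ⟨r, hr⟩ := hIm'
    linarith [hIm r hr]
  -- Lifting `s₂` puts it within reach of the upper group, while `s₁` stays at 0 as an anchor for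
  -- the lower one.
  refine Or.inr ⟨{s₂}, fun u hu => ?_⟩
  have hycube := inCube_hkStep ε S x u
  have hy0 : ∀ s ∈ S, s ≠ s₂ → hkStep ε S x u s = 0 := by
    intro s hs hne
    refine le_antisymm ?_ (hycube s).1
    rw [hkStep_of_mem u hs]
    exact clip_add_le_of_le (hIm _ ((hu s hs).2 hne)).2 (by linarith [hSlow s hs]) le_rfl
  obtain ⟨hu1, hu2, hu3⟩ := hIp _ ((hu s₂ hs₂).1 rfl)
  have hm0 := hx.localMean_nonneg hε.le s₂
  have hy2 : p ≤ hkStep ε S x u s₂ ∧ hkStep ε S x u s₂ ≤ p + 3 * e ∧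
      hkStep ε S x u s₂ ≤ ε + 2 * e := by
    rw [hkStep_of_mem u hs₂]
    exact ⟨le_clip_add_of_le hu1 (by linarith) (by linarith),
      clip_add_le_of_le hu2 (by linarith [hSlow s₂ hs₂]) (by linarith),
      clip_add_le_of_le hu3 (by linarith [hSlow s₂ hs₂]) (by linarith)⟩
  have hynon : ∀ i, i ∉ S → hkStep ε S x u i ≤ 2 * e ∨
      (ε ≤ hkStep ε S x u i ∧ hkStep ε S x u i ≤ ε + 2 * e) := by
    intro i hi
    rw [hkStep_of_notMem hε.le hx u hi]
    rcases hdic i with h | h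
    · exact Or.inl (hlow i h)
    · exact Or.inr (hhigh i h)
  set y := hkStep ε S x u with hydef
  have hs1 : y s₁ = 0 := hy0 s₁ hs₁ hs
  have hymax : ∀ i, y i ≤ ε + 2 * e := by
    intro i
    by_cases hi : i ∈ S
    · by_cases hi2 : i = s₂
      · rw [hi2]; exact hy2.2.2
      · rw [hy0 i hi hi2]; linarith
    · rcases hynon i hi with h | h <;> linarith
  -- If `s₂` is clearly below ε, it pulls the upper group below ε. If not, `p` is close to ε, and a
  -- second lift of `s₂` from its positive mean exceeds `ε + e`.
  rcases le_or_gt (y s₂) (ε - 4 * (n * e)) with hlt | hgt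
  · refine Forces.step ∅ fun v hv => Or.inl ?_
    refine opinionDiam_le_of_forall (l := 0) (r := ε)
      (fun i => ⟨(inCube_hkStep ε S y v i).1, ?_⟩) (by linarith)
    by_cases hi : i ∈ S
    · rw [hkStep_of_mem v hi]
      have := localMean_le (ε := ε) (x := y) (i := i) hε.le fun k _ => hymax k
      exact clip_add_le_of_le (hIm _ ((hv i hi).2 (by simp))).2 (by linarith) hε.le
    · rw [hkStep_of_notMem hε.le hycube v hi]
      rcases hynon i hi with h | h
      · have h3 : |y s₁ - y i| ≤ ε := by
          rw [hs1, abs_le]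
          constructor <;> linarith [(hycube i).1]
        have := localMean_le_sub (k := s₁) (B := ε + 2 * e) (θ := ε + 2 * e) hε.le
          (fun k _ => hymax k) h3 (by linarith) (by linarith)
        have h4 : ε / n ≤ (ε + 2 * e) / n := by gcongr; linarith
        linarith
      · have h3 : |y s₂ - y i| ≤ ε := by
          rw [abs_le]
          constructor <;> linarith
        have := localMean_le_sub (k := s₂) (B := ε + 2 * e) (θ := 2 * e + 4 * (n * e)) hε.le
          (fun k _ => hymax k) h3 (by linarith) (by linarith)
        have h4 : 2 * e ≤ (2 * e + 4 * (n * e)) / n := by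
          rw [le_div_iff₀ hn0]
          linarith
        linarith
  · refine Forces.step {s₂} fun v hv => Or.inr (lt_opinionDiam_of s₂ s₁ ?_)
    have h3 : hkStep ε S y v s₁ ≤ 0 := by
      rw [hkStep_of_mem v hs₁]
      refine clip_add_le_of_le (hIm _ ((hv s₁ hs₁).2 hs)).2 ?_ le_rfl
      have := localMean_le_sub (ε := ε) (x := y) (i := s₁) (k := s₁) (B := ε) (θ := ε) hε.le
        (fun k hk => by rw [hs1, sub_zero] at hk; exact (abs_le.1 hk).2) (by simpa using hε.le)
        hε.le (by linarith)
      linarith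
    have h4 : min 1 (ε / n / 2 + p) ≤ hkStep ε S y v s₂ := by
      rw [hkStep_of_mem v hs₂]
      refine le_clip_add_of_le (hIp _ ((hv s₂ hs₂).1 rfl)).1 ((min_le_right _ _).trans ?_)
        (min_le_left _ _)
      have := le_localMean_add (ε := ε) (x := y) (i := s₂) (k := s₂) (B := 0) (θ := ε / 2) hε.le
        (fun k _ => (hycube k).1) (by simpa using hε.le) (by linarith) (by linarith)
      rw [div_right_comm] at this
      linarith
    have h5 : ε + e < min 1 (ε / n / 2 + p) := lt_min (by linarith) (by linarith)
    linarith

/-- Two noisy agents separate if the noise exceeds `ε / 2` in both directions. -/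
theorem leads_lt_opinionDiam_of_half [NeZero n] (hS : 1 < S.card) (hε : 0 < ε)
    (he : 0 < e) (hp : ε + e < 2 * p) (hpq : p ≤ q) (heε : 32 * (n * e) ≤ ε / n)
    (he1 : 32 * (n * e) ≤ 1 - ε)
    (hIp : ∀ r ∈ Ip, p ≤ r ∧ r ≤ p + e ∧ r ≤ ε) (hIm : ∀ r ∈ Im, -ε ≤ r ∧ r ≤ -q)
    (hIp' : Ip.Nonempty) (hIm' : Im.Nonempty) :
    Leads ε S Ip Im (fun _ => True) (fun y => ε + e < opinionDiam y) := by
  have hn1 : (1 : ℝ) ≤ n := by exact_mod_cast NeZero.one_le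
  have hne : e ≤ n * e := by nlinarith
  have hEε : ε / n ≤ ε := div_le_self hε.le hn1
  refine (leads_opinionDiam_le_or_lt hS hε he hp hpq heε he1 hIp hIm hIp' hIm').trans
    (Leads.or ?_ (Leads.of_imp fun _ _ h => h))
  exact (leads_globalMean_le (Finset.card_pos.1 (by omega)) hε he (by linarith) hIm).trans
    (leads_lt_opinionDiam_of_globalMean_le hS hε he hp hpq heε he1 hIp hIm)

end TwoNoisyAgents

/-! ### The noise distribution -/

section NoiseLaw

variable {Ω : Type*} [MeasurableSpace Ω] {P : Measure Ω} {X : Ω → ℝ}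

lemma exists_pos_measure_add_le {A : Set Ω} {l : ℝ} (h : 0 < P (A ∩ {ω | l < X ω})) :
    ∃ c > 0, 0 < P (A ∩ {ω | l + c ≤ X ω}) := by
  by_contra! hc
  refine h.ne' (measure_mono_null (fun ω hω => ?_)
    (measure_iUnion_null fun k : ℕ => nonpos_iff_eq_zero.1 (hc (1 / (k + 1)) (by positivity))))
  obtain ⟨hA, hω⟩ := hω
  obtain ⟨k, hk⟩ := exists_nat_one_div_lt (show 0 < X ω - l from sub_pos.2 hω)
  refine Set.mem_iUnion.2 ⟨k, hA, ?_⟩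
  simp only [Set.mem_ofPred_eq]
  linarith

/-- Countably many windows of length κ cover the half-line from `l`, so one of them is charged.
Narrow windows keep the rises of the common mean predictable. -/
lemma exists_pos_measure_narrow {l b κ : ℝ} (hκ : 0 < κ)
    (h : 0 < P {ω | X ω ≤ b ∧ l ≤ X ω}) :
    ∃ p ≥ l, 0 < P (X ⁻¹' {r | p ≤ r ∧ r ≤ p + κ ∧ r ≤ b}) := by
  by_contra! hc
  refine h.ne' (measure_mono_null (fun ω hω => ?_)
    (measure_iUnion_null fun k : ℕ => nonpos_iff_eq_zero.1 (hc (l + k * κ)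
      (le_add_of_nonneg_right (by positivity)))))
  obtain ⟨hb, hl⟩ := hω
  have h0 : 0 ≤ (X ω - l) / κ := div_nonneg (by linarith) hκ.le
  have h1 := Nat.floor_le h0
  have h2 := Nat.lt_floor_add_one ((X ω - l) / κ)
  rw [le_div_iff₀ hκ] at h1
  rw [div_lt_iff₀ hκ] at h2
  refine Set.mem_iUnion.2 ⟨⌊(X ω - l) / κ⌋₊, ?_, ?_, hb⟩ <;> linarith

/-- If `X ≤ 0` almost surely with mean 0, then `X = 0` almost surely, against the positive second
moment. -/
lemma measure_pos_of_integral_eq_zero (hX : Integrable X P) (hmean : ∫ ω, X ω ∂P = 0)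
    (hvar : 0 < ∫ ω, X ω ^ 2 ∂P) : 0 < P {ω | 0 < X ω} := by
  rw [pos_iff_ne_zero]
  intro h
  have h1 : ∀ᵐ ω ∂P, 0 ≤ -X ω := by
    rw [ae_iff]
    simpa using h
  have h2 : ∫ ω, -X ω ∂P = 0 := by rw [integral_neg, hmean, neg_zero]
  have h3 := (integral_eq_zero_iff_of_nonneg_ae h1 hX.neg).1 h2
  have h4 : ∫ ω, X ω ^ 2 ∂P = 0 := by
    refine integral_eq_zero_of_ae ?_
    filter_upwards [h3] with ω hω
    simpa using hω
  exact hvar.ne' h4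

end NoiseLaw

/-! ### Consensus -/

lemma opinionDiam_hkStep_le {n : ℕ} [NeZero n] {ε : ℝ} {S : Finset (Fin n)} {x u : Fin n → ℝ}
    (hd : opinionDiam x ≤ ε)
    (hu : ∀ i j, |(if i ∈ S then u i else 0) - (if j ∈ S then u j else 0)| ≤ ε) :
    opinionDiam (hkStep ε S x u) ≤ ε := by
  refine opinionDiam_le_iff.2 fun i j => (abs_clip_sub_clip_le _ _).trans ?_
  rw [localMean_eq_globalMean_of_opinionDiam_le hd, localMean_eq_globalMean_of_opinionDiam_le hd,
    add_sub_add_left_eq_sub]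
  exact hu i j

lemma consensusTime_lt_top {n : ℕ} {ε : ℝ} {x : ℕ → Fin n → ℝ} (t : ℕ)
    (ht : opinionDiam (x t) ≤ ε)
    (h : ∀ t, opinionDiam (x t) ≤ ε → opinionDiam (x (t + 1)) ≤ ε) :
    consensusTime ε x < ⊤ :=
  lt_of_le_of_lt (sInf_le ⟨t, rfl, fun _ h' => Nat.le_induction ht (fun t' _ => h t') _ h'⟩)
    (ENat.natCast_lt_top t)

/-- The diameters are bounded by 1, so the real `limsup` carries information. -/
lemma QuasiConsensus.eventually_le {n : ℕ} [NeZero n] {ε e : ℝ} {x : ℕ → Fin n → ℝ}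
    (h : QuasiConsensus ε x) (hx : ∀ t, InCube (x t)) (he : 0 < e) :
    ∃ T, ∀ t ≥ T, opinionDiam (x t) ≤ ε + e := by
  have h1 : limsup (fun t => opinionDiam (x t)) atTop < ε + e :=
    lt_of_le_of_lt h (by linarith)
  have h2 := eventually_lt_of_limsup_lt h1
    (isBoundedUnder_of ⟨1, fun t => (hx t).opinionDiam_le_one⟩)
  exact eventually_atTop.1 (h2.mono fun t ht => ht.le)

/-! ### From steering to the two probability statements. -/

section Noise

variable {Ω : Type*} [MeasurableSpace Ω] {P : Measure Ω} [IsProbabilityMeasure P]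
  {n : ℕ} [NeZero n] {S : Finset (Fin n)} {ξ : Fin n → ℕ → Ω → ℝ} {x0 : Fin n → ℝ} {ε b : ℝ}

theorem measure_consensusTime_lt_top (hmeas : ∀ i t, 1 ≤ t → Measurable (ξ i t))
    (hindep : iIndepFun (fun (p : Fin n × {t : ℕ // 1 ≤ t}) => ξ p.1 p.2) P)
    (hident : ∀ i t, 1 ≤ t → IdentDistrib (ξ i t) (ξ 0 1) P P)
    (hmean : ∫ ω, ξ 0 1 ω ∂P = 0) (hsq : Integrable (fun ω => ξ 0 1 ω ^ 2) P)
    (hvar : 0 < ∫ ω, ξ 0 1 ω ^ 2 ∂P) (hx0 : InCube x0)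
    (hb : P {ω | |ξ 0 1 ω| ≤ b} = 1)
    (hinv : ∀ u : Fin n → ℝ, (∀ i, |u i| ≤ b) →
      ∀ i j, |(if i ∈ S then u i else 0) - (if j ∈ S then u j else 0)| ≤ ε)
    (hlead : ∀ a, 0 < a → a ≤ b → Leads ε S (Set.Icc a b) (Set.Icc (-b) (-a)) (fun _ => True)
      (fun x => opinionDiam x ≤ ε)) :
    P {ω | consensusTime ε (hkState ε S x0 (fun i t => ξ i t ω)) < ⊤} = 1 := by
  have hX := hmeas 0 1 le_rfl
  have hb' : ∀ᵐ ω ∂P, |ξ 0 1 ω| ≤ b :=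
    (mem_ae_iff_prob_eq_one (measurableSet_le hX.abs measurable_const)).2 hb
  have hint : Integrable (ξ 0 1) P :=
    ((memLp_two_iff_integrable_sq hX.aestronglyMeasurable).2 hsq).integrable one_le_two
  -- Applied to the noise and to its negative, this yields a common `a` such that noise in `[a, b]`
  -- and noise in `[-b, -a]` both have positive probability.
  have key : ∀ X : Ω → ℝ, Integrable X P → ∫ ω, X ω ∂P = 0 → 0 < ∫ ω, X ω ^ 2 ∂P →
      ∃ c > 0, 0 < P ({ω | |ξ 0 1 ω| ≤ b} ∩ {ω | 0 + c ≤ X ω}) := fun X h1 h2 h3 =>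
    exists_pos_measure_add_le (by
      rw [Set.inter_comm, measure_inter_conull (mem_ae_iff.1 hb')]
      exact measure_pos_of_integral_eq_zero h1 h2 h3)
  obtain ⟨a₁, ha₁, h₁⟩ := key _ hint hmean hvar
  obtain ⟨a₂, ha₂, h₂⟩ := key (fun ω => -ξ 0 1 ω) hint.neg
    (by rw [integral_neg, hmean, neg_zero]) (by simpa using hvar)
  set a := min a₁ a₂ with ha
  have ha1 : a ≤ a₁ := min_le_left _ _
  have ha2 : a ≤ a₂ := min_le_right _ _
  have hPp : 0 < P (ξ 0 1 ⁻¹' Set.Icc a b) := h₁.trans_le <| measure_mono fun ω hω => by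
    obtain ⟨h3, h4⟩ := hω
    simp only [Set.mem_ofPred_eq] at h3 h4
    constructor <;> linarith [(abs_le.1 h3).2]
  have hPm : 0 < P (ξ 0 1 ⁻¹' Set.Icc (-b) (-a)) := h₂.trans_le <| measure_mono fun ω hω => by
    obtain ⟨h3, h4⟩ := hω
    simp only [Set.mem_ofPred_eq] at h3 h4
    constructor <;> linarith [(abs_le.1 h3).1]
  have hab : a ≤ b := by
    obtain ⟨ω, hω⟩ := nonempty_of_measure_ne_zero hPp.ne'
    exact hω.1.trans hω.2
  have hnull := measure_eventually_mem_eq_zero (S := S) (ε := ε) hmeas hindep hident hx0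
    (D := {x | ε < opinionDiam x}) (measurableSet_lt measurable_const measurable_opinionDiam)
    measurableSet_Icc measurableSet_Icc hPp hPm
    (by simpa only [Set.mem_ofPred_eq, not_lt] using hlead a (lt_min ha₁ ha₂) hab) 0
  have hbound : ∀ᵐ ω ∂P, ∀ t i, |ξ i (t + 1) ω| ≤ b := by
    rw [ae_all_iff]
    intro t
    rw [ae_all_iff]
    intro i
    exact (hident i (t + 1) (by omega)).symm.ae_snd (p := fun r => |r| ≤ b)
      (measurableSet_le (by fun_prop) measurable_const) hb'
  refine (measure_congr (eventuallyEq_univ.2 ?_)).trans measure_univ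
  have hreach : ∀ᵐ ω ∂P, ∃ t, opinionDiam (randomState ε S x0 ξ t ω) ≤ ε := by
    rw [ae_iff]
    simpa using hnull
  filter_upwards [hreach, hbound] with ω ⟨t, ht⟩ hω
  exact consensusTime_lt_top t ht fun t ht => opinionDiam_hkStep_le ht (hinv _ (hω t))

theorem measure_quasiConsensus_eq_zero (hmeas : ∀ i t, 1 ≤ t → Measurable (ξ i t))
    (hindep : iIndepFun (fun (p : Fin n × {t : ℕ // 1 ≤ t}) => ξ p.1 p.2) P)
    (hident : ∀ i t, 1 ≤ t → IdentDistrib (ξ i t) (ξ 0 1) P P) (hx0 : InCube x0)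
    {Ip Im : Set ℝ} {e : ℝ} (he : 0 < e) (hIp : MeasurableSet Ip) (hIm : MeasurableSet Im)
    (hPp : 0 < P (ξ 0 1 ⁻¹' Ip)) (hPm : 0 < P (ξ 0 1 ⁻¹' Im))
    (hlead : Leads ε S Ip Im (fun _ => True) (fun x => ε + e < opinionDiam x)) :
    P {ω | QuasiConsensus ε (hkState ε S x0 (fun i t => ξ i t ω))} = 0 := by
  have hnull := measure_iUnion_null (measure_eventually_mem_eq_zero (S := S) (ε := ε) hmeas hindep
    hident hx0 (D := {x | opinionDiam x ≤ ε + e})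
    (measurableSet_le measurable_opinionDiam measurable_const) hIp hIm hPp hPm
    (by simpa only [Set.mem_ofPred_eq, not_le] using hlead))
  refine measure_mono_null (fun ω hω => Set.mem_iUnion.2 ?_) hnull
  exact QuasiConsensus.eventually_le hω (fun t => inCube_randomState hx0 t ω) he

end Noise

/-! ### Choice of the noise sets for part (ii). -/

section NoiseSets

variable {Ω : Type*} [MeasurableSpace Ω] {P : Measure Ω} {n : ℕ} {S : Finset (Fin n)} {ε : ℝ}

lemma Set.Nonempty.of_preimage_measure_pos {X : Ω → ℝ} {I : Set ℝ} (h : 0 < P (X ⁻¹' I)) :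
    I.Nonempty :=
  let ⟨ω, hω⟩ := nonempty_of_measure_ne_zero h.ne'
  ⟨X ω, hω⟩

/-- It suffices to find suitable sets of noise values for the reflected noise. -/
lemma exists_leads_of_neg {X : Ω → ℝ} (hε : 0 ≤ ε)
    (h : ∃ Ip Im e, 0 < e ∧ MeasurableSet Ip ∧ MeasurableSet Im ∧ 0 < P ((fun ω => -X ω) ⁻¹' Ip) ∧
      0 < P ((fun ω => -X ω) ⁻¹' Im) ∧
      Leads ε S Ip Im (fun _ => True) (fun x => ε + e < opinionDiam x)) :
    ∃ Ip Im e, 0 < e ∧ MeasurableSet Ip ∧ MeasurableSet Im ∧ 0 < P (X ⁻¹' Ip) ∧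
      0 < P (X ⁻¹' Im) ∧
      Leads ε S Ip Im (fun _ => True) (fun x => ε + e < opinionDiam x) := by
  obtain ⟨Ip, Im, e, he, h1, h2, h3, h4, h5⟩ := h
  exact ⟨{r | -r ∈ Im}, {r | -r ∈ Ip}, e, he, measurable_neg h2, measurable_neg h1, h4, h3,
    Leads.opinionDiam_reflect hε (by simpa using h5)⟩

variable [NeZero n]

theorem exists_leads_of_singleton {X : Ω → ℝ} {s : Fin n} (hn : 2 ≤ n) (hε : 0 < ε) (hε1 : ε < 1)
    (hp : 0 < P {ω | ε < X ω}) (hm : 0 < P {ω | X ω < -ε}) :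
    ∃ Ip Im e, 0 < e ∧ MeasurableSet Ip ∧ MeasurableSet Im ∧ 0 < P (X ⁻¹' Ip) ∧
      0 < P (X ⁻¹' Im) ∧
      Leads ε {s} Ip Im (fun _ => True) (fun x => ε + e < opinionDiam x) := by
  have hn0 : (0 : ℝ) < n := by exact_mod_cast NeZero.pos n
  obtain ⟨c₁, hc₁, h₁⟩ := exists_pos_measure_add_le (A := Set.univ) (X := X) (l := ε)
    (by simpa using hp)
  obtain ⟨c₂, hc₂, h₂⟩ := exists_pos_measure_add_le (A := Set.univ) (X := fun ω => -X ω) (l := ε)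
    (by simpa [lt_neg] using hm)
  set c := min c₁ c₂ with hc
  have hc1 : c ≤ c₁ := min_le_left _ _
  have hc2 : c ≤ c₂ := min_le_right _ _
  have hc0 : 0 < c := lt_min hc₁ hc₂
  -- Here `m` plays the role of `n * e`. The last bound is conditional because `1 - 2 * ε` need not
  -- be positive.
  obtain ⟨m, hm0, hm1, hm2, hm3, hm4⟩ : ∃ m : ℝ, 0 < m ∧ 8 * m ≤ c ∧ 8 * m ≤ 1 - ε ∧ m ≤ ε ∧
      (ε < 1 / 2 → 8 * m ≤ 1 - 2 * ε) := by
    have h0 : 0 < min c (min (1 - ε) ε) := lt_min hc0 (lt_min (by linarith) hε)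
    have h1 : min c (min (1 - ε) ε) ≤ c := min_le_left _ _
    have h2 : min c (min (1 - ε) ε) ≤ 1 - ε := (min_le_right _ _).trans (min_le_left _ _)
    have h3 : min c (min (1 - ε) ε) ≤ ε := (min_le_right _ _).trans (min_le_right _ _)
    by_cases hh : ε < 1 / 2
    · have h4 : 0 < min (min c (min (1 - ε) ε)) (1 - 2 * ε) := lt_min h0 (by linarith)
      have h5 := min_le_left (min c (min (1 - ε) ε)) (1 - 2 * ε)
      have h6 := min_le_right (min c (min (1 - ε) ε)) (1 - 2 * ε)
      exact ⟨min (min c (min (1 - ε) ε)) (1 - 2 * ε) / 8, by linarith, by linarith, by linarith,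
        by linarith, fun _ => by linarith⟩
    · exact ⟨min c (min (1 - ε) ε) / 8, by linarith, by linarith, by linarith,
        by linarith, fun h => absurd h hh⟩
  have hPp : 0 < P (X ⁻¹' Set.Ici (ε + c)) := h₁.trans_le <| measure_mono fun ω hω => by
    have := hω.2
    simp only [Set.mem_ofPred_eq] at this
    simp only [Set.mem_preimage, Set.mem_Ici]
    linarith
  have hPm : 0 < P (X ⁻¹' Set.Iic (-(ε + c))) := h₂.trans_le <| measure_mono fun ω hω => by
    have := hω.2
    simp only [Set.mem_ofPred_eq] at this
    simp only [Set.mem_preimage, Set.mem_Iic]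
    linarith
  have hme : n * (m / n) = m := mul_div_cancel₀ _ hn0.ne'
  exact ⟨Set.Ici (ε + c), Set.Iic (-(ε + c)), m / n, by positivity, measurableSet_Ici,
    measurableSet_Iic, hPp, hPm, leads_lt_opinionDiam_of_singleton hn hε (by positivity)
      (by rwa [hme]) (by rwa [hme]) (by rwa [hme]) (by rwa [hme]) (fun _ h => h) (fun _ h => h)
      (.of_preimage_measure_pos hPp) (.of_preimage_measure_pos hPm)⟩

lemma exists_leads_of_large {X : Ω → ℝ} (hS : 1 < S.card) (hε : 0 < ε) (hε1 : ε < 1)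
    (hp : 0 < P {ω | ε / 2 < X ω}) (hm : 0 < P {ω | X ω < -ε}) :
    ∃ Ip Im e, 0 < e ∧ MeasurableSet Ip ∧ MeasurableSet Im ∧ 0 < P (X ⁻¹' Ip) ∧
      0 < P (X ⁻¹' Im) ∧
      Leads ε S Ip Im (fun _ => True) (fun x => ε + e < opinionDiam x) := by
  have hn1 : (1 : ℝ) ≤ n := by exact_mod_cast NeZero.one_le
  have hn0 : (0 : ℝ) < n := by linarith
  obtain ⟨c, hc, h⟩ := exists_pos_measure_add_le (A := Set.univ) (X := fun ω => -X ω) (l := ε)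
    (by simpa [lt_neg] using hm)
  have hPp : 0 < P (X ⁻¹' Set.Ici (ε / 2)) := hp.trans_le <| measure_mono fun ω (hω : ε / 2 < X ω) =>
    hω.le
  have hPm : 0 < P (X ⁻¹' Set.Iic (-(ε + c))) := h.trans_le <| measure_mono fun ω hω => by
    have := hω.2
    simp only [Set.mem_ofPred_eq] at this
    simp only [Set.mem_preimage, Set.mem_Iic]
    linarith
  set m := min c (min (1 - ε) ε) with hm
  have h0 : 0 < m := lt_min hc (lt_min (by linarith) hε)
  have h1 : m ≤ c := min_le_left _ _
  have h2 : m ≤ 1 - ε := (min_le_right _ _).trans (min_le_left _ _)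
  have h3 : m ≤ ε := (min_le_right _ _).trans (min_le_right _ _)
  have hme : n * (m / 8 / n) = m / 8 := mul_div_cancel₀ _ hn0.ne'
  have hle : m / 8 / n ≤ m / 8 := div_le_self (by positivity) hn1
  exact ⟨Set.Ici (ε / 2), Set.Iic (-(ε + c)), m / 8 / n, by positivity, measurableSet_Ici,
    measurableSet_Iic, hPp, hPm, leads_lt_opinionDiam_of_large (c := c) hS hε (by positivity)
      (by linarith) (by linarith) (by rw [hme]; linarith) (fun _ h => h) (fun _ h => h)
      (.of_preimage_measure_pos hPp) (.of_preimage_measure_pos hPm)⟩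

lemma exists_leads_of_narrow {X : Ω → ℝ} {p q e : ℝ} (hS : 1 < S.card) (hε : 0 < ε) (he : 0 < e)
    (hp : ε + e < 2 * p) (hpq : p ≤ q) (heε : 32 * (n * e) ≤ ε / n) (he1 : 32 * (n * e) ≤ 1 - ε)
    (hPp : 0 < P (X ⁻¹' {r | p ≤ r ∧ r ≤ p + e ∧ r ≤ ε}))
    (hPm : 0 < P ((fun ω => -X ω) ⁻¹' {r | q ≤ r ∧ r ≤ q + e ∧ r ≤ ε})) :
    ∃ Ip Im e, 0 < e ∧ MeasurableSet Ip ∧ MeasurableSet Im ∧ 0 < P (X ⁻¹' Ip) ∧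
      0 < P (X ⁻¹' Im) ∧
      Leads ε S Ip Im (fun _ => True) (fun x => ε + e < opinionDiam x) := by
  have hmeas : ∀ p : ℝ, MeasurableSet {r : ℝ | p ≤ r ∧ r ≤ p + e ∧ r ≤ ε} := fun p =>
    measurableSet_Ici.inter (measurableSet_Iic.inter measurableSet_Iic)
  refine ⟨{r | p ≤ r ∧ r ≤ p + e ∧ r ≤ ε}, {r | -r ∈ {r | q ≤ r ∧ r ≤ q + e ∧ r ≤ ε}}, e, he,
    hmeas p, measurable_neg (hmeas q), hPp, hPm,
    leads_lt_opinionDiam_of_half hS hε he hp hpq heε he1 (fun _ h => h) ?_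
      (.of_preimage_measure_pos hPp) (.of_preimage_measure_pos (X := X) hPm)⟩
  rintro r ⟨h1, -, h2⟩
  constructor <;> linarith

theorem exists_leads_of_half {X : Ω → ℝ} (hS : 1 < S.card) (hε : 0 < ε)
    (hε1 : ε < 1) (hp : 0 < P {ω | ε / 2 < X ω}) (hm : 0 < P {ω | X ω < -(ε / 2)}) :
    ∃ Ip Im e, 0 < e ∧ MeasurableSet Ip ∧ MeasurableSet Im ∧ 0 < P (X ⁻¹' Ip) ∧
      0 < P (X ⁻¹' Im) ∧
      Leads ε S Ip Im (fun _ => True) (fun x => ε + e < opinionDiam x) := by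
  have hn0 : (0 : ℝ) < n := by exact_mod_cast NeZero.pos n
  have hm' : 0 < P {ω | ε / 2 < -X ω} := by simpa only [lt_neg] using hm
  by_cases h1 : 0 < P {ω | X ω < -ε}
  · exact exists_leads_of_large hS hε hε1 hp h1
  by_cases h2 : 0 < P {ω | ε < X ω}
  · exact exists_leads_of_neg hε.le (exists_leads_of_large hS hε hε1 hm'
      (by simpa only [neg_lt_neg_iff] using h2))
  -- In the remaining case the noise lies in `[-ε, ε]` almost surely, and it exceeds ε/2 by a fixed
  -- margin in both directions with positive probability.
  have key : ∀ Y : Ω → ℝ, ¬ 0 < P {ω | ε < Y ω} → 0 < P {ω | ε / 2 < Y ω} →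
      ∃ c > 0, 0 < P {ω | Y ω ≤ ε ∧ ε / 2 + c ≤ Y ω} := fun Y h3 h4 =>
    exists_pos_measure_add_le (A := {ω | Y ω ≤ ε}) (by
      rw [Set.inter_comm, measure_inter_conull]
      · exact h4
      · simpa [Set.compl_def] using h3)
  obtain ⟨c₁, hc₁, h₁⟩ := key X h2 hp
  obtain ⟨c₂, hc₂, h₂⟩ := key (fun ω => -X ω) (by simpa only [lt_neg] using h1) hm'
  set m := min (min c₁ c₂) (min (1 - ε) (ε / n)) with hm
  have hm0 : 0 < m := lt_min (lt_min hc₁ hc₂) (lt_min (by linarith) (by positivity))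
  have hm1 : m ≤ c₁ := (min_le_left _ _).trans (min_le_left _ _)
  have hm2 : m ≤ c₂ := (min_le_left _ _).trans (min_le_right _ _)
  have hm3 : m ≤ 1 - ε := (min_le_right _ _).trans (min_le_left _ _)
  have hm4 : m ≤ ε / n := (min_le_right _ _).trans (min_le_right _ _)
  have hme : 32 * (n * (m / 32 / n)) = m := by field_simp
  have hle : m / 32 / n ≤ m / 32 := div_le_self (by positivity) (by exact_mod_cast NeZero.one_le)
  have he : 0 < m / 32 / n := by positivity
  obtain ⟨p, hpl, hpp⟩ := exists_pos_measure_narrow he h₁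
  obtain ⟨q, hql, hqq⟩ := exists_pos_measure_narrow he h₂
  -- Reflection of the opinions lets the smaller of the two noise levels be the upward one.
  rcases le_total p q with hpq | hqp
  · exact exists_leads_of_narrow hS hε he (by linarith) hpq (by rwa [hme]) (by rwa [hme]) hpp hqq
  · exact exists_leads_of_neg hε.le (exists_leads_of_narrow hS hε he (by linarith) hqp
      (by rwa [hme]) (by rwa [hme]) hqq (by simpa only [neg_neg] using hpp))

end NoiseSets

theorem theorem1 {Ω : Type*} [MeasurableSpace Ω] (P : Measure Ω) [IsProbabilityMeasure P]
    (n : ℕ) [NeZero n] (S : Finset (Fin n)) (hS : S.Nonempty)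
    (ξ : Fin n → ℕ → Ω → ℝ)
    (hmeas : ∀ i t, 1 ≤ t → Measurable (ξ i t))
    (hindep : iIndepFun (fun (p : Fin n × {t : ℕ // 1 ≤ t}) => ξ p.1 p.2) P)
    (hident : ∀ i t, 1 ≤ t → IdentDistrib (ξ i t) (ξ 0 1) P P)
    (hmean : ∫ ω, ξ 0 1 ω ∂P = 0)
    (hsq : Integrable (fun ω => ξ 0 1 ω ^ 2) P)
    (hvar : 0 < ∫ ω, ξ 0 1 ω ^ 2 ∂P)
    (x0 : Fin n → ℝ) (hx0 : ∀ i, x0 i ∈ Set.Icc (0 : ℝ) 1)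
    (ε : ℝ) (hε : ε ∈ Set.Ioc (0 : ℝ) 1) :
    (((S.card = 1 ∧ P {ω | |ξ 0 1 ω| ≤ ε} = 1) ∨
        (1 < S.card ∧ P {ω | |ξ 0 1 ω| ≤ ε / 2} = 1)) →
      P {ω | consensusTime ε (hkState ε S x0 (fun i t => ξ i t ω)) < ⊤} = 1) ∧
    (2 ≤ n → ε < 1 →
      ((S.card = 1 ∧ 0 < P {ω | ε < ξ 0 1 ω} ∧ 0 < P {ω | ξ 0 1 ω < -ε}) ∨
        (1 < S.card ∧ 0 < P {ω | ε / 2 < ξ 0 1 ω} ∧ 0 < P {ω | ξ 0 1 ω < -(ε / 2)})) →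
      P {ω | QuasiConsensus ε (hkState ε S x0 (fun i t => ξ i t ω))} = 0) := by
  refine ⟨?_, fun hn hε1 h => ?_⟩
  · rintro (⟨hcard, hb⟩ | ⟨hcard, hb⟩)
    · obtain ⟨s, rfl⟩ := Finset.card_eq_one.1 hcard
      refine measure_consensusTime_lt_top hmeas hindep hident hmean hsq hvar hx0 hb
        (fun u hu i j => ?_) fun a ha hab => leads_opinionDiam_le_of_singleton ha hab
      simp only [Finset.mem_singleton]
      split_ifs with hi hj hj
      · rw [hi, hj, sub_self, abs_zero]; exact hε.1.le
      · simpa using hu i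
      · simpa using hu j
      · simpa using hε.1.le
    · refine measure_consensusTime_lt_top hmeas hindep hident hmean hsq hvar hx0 hb
        (fun u hu i j => ?_) fun a ha hab => leads_opinionDiam_le_of_half hS ha hab
      have hle : ∀ i, |if i ∈ S then u i else 0| ≤ ε / 2 := by
        intro i
        split_ifs
        · exact hu i
        · rw [abs_zero]; linarith [hε.1]
      exact (abs_sub _ _).trans (by linarith [hle i, hle j])
  · obtain ⟨Ip, Im, e, he, h1, h2, h3, h4, h5⟩ : ∃ Ip Im e, 0 < e ∧ MeasurableSet Ip ∧
        MeasurableSet Im ∧ 0 < P (ξ 0 1 ⁻¹' Ip) ∧ 0 < P (ξ 0 1 ⁻¹' Im) ∧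
        Leads ε S Ip Im (fun _ => True) (fun x => ε + e < opinionDiam x) := by
      rcases h with ⟨hcard, hp, hm⟩ | ⟨hcard, hp, hm⟩
      · obtain ⟨s, rfl⟩ := Finset.card_eq_one.1 hcard
        exact exists_leads_of_singleton hn hε.1 hε1 hp hm
      · exact exists_leads_of_half hcard hε.1 hε1 hp hm
    exact measure_quasiConsensus_eq_zero hmeas hindep hident hx0 he h1 h2 h3 h4 h5
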